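/- **Conventions.** $\log$ is the binary logarithm, and values of logarithms are rounded down to integers; all functions map positive integers to positive integers. Languages are subsets of $\{0,1\}^*$. Machines are multi-tape Turing machines. * $\mathrm{NTIME}(t(n))$ is the class of languages accepted by nondeterministic Turing machines in time $O(t(n))$: each word $x$ of the language has an accepting computation of length $O(t(|x|))$, and no other word has an accepting computation. * $\mathrm{BTIME}(t(n))$ is the class of languages decided with two-sided error, bounded by a constant less than $1/2$, by probabilistic Turing machines that halt in $O(t(n))$ steps for all inputs and all coin flips. * A language $L$ is $f(n)$-sparse if it has at most $f(n)$ words of length $n$ for all large $n$. * $\mathrm{GF}(2^k)$ is represented by an irreducible polynomial $p(u)$ of degree $k$ over $\mathrm{GF}(2)$; its elements are the polynomials of degree less than $k$, written as strings of $k$ bits, with operations modulo $p$. A string $a_0\cdots a_{m-1}$, $m\le k$, is converted into the element $\sum_i a_iu^i$. * $\mathrm{Streaming}(r_0(n),r_1(n),s(n),u(n),r_2(n))$ is the class of languages decided, with two-sided error bounded by a constant less than $1/2$, by a one-pass algorithm that has the input $(n,x)$, where $n=|x|\ge 1$ is given in binary and $x$ is read as a stream, and that 1. deterministically generates from $n$,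 in time $O(r_0(n))$, a representation of a field $\mathrm{GF}(2^k)$; 2. takes $O(r_1(n))$ randomized steps before reading the first bit of $x$; 3. keeps a memory of $O(s(n))$ cells, which includes the representation of the field, from the end of step 1 until the stream has been read and processed; 4. after reading each bit, deterministically takes $O(u(n))$ steps, where a conversion of a string of length at most $k$ into a field element, an addition in $\mathrm{GF}(2^k)$ and a multiplication in $\mathrm{GF}(2^k)$ each count as one step; 5. takes $O(r_2(n))$ randomized steps after the entire input has been read. **Theorem.** Let $u_1,u_2,f,t_1,t_2,t_3$ be nondecreasing functions such that a deterministic Turing machine generates, on input $1^m$, an irreducible polynomial of degree $m$ over $\mathrm{GF}(2)$ in time $O(u_1(m))$, and such that deterministic Turing machines perform the operations $+$ and $\cdot$ of $\mathrm{GF}(2^m)$ (given an irreducible polynomial of degree $m$ representing the field, and the two operands) in time $O(u_2(m))$. Let $v(n)=\log n+\log f(n)$, and suppose that $f(n)\le 2^{n/2}$ and $$10v(n)+t_1(n)+u_1(10v(n))+n\cdot u_2(10v(n))\le t_2(v(n))$$ for all large $n$. Suppose also that $v(n)$ (in unary) can be computed from $n$ (in binary) in time $O(u_1(10v(n)))$.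 If there is an $f(n)$-sparse language $L\in\mathrm{NTIME}(t_1(n))$ with $$L\notin \mathrm{Streaming}\bigl(u_1(10v(n)),\,v(n),\,v(n),\,1,\,t_3(10v(n))\bigr),$$ then there is a language $A$ with $A\in\mathrm{NTIME}(t_2(n))$ and $A\notin\mathrm{BTIME}(t_3(n))$. -/

import Mathlib

open Polynomial Filter

/-! ### Multi-tape machines

All machines have finitely many two-way infinite tapes over the alphabet `{blank, 0, 1}`
(`none`, `some false`, `some true`).  A larger finite alphabet can be coded on several tapes
moving in parallel, at no cost in time, because the number of tapes is arbitrary. -/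

/-- Head moves. -/
inductive Move where
  | left
  | stay
  | right

/-- The displacement of a head move. -/
def Move.toInt : Move → ℤ
  | .left => -1
  | .stay => 0
  | .right => 1

/-- A configuration: control state, head positions and tape contents (tapes indexed by `ι`). -/
structure Cfg (Q ι : Type) where
  state : Q
  head : ι → ℤ
  cell : ι → ℤ → Option Bool

/-- An action of a machine: new state and, for each tape, the symbol written and the head move. -/
abbrev Act (Q ι : Type) : Type := Q × (ι → Option Bool × Move)

namespace Cfg

variable {Q ι : Type}

/-- The symbols under the heads. -/
def scan (c : Cfg Q ι) : ι → Option Bool := fun i => c.cell i (c.head i)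

/-- The result of one action. -/
def apply (c : Cfg Q ι) (a : Act Q ι) : Cfg Q ι where
  state := a.1
  head := fun i => c.head i + (a.2 i).2.toInt
  cell := fun i => Function.update (c.cell i) (c.head i) (a.2 i).1

/-- The tape holding the string `s` in the cells `0, …, |s| - 1`, blank elsewhere. -/
def tapeOf (s : List Bool) : ℤ → Option Bool := fun z => if 0 ≤ z then s[z.toNat]? else none

/-- State `q`, the string `σ i` on tape `i`, all heads on cell `0`. -/
def ofStrings (q : Q) (σ : ι → List Bool) : Cfg Q ι where
  state := q
  head := fun _ => 0
  cell := fun i => tapeOf (σ i)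

/-- All heads and all nonblank cells are within distance `S` of cell `0`. -/
def FitsIn (c : Cfg Q ι) (S : ℕ) : Prop :=
  ∀ i, |c.head i| ≤ S ∧ ∀ z, c.cell i z ≠ none → |z| ≤ S

open Classical in
/-- Replace the content of tape `i` by the string `s`, with the head of tape `i` on cell `0`. -/
noncomputable def put (c : Cfg Q ι) (i : ι) (s : List Bool) : Cfg Q ι where
  state := c.state
  head := Function.update c.head i 0
  cell := Function.update c.cell i (tapeOf s)

/-- The first `k` cells of tape `i`, blanks being read as `0`. -/
def take (c : Cfg Q ι) (i : ι) (k : ℕ) : List Bool :=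
  List.ofFn fun j : Fin k => (c.cell i (j : ℤ)).getD false

end Cfg

/-! ### Nondeterministic time -/

/-- A nondeterministic Turing machine. Tape `none` is the input tape, the others are work tapes. -/
structure NTM where
  Work : Type
  State : Type
  finWork : Finite Work
  finState : Finite State
  start : State
  accept : Set State
  next : State → (Option Work → Option Bool) → Set (Act State (Option Work))

namespace NTM

/-- `c'` can be reached from `c` in exactly `t` steps. -/
def Reaches (M : NTM) : ℕ → Cfg M.State (Option M.Work) → Cfg M.State (Option M.Work) → Prop
  | 0, c, c' => c = c'
  | t + 1, c, c' => ∃ a ∈ M.next c.state c.scan, M.Reaches t (c.apply a) c'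

/-- Some computation on input `x` reaches an accepting state in at most `T` steps. -/
def AcceptsIn (M : NTM) (x : List Bool) (T : ℕ) : Prop :=
  ∃ t ≤ T, ∃ c, M.Reaches t (Cfg.ofStrings M.start fun i => i.elim x fun _ => []) c ∧
    c.state ∈ M.accept

end NTM

/-- `NTIME(t(n))`: the languages accepted by nondeterministic Turing machines in time `O(t(n))`:
every word of the language has an accepting computation of that length, and no other word has an
accepting computation. -/
def NTIME (t : ℕ → ℕ) : Set (Language Bool) :=
  {L | ∃ M : NTM, ∃ c : ℕ, ∀ x : List Bool,
    (x ∈ L → M.AcceptsIn x (c * t x.length + c)) ∧ (x ∉ L → ∀ T, ¬ M.AcceptsIn x T)}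

/-! ### Bounded-error probabilistic time -/

/-- The probability of the event `E` under the uniform distribution on the finite type `Ω`. -/
noncomputable def uniformProb {Ω : Type} [Fintype Ω] (E : Set Ω) : ℝ :=
  (E.ncard : ℝ) / Fintype.card Ω

/-- A transition rule in which each step may depend on one fair coin; `none` means halting. -/
abbrev CoinRule (Q ι : Type) : Type := Q → (ι → Option Bool) → Option (Bool → Act Q ι)

/-- One step of a coin rule with coin `b` (halted configurations do not change). -/
def CoinRule.step {Q ι : Type} (δ : CoinRule Q ι) (c : Cfg Q ι) (b : Bool) : Cfg Q ι :=
  match δ c.state c.scan with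
  | none => c
  | some a => c.apply (a b)

/-- The run of a coin rule along a list of coins. -/
def CoinRule.run {Q ι : Type} (δ : CoinRule Q ι) (c : Cfg Q ι) (ω : List Bool) : Cfg Q ι :=
  ω.foldl δ.step c

/-- The rule has halted in the configuration `c`. -/
def CoinRule.Halted {Q ι : Type} (δ : CoinRule Q ι) (c : Cfg Q ι) : Prop :=
  δ c.state c.scan = none

/-- A probabilistic Turing machine. Tape `none` is the input tape. -/
structure PTM where
  Work : Type
  State : Type
  finWork : Finite Work
  finState : Finite State
  start : State
  accept : Set State
  next : CoinRule State (Option Work)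

/-- The configuration of `M` on input `x` after `T` steps with coins `ω`. -/
def PTM.run (M : PTM) (x : List Bool) {T : ℕ} (ω : Fin T → Bool) :
    Cfg M.State (Option M.Work) :=
  M.next.run (Cfg.ofStrings M.start fun i => i.elim x fun _ => []) (List.ofFn ω)

/-- `BTIME(t(n))`: the languages with two-sided bounded-error probabilistic algorithms that halt
in time `O(t(n))` for all inputs and coins; the error is bounded by a constant below `1/2`. -/
def BTIME (t : ℕ → ℕ) : Set (Language Bool) :=
  {L | ∃ M : PTM, ∃ c : ℕ, ∃ ε : ℝ, ε < 1 / 2 ∧ ∀ x : List Bool,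
    (∀ ω : Fin (c * t x.length + c) → Bool, M.next.Halted (M.run x ω)) ∧
    (x ∈ L →
      1 - ε ≤ uniformProb {ω : Fin (c * t x.length + c) → Bool | (M.run x ω).state ∈ M.accept}) ∧
    (x ∉ L →
      uniformProb {ω : Fin (c * t x.length + c) → Bool | (M.run x ω).state ∈ M.accept} ≤ ε)}

/-! ### Deterministic computation of string functions -/

/-- A deterministic Turing machine with `r` input tapes (`inl j`), one output tape (`inr none`)
and further work tapes. The value `none` of `next` means halting. -/
structure Transducer (r : ℕ) where
  Work : Type
  State : Type
  finWork : Finite Work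
  finState : Finite State
  start : State
  next : State → (Fin r ⊕ Option Work → Option Bool) → Option (Act State (Fin r ⊕ Option Work))

/-- One step (halted configurations do not change). -/
def Transducer.step {r : ℕ} (M : Transducer r) (c : Cfg M.State (Fin r ⊕ Option M.Work)) :
    Cfg M.State (Fin r ⊕ Option M.Work) :=
  match M.next c.state c.scan with
  | none => c
  | some a => c.apply a

/-- On input `(x₁, …, x_r)` the machine halts within `T` steps with output `y`. As usual, it leaves
its input tapes as they were, its work tapes blank, and all heads on cell `0`; cleaning up costs
only a constant factor in time. -/
def Transducer.ComputesIn {r : ℕ} (M : Transducer r) (x : Fin r → List Bool) (y : List Bool)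
    (T : ℕ) : Prop :=
  ∃ q : M.State,
    M.step^[T] (Cfg.ofStrings M.start (Sum.elim x fun _ => [])) =
      Cfg.ofStrings q (Sum.elim x fun i => i.elim y fun _ => []) ∧
    M.next q (Cfg.ofStrings q (Sum.elim x fun i => i.elim y fun _ => [])).scan = none

/-! ### The fields `GF(2^k)`

`GF(2^k)` is represented by an irreducible polynomial `p` of degree `k` over `GF(2)`; its elements
are the polynomials of degree less than `k`, with addition and multiplication modulo `p`. -/

/-- `w(s, u) = ∑ a_i u^i` for the string `s = a_0 ⋯ a_{m-1}`. -/
noncomputable def segPoly (s : List Bool) : (ZMod 2)[X] :=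
  ∑ i ∈ Finset.range s.length, if s.getD i false then X ^ i else 0

/-- The string `b_{k-1} ⋯ b_0` that represents `∑ b_i u^i`. -/
noncomputable def elemBits (k : ℕ) (g : (ZMod 2)[X]) : List Bool :=
  (List.ofFn fun i : Fin k => decide (g.coeff i = 1)).reverse

/-- The polynomial represented by the string `b_{k-1} ⋯ b_0`. -/
noncomputable def elemPoly (s : List Bool) : (ZMod 2)[X] := segPoly s.reverse

/-- The string of the `deg p + 1` coefficients of `p`, which represents the field. -/
noncomputable def fieldRep (p : (ZMod 2)[X]) : List Bool := elemBits (p.natDegree + 1) p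

/-- An irreducible polynomial of degree `m` over `GF(2)` can be generated (from `m` in unary) by a
deterministic machine in time `O(u(m))`. -/
def GeneratesIrreducibleIn (u : ℕ → ℕ) : Prop :=
  ∃ G : Transducer 1, ∃ c : ℕ, ∀ m : ℕ, 1 ≤ m → ∃ p : (ZMod 2)[X],
    Irreducible p ∧ p.natDegree = m ∧
      G.ComputesIn ![List.replicate m true] (fieldRep p) (c * u m + c)

/-- The operations `+` and `·` of `GF(2^m)`, for every representation of this field by an
irreducible polynomial of degree `m`, can be carried out in time `O(u(m))`. -/
def FieldOperationsIn (u : ℕ → ℕ) : Prop :=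
  ∃ Madd Mmul : Transducer 3, ∃ c : ℕ, ∀ p : (ZMod 2)[X], Irreducible p →
    ∀ a b : (ZMod 2)[X], a.degree < p.degree → b.degree < p.degree →
      Madd.ComputesIn ![fieldRep p, elemBits p.natDegree a, elemBits p.natDegree b]
        (elemBits p.natDegree ((a + b) %ₘ p)) (c * u p.natDegree + c) ∧
      Mmul.ComputesIn ![fieldRep p, elemBits p.natDegree a, elemBits p.natDegree b]
        (elemBits p.natDegree ((a * b) %ₘ p)) (c * u p.natDegree + c)

/-- The function `v` can be computed (from `n` in binary to `v(n)` in unary) in time `O(r(n))`. -/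
def ComputableInTime (v r : ℕ → ℕ) : Prop :=
  ∃ V : Transducer 1, ∃ c : ℕ, ∀ n : ℕ, 1 ≤ n →
    V.ComputesIn ![n.bits] (List.replicate (v n) true) (c * r n + c)

/-! ### Streaming algorithms -/

/-- The instructions available while the stream is read: an ordinary Turing machine action, the
conversion of a segment into a field element, and the two field operations. Each of them counts as
one step. -/
inductive Instr (Q ι : Type) where
  | act (a : Act Q ι)
  | conv (src dst : ι) (q : Q)
  | add (x y dst : ι) (q : Q)
  | mul (x y dst : ι) (q : Q)

/-- The effect of an instruction, where `p` represents the field `GF(2^k)`, `k = deg p`. The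
conversion takes the segment `s`, `|s| ≤ k`, from the tape `src`, and writes `w(s, u)` on the tape
`dst`; the operations act on the elements on the tapes `x` and `y` and write the result
on `dst`. -/
noncomputable def Instr.exec {Q ι : Type} (p : (ZMod 2)[X]) :
    Instr Q ι → Cfg Q ι → Cfg Q ι
  | .act a, c => c.apply a
  | .conv src dst q, c =>
      { (c.put src []).put dst (elemBits p.natDegree (segPoly (c.take src p.natDegree))) with
        state := q }
  | .add x y dst q, c =>
      { c.put dst (elemBits p.natDegree
          ((elemPoly (c.take x p.natDegree) + elemPoly (c.take y p.natDegree)) %ₘ p)) with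
        state := q }
  | .mul x y dst q, c =>
      { c.put dst (elemBits p.natDegree
          ((elemPoly (c.take x p.natDegree) * elemPoly (c.take y p.natDegree)) %ₘ p)) with
        state := q }

/-- The part of a one-pass streaming algorithm that follows the generation of the field. Tape
`inl 0` initially holds `n` in binary, tape `inl 1` the field representation; the other tapes are
initially blank. In each phase the value `none` means that the phase is over.
* `pre`: the randomized steps before the first bit is read;
* `receive`: a bit of the stream enters the finite control;
* `update`: the deterministic processing after each bit;
* `post`: the randomized steps after the entire input has been read. -/
structure StreamMachine where
  Work : Type
  State : Type
  finWork : Finite Work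
  finState : Finite State
  start : State
  accept : Set State
  pre : CoinRule State (Fin 2 ⊕ Work)
  receive : Bool → State → State
  update : State → (Fin 2 ⊕ Work → Option Bool) → Option (Instr State (Fin 2 ⊕ Work))
  post : CoinRule State (Fin 2 ⊕ Work)

namespace StreamMachine

variable (M : StreamMachine)

/-- Configurations of a streaming machine. -/
abbrev Conf : Type := Cfg M.State (Fin 2 ⊕ M.Work)

/-- The configuration after the steps with coins `ω` before the first bit is read. -/
noncomputable def preRun (p : (ZMod 2)[X]) (n : ℕ) (ω : List Bool) : M.Conf :=
  M.pre.run (Cfg.ofStrings M.start (Sum.elim ![n.bits, fieldRep p] fun _ => [])) ω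

/-- A bit of the stream is received. -/
def recv (c : M.Conf) (b : Bool) : M.Conf := { c with state := M.receive b c.state }

/-- One step of the processing of a bit (no change when the processing is over). -/
noncomputable def updStep (p : (ZMod 2)[X]) (c : M.Conf) : M.Conf :=
  match M.update c.state c.scan with
  | none => c
  | some i => i.exec p c

/-- The bits `y` are read one after the other, with `N` steps after each bit. -/
noncomputable def stream (p : (ZMod 2)[X]) (N : ℕ) (c : M.Conf) (y : List Bool) : M.Conf :=
  y.foldl (fun c b => (M.updStep p)^[N] (M.recv c b)) c

/-- The last configuration on input `x`, for the coins `ω` before and `ω'` after the stream. -/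
noncomputable def fullRun (p : (ZMod 2)[X]) (x : List Bool) (N : ℕ) (ω ω' : List Bool) : M.Conf :=
  M.post.run (M.stream p N (M.preRun p x.length ω) x) ω'

/-- On input `(|x|, x)` and with the field represented by `p`, for all coins, there are at
most `T₁` steps before the first bit is read, at most `N` steps after each bit, and at most `T₂`
steps after the entire input, and the memory fits in space `S` from the time when the field
representation has been generated until the stream has been read and processed. -/
structure RunsWithin (p : (ZMod 2)[X]) (x : List Bool) (T₁ S N T₂ : ℕ) : Prop where
  pre_time : ∀ ω : Fin T₁ → Bool, M.pre.Halted (M.preRun p x.length (List.ofFn ω))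
  pre_space : ∀ ω : Fin T₁ → Bool, ∀ j : ℕ,
    (M.preRun p x.length ((List.ofFn ω).take j)).FitsIn S
  update_time : ∀ ω : Fin T₁ → Bool, ∀ (y : List Bool) (b : Bool), y ++ [b] <+: x →
    M.update (M.stream p N (M.preRun p x.length (List.ofFn ω)) (y ++ [b])).state
      (M.stream p N (M.preRun p x.length (List.ofFn ω)) (y ++ [b])).scan = none
  update_space : ∀ ω : Fin T₁ → Bool, ∀ (y : List Bool) (b : Bool), y ++ [b] <+: x →
    ∀ j ≤ N, ((M.updStep p)^[j]
      (M.recv (M.stream p N (M.preRun p x.length (List.ofFn ω)) y) b)).FitsIn S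
  post_time : ∀ (ω : Fin T₁ → Bool) (ω' : Fin T₂ → Bool),
    M.post.Halted (M.fullRun p x N (List.ofFn ω) (List.ofFn ω'))

/-- The probability that `(|x|, x)` is accepted, for the indicated numbers of steps. -/
noncomputable def acceptProb (p : (ZMod 2)[X]) (x : List Bool) (T₁ N T₂ : ℕ) : ℝ :=
  uniformProb {ω : (Fin T₁ → Bool) × (Fin T₂ → Bool) |
    (M.fullRun p x N (List.ofFn ω.1) (List.ofFn ω.2)).state ∈ M.accept}

end StreamMachine

/-- `Streaming(r₀(n), r₁(n), s(n), u(n), r₂(n))`: the languages with a one-pass streaming algorithm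
with input `(n, x)`, `n = |x| ≥ 1`, that generates from `n` a field `GF(2^k)` (machine `G`) in
time `O(r₀(n))`, takes `O(r₁(n))` random steps before reading the first bit, keeps a memory of
size `O(s(n))` (including the field representation) while the input is streamed, takes `O(u(n))`
steps, among them conversions to field elements and field operations, after reading each
bit, takes `O(r₂(n))` random steps after reading the entire input, and decides the language with
two-sided error bounded by a constant below `1/2`. -/
def Streaming (r₀ r₁ s u r₂ : ℕ → ℕ) : Set (Language Bool) :=
  {L | ∃ (G : Transducer 1) (M : StreamMachine) (c : ℕ) (ε : ℝ), ε < 1 / 2 ∧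
    ∀ n : ℕ, 1 ≤ n → ∃ p : (ZMod 2)[X], Irreducible p ∧
      G.ComputesIn ![n.bits] (fieldRep p) (c * r₀ n + c) ∧
      ∀ x : List Bool, x.length = n →
        M.RunsWithin p x (c * r₁ n + c) (c * s n + c) (c * u n + c) (c * r₂ n + c) ∧
        (x ∈ L →
          1 - ε ≤ M.acceptProb p x (c * r₁ n + c) (c * u n + c) (c * r₂ n + c)) ∧
        (x ∉ L →
          M.acceptProb p x (c * r₁ n + c) (c * u n + c) (c * r₂ n + c) ≤ ε)}

/-! ### Sparse languages -/

/-- `L` is `f(n)`-sparse: it has at most `f(n)` words of length `n`, for all large `n`. -/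
def IsSparse (f : ℕ → ℕ) (L : Language Bool) : Prop :=
  ∀ᶠ n in atTop, {x : List Bool | x ∈ L ∧ x.length = n}.ncard ≤ f n

/-- `v(n) = log n + log f(n)`, with binary logarithms rounded down. -/
def logSize (f : ℕ → ℕ) (n : ℕ) : ℕ := Nat.log 2 n + Nat.log 2 (f n)

/-!
The language `A` consists of codes of triples `(n, z, h)` such that some word `y ∈ L` of length `n`
has the hash value `h` for the key `z` (`hashLanguage`). Key and hash value are elements of
`GF(2^k)` with `k = 2 v(n) + 2`, and the hash value of `b₁ ⋯ b_n` is `∑ b_i z^(n-i)`, evaluated by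
Horner's rule (`hashPoly`). The code interleaves the three components, each as a string of `k`
letters, so that it has length `3 k`, which is `O(v(n))`.

`A ∈ NTIME t₂` (`hashLanguage_mem_NTIME`): a machine generates the field from `n`
(`exists_field_generator`), guesses `y`, computes its hash value with `n` multiplications, compares
it with `h` (`Verifier.exec_program`), and finally runs the machine for `L` on `y`. The part
between the guess and the final run is deterministic, and it is built from small programs (`Prog`)
with explicit running times; `exists_guess_verify` puts the parts together. The cost of the remaining elementary
operations per letter is `O(k)`, and it is covered by `u₂`, because a machine that multiplies has to
write `k` letters.

`A ∉ BTIME t₃`, for otherwise `L` has a streaming algorithm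
(`mem_Streaming_of_hashLanguage_mem_BTIME`). It draws a random key `z`, computes the hash value `h`
of the stream with one multiplication and one addition for each bit, and runs the probabilistic
machine for `A` on the code of `(n, z, h)`. The code is not written down: the head of the simulated
machine moves over three tapes in turn (`Simulates`). If `x ∈ L`, the code is in `A`. If `x ∉ L`, it
is in `A` only if `x` has the same hash value as another word of `L` of the same length. Two
different words collide for at most `n` keys, the roots of a nonzero polynomial of degree less than
`n` (`ncard_collision_le`), and there are at most `f(n)` words in `L`. Hence the fraction of bad
keys is at most `n f(n) / 2^k ≤ 2^(-v(n))` (`uniformProb_badKeys_le`), which is added to the error.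
This is harmless for all but finitely many lengths. Words of the remaining lengths are stored in the
finite control and looked up in a table.
-/

/-! ### Tapes -/

/-- A single tape together with the position of its head. -/
@[ext]
structure Tape where
  head : ℤ
  cell : ℤ → Option Bool

namespace Tape

/-- The symbol under the head. -/
def read (τ : Tape) : Option Bool := τ.cell τ.head

/-- Write a symbol and move the head. -/
def step (τ : Tape) (w : Option Bool × Move) : Tape where
  head := τ.head + w.2.toInt
  cell := Function.update τ.cell τ.head w.1

/-- The tape with the string `l.reverse ++ r` from cell `0` on, whose head is on the first letter
of `r` (on the blank after the string, if `r` is empty). -/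
def zip (l r : List Bool) : Tape where
  head := l.length
  cell := Cfg.tapeOf (l.reverse ++ r)

/-- The tape with the string `r` from cell `0` on, whose head is on cell `-1`. -/
def leftEnd (r : List Bool) : Tape where
  head := -1
  cell := Cfg.tapeOf r

/-- The tape with the string `s` from cell `0` on, whose head is on cell `0`. -/
abbrev ofList (s : List Bool) : Tape := zip [] s

theorem tapeOf_natCast (s : List Bool) (i : ℕ) : Cfg.tapeOf s i = s[i]? := by
  simp [Cfg.tapeOf]

theorem tapeOf_neg (s : List Bool) {z : ℤ} (hz : z < 0) : Cfg.tapeOf s z = none := by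
  simp [Cfg.tapeOf, hz]

theorem update_tapeOf {s s' : List Bool} {i : ℕ} {x : Option Bool} (h : s'[i]? = x)
    (h' : ∀ j, j ≠ i → s'[j]? = s[j]?) :
    Function.update (Cfg.tapeOf s) (i : ℤ) x = Cfg.tapeOf s' := by
  funext z
  rcases lt_or_ge z 0 with hz | hz
  · rw [Function.update_of_ne (by omega), tapeOf_neg _ hz, tapeOf_neg _ hz]
  · obtain ⟨j, rfl⟩ := Int.eq_ofNat_of_zero_le hz
    by_cases hj : j = i
    · subst hj
      simp [tapeOf_natCast, h]
    · rw [Function.update_of_ne (by omega), tapeOf_natCast, tapeOf_natCast, h' j hj]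

@[simp] theorem read_zip (l r : List Bool) : (zip l r).read = r.head? := by
  cases r <;> simp [read, zip, tapeOf_natCast]

@[simp] theorem read_leftEnd (r : List Bool) : (leftEnd r).read = none := by
  simp [read, leftEnd, tapeOf_neg]

@[simp] theorem step_read_stay (τ : Tape) : τ.step (τ.read, .stay) = τ := by
  ext <;> simp [step, read, Move.toInt]

theorem step_stay_of_read {τ : Tape} {x : Option Bool} (h : τ.read = x) :
    τ.step (x, .stay) = τ := by
  rw [← h, step_read_stay]

theorem update_zip_cons (l r : List Bool) (b b' : Bool) :
    Function.update (Cfg.tapeOf (l.reverse ++ b :: r)) (l.length : ℤ) (some b')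
      = Cfg.tapeOf (l.reverse ++ b' :: r) := by
  apply update_tapeOf
  · simp
  · intro j hj
    rcases lt_or_ge j l.length with h | h
    · rw [List.getElem?_append_left (by simpa), List.getElem?_append_left (by simpa)]
    · rw [List.getElem?_append_right (by simpa), List.getElem?_append_right (by simpa)]
      obtain ⟨m, hm⟩ : ∃ m, j - l.reverse.length = m + 1 :=
        ⟨j - l.length - 1, by simp; omega⟩
      rw [hm]; simp

theorem update_zip_nil (l : List Bool) (b' : Bool) :
    Function.update (Cfg.tapeOf l.reverse) (l.length : ℤ) (some b')
      = Cfg.tapeOf (l.reverse ++ [b']) := by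
  apply update_tapeOf
  · simp
  · intro j hj
    rcases lt_or_ge j l.length with h | h
    · rw [List.getElem?_append_left (by simpa)]
    · rw [List.getElem?_eq_none (by simp; omega), List.getElem?_eq_none (by simp; omega)]

theorem update_zip_erase (l : List Bool) (b : Bool) :
    Function.update (Cfg.tapeOf (l.reverse ++ [b])) (l.length : ℤ) none
      = Cfg.tapeOf l.reverse := by
  apply update_tapeOf
  · simp
  · intro j hj
    rcases lt_or_ge j l.length with h | h
    · rw [List.getElem?_append_left (by simpa)]
    · rw [List.getElem?_eq_none (by simp; omega), List.getElem?_eq_none (by simp; omega)]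

theorem update_zip_none (l : List Bool) :
    Function.update (Cfg.tapeOf l.reverse) (l.length : ℤ) none = Cfg.tapeOf l.reverse :=
  update_tapeOf (by simp) fun _ _ => rfl

@[simp] theorem step_right_cons (l r : List Bool) (b b' : Bool) :
    (zip l (b :: r)).step (some b', .right) = zip (b' :: l) r := by
  ext1
  · simp [step, zip, Move.toInt]
  · simpa [step, zip] using update_zip_cons l r b b'

@[simp] theorem step_right_nil (l : List Bool) (b' : Bool) :
    (zip l []).step (some b', .right) = zip (b' :: l) [] := by
  ext1
  · simp [step, zip, Move.toInt]
  · simpa [step, zip] using update_zip_nil l b'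

theorem step_left_cons_zip (a : Bool) (l r : List Bool) (b b' : Bool) :
    (zip (a :: l) (b :: r)).step (some b', .left) = zip l (a :: b' :: r) := by
  ext1
  · simp [step, zip, Move.toInt]
  · simpa [step, zip] using update_zip_cons (a :: l) r b b'

theorem step_left_cons_leftEnd (r : List Bool) (b b' : Bool) :
    (zip [] (b :: r)).step (some b', .left) = leftEnd (b' :: r) := by
  ext1
  · simp [step, zip, leftEnd, Move.toInt]
  · simpa [step, zip, leftEnd] using update_zip_cons [] r b b'

theorem step_right_leftEnd (r : List Bool) :
    (leftEnd r).step (none, .right) = zip [] r := by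
  ext1
  · simp [step, zip, leftEnd, Move.toInt]
  · have : Cfg.tapeOf r (-1) = none := tapeOf_neg _ (by norm_num)
    simp [step, zip, leftEnd, ← this]

/-- The tape with the string `l.reverse ++ r` from cell `0` on, whose head is on the last letter
of `l.reverse` (on cell `-1`, if `l` is empty). -/
def back (l r : List Bool) : Tape :=
  match l with
  | [] => leftEnd r
  | a :: l => zip l (a :: r)

@[simp] theorem read_back (l r : List Bool) : (back l r).read = l.head? := by
  cases l <;> simp [back]

@[simp] theorem step_left_cons (l r : List Bool) (b b' : Bool) :
    (zip l (b :: r)).step (some b', .left) = back l (b' :: r) := by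
  cases l
  · exact step_left_cons_leftEnd ..
  · exact step_left_cons_zip ..

@[simp] theorem step_left_nil (l : List Bool) :
    (zip l []).step (none, .left) = back l [] := by
  cases l with
  | nil =>
    ext1
    · simp [step, zip, back, leftEnd, Move.toInt]
    · simpa [step, zip, back, leftEnd] using update_zip_none []
  | cons a l =>
    ext1
    · simp [step, zip, back, Move.toInt]
    · simpa [step, zip, back] using update_zip_none (a :: l)

@[simp] theorem step_left_erase (l : List Bool) (b : Bool) :
    (zip l [b]).step (none, .left) = back l [] := by
  cases l with
  | nil =>
    ext1
    · simp [step, zip, back, leftEnd, Move.toInt]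
    · simpa [step, zip, back, leftEnd] using update_zip_erase [] b
  | cons a l =>
    ext1
    · simp [step, zip, back, Move.toInt]
    · simpa [step, zip, back] using update_zip_erase (a :: l) b

@[simp] theorem back_step_left (a : Bool) (l r : List Bool) (b' : Bool) :
    (back (a :: l) r).step (some b', .left) = back l (b' :: r) :=
  step_left_cons ..

@[simp] theorem back_step_erase (a : Bool) (l : List Bool) :
    (back (a :: l) []).step (none, .left) = back l [] :=
  step_left_erase ..

@[simp] theorem back_step_right (r : List Bool) :
    (back [] r).step (none, .right) = zip [] r :=
  step_right_leftEnd r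

@[simp] theorem back_cons_step_stay (a : Bool) (l r : List Bool) (b' : Bool) :
    (back (a :: l) r).step (some b', .stay) = zip l (b' :: r) := by
  ext1
  · simp [back, step, zip, Move.toInt]
  · simpa [back, step, zip] using update_zip_cons l r a b'

@[simp] theorem step_stay_cons (l r : List Bool) (b b' : Bool) :
    (zip l (b :: r)).step (some b', .stay) = zip l (b' :: r) := by
  ext1
  · simp [step, zip, Move.toInt]
  · simpa [step, zip] using update_zip_cons l r b b'

@[simp] theorem step_stay_nil (l : List Bool) (b' : Bool) :
    (zip l []).step (some b', .stay) = zip l [b'] := by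
  ext1
  · simp [step, zip, Move.toInt]
  · simpa [step, zip] using update_zip_nil l b'

@[simp] theorem step_stay_blank (l : List Bool) :
    (zip l []).step (none, .stay) = zip l [] := by
  ext1
  · simp [step, zip, Move.toInt]
  · simpa [step, zip] using update_zip_none l

end Tape

/-- The configuration with state `q` and tapes `τ`. -/
def Cfg.ofTapes {Q ι : Type} (q : Q) (τ : ι → Tape) : Cfg Q ι where
  state := q
  head := fun i => (τ i).head
  cell := fun i => (τ i).cell

theorem Cfg.ofStrings_eq_ofTapes {Q ι : Type} (q : Q) (σ : ι → List Bool) :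
    Cfg.ofStrings q σ = Cfg.ofTapes q fun i => Tape.ofList (σ i) := by
  simp [Cfg.ofStrings, Cfg.ofTapes, Tape.zip]

/-- The tapes of a configuration. -/
def Cfg.tapes {Q ι : Type} (c : Cfg Q ι) : ι → Tape := fun i => ⟨c.head i, c.cell i⟩

/-! ### Deterministic programs -/

/-- A deterministic multi-tape program with exit values in `E`. Every step leads to a new state or
leaves the program with an exit value. -/
structure Prog (ι E : Type) where
  State : Type
  finState : Finite State
  start : State
  next : State → (ι → Option Bool) → (State ⊕ E) × (ι → Option Bool × Move)

namespace Prog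

variable {ι κ E F : Type}

/-- From state `q` and tapes `τ`, the program exits after exactly `t` steps with the value `e` and
tapes `τ'`. -/
inductive Run (P : Prog ι E) : P.State → (ι → Tape) → ℕ → E → (ι → Tape) → Prop
  | exit {q τ e w τ'} (h : P.next q (fun i => (τ i).read) = (Sum.inr e, w))
      (hτ : (fun i => (τ i).step (w i)) = τ') : Run P q τ 1 e τ'
  | step {q τ q' w τ₁ t e τ'} (h : P.next q (fun i => (τ i).read) = (Sum.inl q', w))
      (hτ : (fun i => (τ i).step (w i)) = τ₁) (hr : Run P q' τ₁ t e τ') : Run P q τ (t + 1) e τ'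

theorem Run.step_of {P : Prog ι E} {q q' : P.State} {τ τ₁ τ' : ι → Tape} {s : ι → Option Bool}
    {w : ι → Option Bool × Move} {t : ℕ} {e : E} (hs : ∀ i, (τ i).read = s i)
    (h : P.next q s = (Sum.inl q', w)) (hτ : ∀ i, (τ i).step (w i) = τ₁ i)
    (hr : Run P q' τ₁ t e τ') : Run P q τ (t + 1) e τ' :=
  .step (by rw [← h, ← funext hs]) (funext hτ) hr

theorem Run.exit_of {P : Prog ι E} {q : P.State} {τ τ' : ι → Tape} {s : ι → Option Bool}
    {w : ι → Option Bool × Move} {e : E} (hs : ∀ i, (τ i).read = s i)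
    (h : P.next q s = (Sum.inr e, w)) (hτ : ∀ i, (τ i).step (w i) = τ' i) :
    Run P q τ 1 e τ' :=
  .exit (by rw [← h, ← funext hs]) (funext hτ)

/-- From its start state and tapes `τ`, the program exits within `B` steps with the value `e` and
tapes `τ'`. -/
def Exec (P : Prog ι E) (τ : ι → Tape) (e : E) (τ' : ι → Tape) (B : ℕ) : Prop :=
  ∃ t ≤ B, P.Run P.start τ t e τ'

theorem Run.exec {P : Prog ι E} {τ τ' : ι → Tape} {q : P.State} {t B : ℕ} {e : E}
    (h : P.Run q τ t e τ') (hq : P.start = q) (ht : t ≤ B) : P.Exec τ e τ' B :=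
  ⟨t, ht, hq ▸ h⟩

theorem Exec.mono {P : Prog ι E} {τ τ' : ι → Tape} {e : E} {B B' : ℕ}
    (h : P.Exec τ e τ' B) (hB : B ≤ B') : P.Exec τ e τ' B' :=
  let ⟨t, ht, hr⟩ := h
  ⟨t, ht.trans hB, hr⟩

/-- Do one step and exit. -/
def act (g : (ι → Option Bool) → E × (ι → Option Bool × Move)) : Prog ι E where
  State := Unit
  finState := inferInstance
  start := ()
  next := fun _ s => (Sum.inr (g s).1, (g s).2)

theorem exec_act (g : (ι → Option Bool) → E × (ι → Option Bool × Move)) {τ τ' : ι → Tape} {e : E}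
    (h : (g fun i => (τ i).read).1 = e)
    (hτ : (fun i => (τ i).step ((g fun i => (τ i).read).2 i)) = τ') : (act g).Exec τ e τ' 1 :=
  ⟨1, le_rfl, Run.exit (P := act g) (by rw [← h]; rfl) hτ⟩

/-- Exit with the value `e` without changing the tapes. -/
def ret (e : E) : Prog ι E := act fun s => (e, fun i => (s i, .stay))

theorem exec_ret (e : E) (τ : ι → Tape) : (ret e).Exec τ e τ 1 :=
  exec_act _ rfl (by funext i; simp)

/-- Run `P`, then the program selected by its exit value. -/
def bind [Finite E] (P : Prog ι E) (Q : E → Prog ι F) : Prog ι F where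
  State := P.State ⊕ Σ e, (Q e).State
  finState :=
    have := P.finState
    have := fun e => (Q e).finState
    inferInstance
  start := Sum.inl P.start
  next := fun q s => match q with
    | Sum.inl q => match P.next q s with
      | (Sum.inl q', w) => (Sum.inl (Sum.inl q'), w)
      | (Sum.inr e, w) => (Sum.inl (Sum.inr ⟨e, (Q e).start⟩), w)
    | Sum.inr ⟨e, q⟩ => match (Q e).next q s with
      | (Sum.inl q', w) => (Sum.inl (Sum.inr ⟨e, q'⟩), w)
      | (Sum.inr f, w) => (Sum.inr f, w)

theorem Run.bind_right [Finite E] {P : Prog ι E} {Q : E → Prog ι F} {e : E} {q : (Q e).State}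
    {τ τ' : ι → Tape} {t : ℕ} {f : F} (h : (Q e).Run q τ t f τ') :
    (P.bind Q).Run (Sum.inr ⟨e, q⟩) τ t f τ' := by
  induction h with
  | exit h hτ => exact .exit (by simp [bind, h]) hτ
  | step h hτ _ ih => exact .step (by simp only [bind, h]) hτ ih

theorem Run.bind [Finite E] {P : Prog ι E} {Q : E → Prog ι F} {e : E} {q : P.State}
    {τ τ₁ τ' : ι → Tape} {t t' : ℕ} {f : F} (h : P.Run q τ t e τ₁)
    (h' : (Q e).Run (Q e).start τ₁ t' f τ') :
    (P.bind Q).Run (Sum.inl q) τ (t' + t) f τ' := by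
  induction h with
  | exit h hτ => exact .step (by simp only [Prog.bind, h]) hτ h'.bind_right
  | step h hτ _ ih => exact .step (by simp only [Prog.bind, h]) hτ (ih h')

theorem Exec.bind [Finite E] {P : Prog ι E} {Q : E → Prog ι F} {e : E}
    {τ τ₁ τ' : ι → Tape} {B B' : ℕ} {f : F} (h : P.Exec τ e τ₁ B) (h' : (Q e).Exec τ₁ f τ' B') :
    (P.bind Q).Exec τ f τ' (B + B') := by
  obtain ⟨t, ht, hr⟩ := h
  obtain ⟨t', ht', hr'⟩ := h'
  exact ⟨t' + t, by omega, hr.bind hr'⟩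

/-- Repeat `P` until it exits with a value `some f`. -/
def loop (P : Prog ι (Option F)) : Prog ι F where
  State := P.State
  finState := P.finState
  start := P.start
  next := fun q s => match P.next q s with
    | (Sum.inl q', w) => (Sum.inl q', w)
    | (Sum.inr none, w) => (Sum.inl P.start, w)
    | (Sum.inr (some f), w) => (Sum.inr f, w)

theorem Exec.loop_done {P : Prog ι (Option F)} {τ τ' : ι → Tape} {f : F} {B : ℕ}
    (h : P.Exec τ (some f) τ' B) : P.loop.Exec τ f τ' B := by
  obtain ⟨t, ht, hr⟩ := h
  refine ⟨t, ht, ?_⟩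
  change P.loop.Run P.start τ t f τ'
  clear ht
  generalize P.start = q at hr ⊢
  generalize he : some f = e at hr
  induction hr with
  | exit h hτ => subst he; exact .exit (by simp [loop, h]) hτ
  | step h hτ _ ih => exact .step (by simp only [loop, h]) hτ (ih he)

theorem Exec.loop_again {P : Prog ι (Option F)} {τ τ₁ τ' : ι → Tape} {f : F} {B B' : ℕ}
    (h : P.Exec τ none τ₁ B) (h' : P.loop.Exec τ₁ f τ' B') : P.loop.Exec τ f τ' (B + B') := by
  obtain ⟨t, ht, hr⟩ := h
  obtain ⟨t', ht', hr'⟩ := h'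
  refine ⟨t' + t, by omega, ?_⟩
  change P.loop.Run P.start τ (t' + t) f τ'
  clear ht
  generalize hq : P.start = q at hr ⊢
  replace hq : P.loop.start = P.start := rfl
  rw [hq] at hr'
  clear hq
  generalize he : none = e at hr
  induction hr with
  | exit h hτ => subst he; exact .step (by simp only [loop, h]) hτ hr'
  | step h hτ _ ih => exact .step (by simp only [loop, h]) hτ (ih hr' he)

/-- The program `P` acting on the tapes selected by `j`. -/
noncomputable def map (j : κ → ι) (P : Prog κ E) : Prog ι E where
  State := P.State
  finState := P.finState
  start := P.start
  next := fun q s => ((P.next q (s ∘ j)).1,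
    Function.extend j (P.next q (s ∘ j)).2 fun i => (s i, .stay))

theorem Run.map {j : κ → ι} (hj : j.Injective) {P : Prog κ E} {q : P.State} {τ₀ τ₀' : κ → Tape}
    {t : ℕ} {e : E} (h : P.Run q τ₀ t e τ₀') {τ τ' : ι → Tape} (hτ : ∀ x, τ (j x) = τ₀ x)
    (hτ' : ∀ x, τ' (j x) = τ₀' x) (hne : ∀ i, (∀ x, j x ≠ i) → τ' i = τ i) :
    (P.map j).Run q τ t e τ' := by
  induction h generalizing τ with
  | @exit q τ₀ e w τ₀' h hs =>
    have h0 : (fun i => (τ i).read) ∘ j = fun x => (τ₀ x).read := by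
      funext x; simp [hτ]
    have h1 : (P.map j).next q (fun i => (τ i).read)
        = (Sum.inr e, Function.extend j w fun i => ((τ i).read, .stay)) := by
      simp only [Prog.map, h0, h]
    refine .exit h1 ?_
    funext i
    by_cases hi : ∃ x, j x = i
    · obtain ⟨x, rfl⟩ := hi
      rw [hj.extend_apply, hτ, hτ', ← hs]
    · rw [Function.extend_apply' _ _ _ hi, Tape.step_read_stay,
        hne i fun x hx => hi ⟨x, hx⟩]
  | @step q τ₀ q' w τ₁ t e τ₀' h hs _ ih =>
    have h0 : (fun i => (τ i).read) ∘ j = fun x => (τ₀ x).read := by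
      funext x; simp [hτ]
    have h1 : (P.map j).next q (fun i => (τ i).read)
        = (Sum.inl q', Function.extend j w fun i => ((τ i).read, .stay)) := by
      simp only [Prog.map, h0, h]
    refine .step h1 rfl (ih ?_ hτ' ?_)
    · intro x
      rw [hj.extend_apply, hτ, ← hs]
    · intro i hi
      rw [Function.extend_apply' _ _ _ (fun ⟨x, hx⟩ => hi x hx), Tape.step_read_stay, hne i hi]

theorem Exec.map {j : κ → ι} (hj : j.Injective) {P : Prog κ E} {τ₀ τ₀' : κ → Tape}
    {B : ℕ} {e : E} (h : P.Exec τ₀ e τ₀' B) {τ τ' : ι → Tape} (hτ : ∀ x, τ (j x) = τ₀ x)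
    (hτ' : ∀ x, τ' (j x) = τ₀' x) (hne : ∀ i, (∀ x, j x ≠ i) → τ' i = τ i) :
    (P.map j).Exec τ e τ' B :=
  let ⟨t, ht, hr⟩ := h
  ⟨t, ht, hr.map hj hτ hτ' hne⟩

theorem Exec.map_extend {j : κ → ι} (hj : j.Injective) {P : Prog κ E} {τ₀ τ₀' : κ → Tape}
    {B : ℕ} {e : E} (h : P.Exec τ₀ e τ₀' B) {τ : ι → Tape} (hτ : ∀ x, τ (j x) = τ₀ x) :
    (P.map j).Exec τ e (Function.extend j τ₀' τ) B :=
  h.map hj hτ (fun x => hj.extend_apply _ _ x)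
    fun _ hi => Function.extend_apply' _ _ _ fun ⟨x, hx⟩ => hi x hx

theorem Run.unique {P : Prog ι E} {q : P.State} {τ τ₁ τ₂ : ι → Tape} {t₁ t₂ : ℕ} {e₁ e₂ : E}
    (h₁ : P.Run q τ t₁ e₁ τ₁) (h₂ : P.Run q τ t₂ e₂ τ₂) : e₁ = e₂ ∧ τ₁ = τ₂ := by
  induction h₁ generalizing t₂ with
  | exit h hτ =>
    cases h₂ with
    | exit h' hτ' =>
      rw [h] at h'
      obtain ⟨h1, rfl⟩ := Prod.mk.inj h'
      exact ⟨Sum.inr.inj h1, hτ.symm.trans hτ'⟩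
    | step h' => rw [h] at h'; simp at h'
  | step h hτ _ ih =>
    cases h₂ with
    | exit h' hτ' => rw [h] at h'; simp at h'
    | step h' hτ' hr =>
      rw [h] at h'
      obtain ⟨h1, rfl⟩ := Prod.mk.inj h'
      cases Sum.inl.inj h1
      subst hτ hτ'
      exact ih hr

/-! ### Programs and transducers -/

/-- The program of a deterministic machine; it exits when the machine halts. -/
def ofTransducer {r : ℕ} (M : Transducer r) : Prog (Fin r ⊕ Option M.Work) Unit where
  State := M.State
  finState := M.finState
  start := M.start
  next := fun q s => match M.next q s with
    | none => (Sum.inr (), fun i => (s i, .stay))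
    | some a => (Sum.inl a.1, a.2)

theorem next_ofTransducer_none {r : ℕ} {M : Transducer r} {q : M.State}
    {s : Fin r ⊕ Option M.Work → Option Bool} (h : M.next q s = none) :
    (ofTransducer M).next q s = (Sum.inr (), fun i => (s i, .stay)) := by
  simp [ofTransducer, h]

theorem next_ofTransducer_some {r : ℕ} {M : Transducer r} {q : M.State}
    {s : Fin r ⊕ Option M.Work → Option Bool} {a : Act M.State (Fin r ⊕ Option M.Work)}
    (h : M.next q s = some a) : (ofTransducer M).next q s = (Sum.inl a.1, a.2) := by
  simp [ofTransducer, h]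

theorem run_ofTransducer {r : ℕ} (M : Transducer r) (T : ℕ)
    (c c' : Cfg M.State (Fin r ⊕ Option M.Work)) (h : M.step^[T] c = c')
    (h' : M.next c'.state c'.scan = none) :
    ∃ t ≤ T + 1, (ofTransducer M).Run c.state c.tapes t () c'.tapes := by
  induction T generalizing c with
  | zero =>
    subst h
    exact ⟨1, le_rfl, .exit (next_ofTransducer_none h')
      (by funext i; exact Tape.step_read_stay _)⟩
  | succ T ih =>
    rw [Function.iterate_succ_apply] at h
    cases hn : M.next c.state c.scan with
    | none =>
      have hs : M.step c = c := by simp [Transducer.step, hn]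
      rw [hs] at h
      obtain ⟨t, ht, hr⟩ := ih c h
      exact ⟨t, by omega, hr⟩
    | some a =>
      have hs : M.step c = c.apply a := by simp [Transducer.step, hn]
      rw [hs] at h
      obtain ⟨t, ht, hr⟩ := ih _ h
      exact ⟨t + 1, by omega, .step (next_ofTransducer_some hn) rfl hr⟩

theorem exec_ofTransducer {r : ℕ} {M : Transducer r} {x : Fin r → List Bool} {y : List Bool}
    {T : ℕ} (h : M.ComputesIn x y T) :
    (ofTransducer M).Exec (Sum.elim (fun i => Tape.ofList (x i)) fun _ => Tape.ofList []) ()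
      (Sum.elim (fun i => Tape.ofList (x i))
        fun i => i.elim (Tape.ofList y) fun _ => Tape.ofList []) (T + 1) := by
  obtain ⟨q, h1, h2⟩ := h
  obtain ⟨t, ht, hr⟩ := run_ofTransducer M T _ _ h1 h2
  refine ⟨t, ht, ?_⟩
  have e1 : (Cfg.ofStrings M.start (Sum.elim x fun _ : Option M.Work => [])).tapes
      = Sum.elim (fun i => Tape.ofList (x i)) fun _ => Tape.ofList [] := by
    funext i
    rcases i with i | i <;> simp [Cfg.tapes, Cfg.ofStrings, Tape.zip]
  have e2 : (Cfg.ofStrings q (Sum.elim x fun i : Option M.Work => i.elim y fun _ => [])).tapes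
      = Sum.elim (fun i => Tape.ofList (x i))
        fun i => i.elim (Tape.ofList y) fun _ => Tape.ofList [] := by
    funext i
    rcases i with i | _ | i <;> simp [Cfg.tapes, Cfg.ofStrings, Tape.zip]
  rw [e1, e2] at hr
  exact hr

/-- The deterministic machine that executes a program and halts when the program exits. -/
def toTransducer {r : ℕ} {W : Type} [Finite W] [Finite E] (P : Prog (Fin r ⊕ Option W) E) :
    Transducer r where
  Work := W
  State := P.State ⊕ E
  finWork := inferInstance
  finState := have := P.finState; inferInstance
  start := Sum.inl P.start
  next := fun q s => match q with
    | Sum.inl q => some (P.next q s)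
    | Sum.inr _ => none

/-- The configuration of `toTransducer P` with state `q` and tapes `τ`. -/
def cfg {r : ℕ} {W : Type} [Finite W] [Finite E] (P : Prog (Fin r ⊕ Option W) E)
    (q : P.State ⊕ E) (τ : Fin r ⊕ Option W → Tape) :
    Cfg P.toTransducer.State (Fin r ⊕ Option P.toTransducer.Work) :=
  Cfg.ofTapes (Q := P.State ⊕ E) (ι := Fin r ⊕ Option W) q τ

section

variable {r : ℕ} {W : Type} [Finite W] [Finite E] {P : Prog (Fin r ⊕ Option W) E}

theorem step_cfg {q : P.State} {τ : Fin r ⊕ Option W → Tape} {q' : P.State ⊕ E}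
    {w : Fin r ⊕ Option W → Option Bool × Move}
    (h : P.next q (fun i => (τ i).read) = (q', w)) :
    P.toTransducer.step (P.cfg (Sum.inl q) τ) = P.cfg q' fun i => (τ i).step (w i) := by
  change (Cfg.ofTapes (Q := P.State ⊕ E) (Sum.inl q) τ).apply
    (P.next q fun i => (τ i).read) = _
  rw [h]
  rfl

theorem Run.toTransducer {q : P.State} {τ τ' : Fin r ⊕ Option W → Tape} {t : ℕ} {e : E}
    (h : P.Run q τ t e τ') :
    P.toTransducer.step^[t] (P.cfg (Sum.inl q) τ) = P.cfg (Sum.inr e) τ' := by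
  induction h with
  | exit h hτ => rw [Function.iterate_one, step_cfg h, hτ]
  | step h hτ _ ih => rw [Function.iterate_succ_apply, step_cfg h, hτ, ih]

theorem ofStrings_eq_cfg (q : P.State ⊕ E) (σ : Fin r ⊕ Option W → List Bool) :
    Cfg.ofStrings (Q := P.toTransducer.State) (ι := Fin r ⊕ Option P.toTransducer.Work) q σ
      = P.cfg q fun i => Tape.ofList (σ i) :=
  Cfg.ofStrings_eq_ofTapes (Q := P.State ⊕ E) q σ

theorem Exec.computesIn {x : Fin r → List Bool} {y : List Bool} {B : ℕ} {e : E}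
    (h : P.Exec (Sum.elim (fun i => Tape.ofList (x i)) fun _ => Tape.ofList []) e
      (Sum.elim (fun i => Tape.ofList (x i))
        fun i => i.elim (Tape.ofList y) fun _ => Tape.ofList []) B) :
    P.toTransducer.ComputesIn x y B := by
  obtain ⟨t, ht, hr⟩ := h
  refine ⟨Sum.inr e, ?_, rfl⟩
  obtain ⟨d, rfl⟩ := Nat.exists_eq_add_of_le' ht
  rw [Function.iterate_add_apply]
  refine Eq.trans ?_ (Function.iterate_fixed (f := P.toTransducer.step) rfl d)
  congr 1
  have e1 : (fun i => Tape.ofList (Sum.elim x (fun _ : Option W => []) i))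
      = Sum.elim (fun i => Tape.ofList (x i)) fun _ => Tape.ofList [] := by
    funext i
    rcases i with i | i <;> rfl
  have e2 : (fun i => Tape.ofList (Sum.elim x (fun i : Option W => i.elim y fun _ => []) i))
      = Sum.elim (fun i => Tape.ofList (x i))
        fun i => i.elim (Tape.ofList y) fun _ => Tape.ofList [] := by
    funext i
    rcases i with i | _ | i <;> rfl
  exact (congrArg P.toTransducer.step^[t] ((ofStrings_eq_cfg (Sum.inl P.start) _).trans
    (congrArg (P.cfg _) e1))).trans (hr.toTransducer.trans
      ((ofStrings_eq_cfg (Sum.inr e) _).trans (congrArg (P.cfg _) e2)).symm)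

end

end Prog

/-- A machine needs a step for each letter of its output. -/
theorem Transducer.ComputesIn.length_le {r : ℕ} {M : Transducer r} {x : Fin r → List Bool}
    {y : List Bool} {T : ℕ} (h : M.ComputesIn x y T) : y.length ≤ T := by
  obtain ⟨q, h1, -⟩ := h
  have key : ∀ t, let c := M.step^[t] (Cfg.ofStrings M.start (Sum.elim x fun _ => []))
      c.head (Sum.inr none) ≤ t ∧ ∀ z : ℤ, (t : ℤ) ≤ z → c.cell (Sum.inr none) z = none := by
    intro t
    induction t with
    | zero => simp [Cfg.ofStrings, Cfg.tapeOf]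
    | succ t ih =>
      rw [Function.iterate_succ_apply']
      set c := M.step^[t] (Cfg.ofStrings M.start (Sum.elim x fun _ => [])) with hc
      obtain ⟨ih1, ih2⟩ := ih
      simp only [Transducer.step]
      cases hn : M.next c.state c.scan with
      | none => exact ⟨by push_cast; omega, fun z hz => ih2 z (by push_cast at hz; omega)⟩
      | some a =>
        refine ⟨?_, fun z hz => ?_⟩
        · simp only [Cfg.apply]
          push_cast
          have : (a.2 (Sum.inr none)).2.toInt ≤ 1 := by
            cases (a.2 (Sum.inr none)).2 <;> simp [Move.toInt]
          omega
        · push_cast at hz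
          simp only [Cfg.apply]
          rw [Function.update_of_ne (by omega)]
          exact ih2 z (by omega)
  have := (key T).2 T le_rfl
  rw [h1] at this
  simpa [Cfg.ofStrings, Tape.tapeOf_natCast] using this

theorem Transducer.ComputesIn.mono {r : ℕ} {M : Transducer r} {x : Fin r → List Bool}
    {y : List Bool} {T T' : ℕ} (h : M.ComputesIn x y T) (hT : T ≤ T') : M.ComputesIn x y T' := by
  obtain ⟨q, h, hq⟩ := h
  obtain ⟨j, rfl⟩ := Nat.exists_eq_add_of_le' hT
  refine ⟨q, ?_, hq⟩
  rw [Function.iterate_add_apply, h]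
  refine Function.iterate_fixed ?_ j
  generalize (Sum.elim x fun i : Option M.Work => i.elim y fun _ => []) = σ at hq
  have hq' : M.next (Cfg.ofStrings q σ).state (Cfg.ofStrings q σ).scan = none := hq
  rw [Transducer.step, hq']

/-! ### Elementary string programs -/

/-- The interleaving `a₀ b₀ c₀ a₁ b₁ c₁ ⋯` of three strings of the same length. -/
def interleave : List Bool → List Bool → List Bool → List Bool
  | a :: as, b :: bs, c :: cs => a :: b :: c :: interleave as bs cs
  | _, _, _ => []

/-- The number with the binary representation `s` (least significant bit first). -/
def bitVal : List Bool → ℕ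
  | [] => 0
  | b :: s => b.toNat + 2 * bitVal s

theorem length_interleave {n z h : List Bool} (hz : z.length = n.length)
    (hh : h.length = n.length) : (interleave n z h).length = 3 * n.length := by
  induction n generalizing z h with
  | nil => rfl
  | cons a n ih =>
    obtain ⟨b, z, rfl⟩ := List.exists_cons_of_length_eq_add_one hz
    obtain ⟨c, h, rfl⟩ := List.exists_cons_of_length_eq_add_one hh
    simp only [interleave, List.length_cons, ih (by simpa using hz) (by simpa using hh)]
    ring

namespace Prog

/-- Split the interleaving on tape `0` into its three tracks. -/
def deinterleave : Prog (Fin 4) Bool where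
  State := Fin 4
  finState := inferInstance
  start := 0
  next := fun q s => match q with
    | 0 => match s 0 with
      | some b => (Sum.inl 1, ![(some b, .right), (some b, .right), (s 2, .stay), (s 3, .stay)])
      | none => (Sum.inl 3, ![(none, .stay), (s 1, .left), (s 2, .left), (s 3, .left)])
    | 1 => match s 0 with
      | some b => (Sum.inl 2, ![(some b, .right), (s 1, .stay), (some b, .right), (s 3, .stay)])
      | none => (Sum.inr false, fun i => (s i, .stay))
    | 2 => match s 0 with
      | some b => (Sum.inl 0, ![(some b, .right), (s 1, .stay), (s 2, .stay), (some b, .right)])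
      | none => (Sum.inr false, fun i => (s i, .stay))
    | 3 => match s 1 with
      | some b => (Sum.inl 3, ![(s 0, .stay), (some b, .left), (s 2, .left), (s 3, .left)])
      | none => (Sum.inr true, ![(s 0, .stay), (none, .right), (s 2, .right), (s 3, .right)])

theorem run_deinterleave_back (τ : Tape) (l₁ l₂ l₃ r₁ r₂ r₃ : List Bool)
    (h₂ : l₂.length = l₁.length) (h₃ : l₃.length = l₁.length) :
    deinterleave.Run (3 : Fin 4) ![τ, .back l₁ r₁, .back l₂ r₂, .back l₃ r₃] (l₁.length + 1) true
      ![τ, .ofList (l₁.reverse ++ r₁), .ofList (l₂.reverse ++ r₂), .ofList (l₃.reverse ++ r₃)] := by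
  induction l₁ generalizing l₂ l₃ r₁ r₂ r₃ with
  | nil =>
    obtain rfl := List.eq_nil_of_length_eq_zero h₂
    obtain rfl := List.eq_nil_of_length_eq_zero h₃
    refine .exit_of (s := ![τ.read, none, none, none]) ?_ rfl ?_
    · intro i; fin_cases i <;> simp
    · intro i; fin_cases i <;> simp
  | cons a l₁ ih =>
    obtain ⟨b, l₂, rfl⟩ := List.exists_cons_of_length_eq_add_one h₂
    obtain ⟨c, l₃, rfl⟩ := List.exists_cons_of_length_eq_add_one h₃
    have := ih l₂ l₃ (a :: r₁) (b :: r₂) (c :: r₃) (by simpa using h₂) (by simpa using h₃)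
    simp only [List.reverse_cons, List.append_assoc, List.singleton_append]
    refine .step_of (s := ![τ.read, some a, some b, some c]) ?_ rfl ?_ this
    · intro i; fin_cases i <;> simp
    · intro i; fin_cases i <;> simp

theorem run_deinterleave (n z h pre l₁ l₂ l₃ : List Bool) (hz : z.length = n.length)
    (hh : h.length = n.length) (h₂ : l₂.length = l₁.length) (h₃ : l₃.length = l₁.length) :
    ∃ τ, deinterleave.Run (0 : Fin 4)
      ![.zip pre (interleave n z h), .zip l₁ [], .zip l₂ [], .zip l₃ []]
      (4 * n.length + l₁.length + 2) true
      ![τ, .ofList (l₁.reverse ++ n), .ofList (l₂.reverse ++ z), .ofList (l₃.reverse ++ h)] := by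
  induction n generalizing z h pre l₁ l₂ l₃ with
  | nil =>
    obtain rfl := List.eq_nil_of_length_eq_zero hz
    obtain rfl := List.eq_nil_of_length_eq_zero hh
    have := run_deinterleave_back (.zip pre []) l₁ l₂ l₃ [] [] [] h₂ h₃
    refine ⟨.zip pre [], ?_⟩
    rw [show 4 * ([] : List Bool).length + l₁.length + 2 = l₁.length + 1 + 1 by simp]
    refine .step_of (s := ![none, none, none, none]) ?_ rfl ?_ this
    · intro i; fin_cases i <;> simp [interleave]
    · intro i; fin_cases i <;> simp [interleave]
  | cons a n ih =>
    obtain ⟨b, z, rfl⟩ := List.exists_cons_of_length_eq_add_one hz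
    obtain ⟨c, h, rfl⟩ := List.exists_cons_of_length_eq_add_one hh
    obtain ⟨τ, hr⟩ := ih z h (c :: b :: a :: pre) (a :: l₁) (b :: l₂) (c :: l₃)
      (by simpa using hz) (by simpa using hh) (by simpa using h₂) (by simpa using h₃)
    refine ⟨τ, ?_⟩
    simp only [List.reverse_cons, List.append_assoc, List.singleton_append] at hr
    rw [show 4 * (a :: n).length + l₁.length + 2
      = 4 * n.length + (a :: l₁).length + 2 + 1 + 1 + 1 by simp; ring]
    refine .step_of (s := ![some a, none, none, none])
      (τ₁ := ![.zip (a :: pre) (b :: c :: interleave n z h), .zip (a :: l₁) [], .zip l₂ [],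
        .zip l₃ []]) ?_ rfl ?_ ?_
    · intro i; fin_cases i <;> simp [interleave]
    · intro i; fin_cases i <;> simp [interleave]
    refine .step_of (s := ![some b, none, none, none])
      (τ₁ := ![.zip (b :: a :: pre) (c :: interleave n z h), .zip (a :: l₁) [], .zip (b :: l₂) [],
        .zip l₃ []]) ?_ rfl ?_ ?_
    · intro i; fin_cases i <;> simp
    · intro i; fin_cases i <;> simp
    refine .step_of (s := ![some c, none, none, none]) ?_ rfl ?_ hr
    · intro i; fin_cases i <;> simp
    · intro i; fin_cases i <;> simp

theorem exec_deinterleave {n z h : List Bool} (hz : z.length = n.length)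
    (hh : h.length = n.length) :
    ∃ τ, deinterleave.Exec ![.ofList (interleave n z h), .ofList [], .ofList [], .ofList []] true
      ![τ, .ofList n, .ofList z, .ofList h] (4 * n.length + 2) :=
  let ⟨τ, hr⟩ := run_deinterleave n z h [] [] [] [] hz hh rfl rfl
  ⟨τ, hr.exec rfl (by simp)⟩

theorem run_deinterleave_false (pre l₁ l₂ l₃ : List Bool) : ∀ a : List Bool,
    (¬ ∃ n z h : List Bool, z.length = n.length ∧ h.length = n.length ∧ a = interleave n z h) →
      ∃ t τ', deinterleave.Run (0 : Fin 4) ![.zip pre a, .zip l₁ [], .zip l₂ [], .zip l₃ []] t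
        false τ'
  | [], ha => absurd ⟨[], [], [], rfl, rfl, rfl⟩ ha
  | [a], _ => by
    refine ⟨1 + 1, _, .step_of (s := ![some a, none, none, none])
      (τ₁ := ![.zip (a :: pre) [], .zip (a :: l₁) [], .zip l₂ [], .zip l₃ []]) ?_ rfl ?_
      (.exit_of (s := ![none, none, none, none]) ?_ rfl fun i => rfl)⟩
    all_goals intro i; fin_cases i <;> simp
  | [a, b], _ => by
    refine ⟨1 + 1 + 1, _, .step_of (s := ![some a, none, none, none])
      (τ₁ := ![.zip (a :: pre) [b], .zip (a :: l₁) [], .zip l₂ [], .zip l₃ []]) ?_ rfl ?_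
      (.step_of (s := ![some b, none, none, none])
      (τ₁ := ![.zip (b :: a :: pre) [], .zip (a :: l₁) [], .zip (b :: l₂) [], .zip l₃ []]) ?_ rfl ?_
      (.exit_of (s := ![none, none, none, none]) ?_ rfl fun i => rfl))⟩
    all_goals intro i; fin_cases i <;> simp
  | a :: b :: c :: as, ha => by
    obtain ⟨t, τ', hr⟩ := run_deinterleave_false (c :: b :: a :: pre) (a :: l₁) (b :: l₂)
      (c :: l₃) as (by
        rintro ⟨n, z, h, hz, hh, rfl⟩
        exact ha ⟨a :: n, b :: z, c :: h, by simpa using hz, by simpa using hh, rfl⟩)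
    refine ⟨t + 1 + 1 + 1, τ', .step_of (s := ![some a, none, none, none])
      (τ₁ := ![.zip (a :: pre) (b :: c :: as), .zip (a :: l₁) [], .zip l₂ [], .zip l₃ []]) ?_ rfl ?_
      (.step_of (s := ![some b, none, none, none])
      (τ₁ := ![.zip (b :: a :: pre) (c :: as), .zip (a :: l₁) [], .zip (b :: l₂) [],
        .zip l₃ []]) ?_ rfl ?_
      (.step_of (s := ![some c, none, none, none]) ?_ rfl ?_ hr))⟩
    all_goals intro i; fin_cases i <;> simp

theorem exec_deinterleave_false {a : List Bool} (ha : ¬ ∃ n z h : List Bool,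
    z.length = n.length ∧ h.length = n.length ∧ a = interleave n z h) :
    ∃ B τ', deinterleave.Exec ![.ofList a, .ofList [], .ofList [], .ofList []] false τ' B :=
  let ⟨t, τ', hr⟩ := run_deinterleave_false [] [] [] [] a ha
  ⟨t, τ', hr.exec rfl le_rfl⟩

/-- Copy the string on tape `0` to tape `1` without its final zeros. The exit value tells whether
anything remains. -/
def strip : Prog (Fin 2) Bool where
  State := Fin 3
  finState := inferInstance
  start := 0
  next := fun q s => match q with
    | 0 => match s 0 with
      | some b => (Sum.inl 0, ![(some b, .right), (some b, .right)])
      | none => (Sum.inl 1, ![(none, .left), (s 1, .left)])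
    | 1 => match s 0 with
      | some b => match s 1 with
        | some true => (Sum.inl 2, ![(some b, .left), (some true, .left)])
        | _ => (Sum.inl 1, ![(some b, .left), (none, .left)])
      | none => (Sum.inr false, ![(none, .right), (s 1, .right)])
    | 2 => match s 0 with
      | some b => (Sum.inl 2, ![(some b, .left), (s 1, .left)])
      | none => (Sum.inr true, ![(none, .right), (s 1, .right)])

theorem run_strip_keep (l r r' : List Bool) :
    strip.Run (2 : Fin 3) ![.back l r, .back l r'] (l.length + 1) true
      ![.ofList (l.reverse ++ r), .ofList (l.reverse ++ r')] := by
  induction l generalizing r r' with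
  | nil =>
    refine .exit_of (s := ![none, none]) ?_ rfl ?_
    · intro i; fin_cases i <;> simp
    · intro i; fin_cases i <;> simp
  | cons a l ih =>
    have := ih (a :: r) (a :: r')
    simp only [List.reverse_cons, List.append_assoc, List.singleton_append]
    refine .step_of (s := ![some a, some a]) ?_ rfl ?_ this
    · intro i; fin_cases i <;> simp
    · intro i; fin_cases i <;> simp

theorem run_strip_erase (j : ℕ) (l r : List Bool) :
    strip.Run (1 : Fin 3) ![.back (List.replicate j false ++ true :: l) r,
      .back (List.replicate j false ++ true :: l) []] (j + l.length + 2) true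
      ![.ofList (l.reverse ++ true :: (List.replicate j false ++ r)),
        .ofList (l.reverse ++ [true])] := by
  induction j generalizing r with
  | zero =>
    rw [show 0 + l.length + 2 = l.length + 1 + 1 by ring]
    refine .step_of (s := ![some true, some true]) ?_ rfl ?_ (run_strip_keep l (true :: r) [true])
    · intro i; fin_cases i <;> simp
    · intro i; fin_cases i <;> simp
  | succ j ih =>
    have := ih (false :: r)
    rw [show List.replicate j false ++ false :: r = List.replicate (j + 1) false ++ r by
      simp [List.replicate_succ']] at this
    rw [show j + 1 + l.length + 2 = j + l.length + 2 + 1 by ring]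
    refine .step_of (s := ![some false, some false]) ?_ rfl ?_ this
    · intro i; fin_cases i <;> simp [List.replicate_succ]
    · intro i; fin_cases i <;> simp [List.replicate_succ]

theorem run_strip_erase_all (j : ℕ) (r : List Bool) :
    strip.Run (1 : Fin 3) ![.back (List.replicate j false) r, .back (List.replicate j false) []]
      (j + 1) false ![.ofList (List.replicate j false ++ r), .ofList []] := by
  induction j generalizing r with
  | zero =>
    refine .exit_of (s := ![none, none]) ?_ rfl ?_
    · intro i; fin_cases i <;> simp
    · intro i; fin_cases i <;> simp
  | succ j ih =>
    have := ih (false :: r)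
    rw [show List.replicate j false ++ false :: r = List.replicate (j + 1) false ++ r by
      simp [List.replicate_succ']] at this
    refine .step_of (s := ![some false, some false]) ?_ rfl ?_ this
    · intro i; fin_cases i <;> simp [List.replicate_succ]
    · intro i; fin_cases i <;> simp [List.replicate_succ]

theorem run_strip_copy {s l : List Bool} {t : ℕ} {e : Bool} {τ' : Fin 2 → Tape}
    (h : strip.Run (1 : Fin 3) ![.back (s.reverse ++ l) [], .back (s.reverse ++ l) []] t e τ') :
    strip.Run (0 : Fin 3) ![.zip l s, .zip l []] (s.length + 1 + t) e τ' := by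
  induction s generalizing l with
  | nil =>
    rw [show ([] : List Bool).length + 1 + t = t + 1 by simp; ring]
    refine .step_of (s := ![none, none]) ?_ rfl ?_ h
    · intro i; fin_cases i <;> simp
    · intro i; fin_cases i <;> simp
  | cons a s ih =>
    rw [show (a :: s).length + 1 + t = s.length + 1 + t + 1 by simp; ring]
    refine .step_of (s := ![some a, none]) ?_ rfl ?_ (ih (l := a :: l) (by simpa using h))
    · intro i; fin_cases i <;> simp
    · intro i; fin_cases i <;> simp

theorem exec_strip (u : List Bool) (j : ℕ) :
    strip.Exec ![.ofList (u ++ true :: List.replicate j false), .ofList []] true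
      ![.ofList (u ++ true :: List.replicate j false), .ofList (u ++ [true])]
      (2 * (u ++ true :: List.replicate j false).length + 2) := by
  refine (run_strip_copy (l := []) (by simpa using run_strip_erase j u.reverse [])).exec rfl ?_
  simp; omega

theorem exec_strip_zero (j : ℕ) :
    strip.Exec ![.ofList (List.replicate j false), .ofList []] false
      ![.ofList (List.replicate j false), .ofList []] (2 * j + 2) := by
  refine (run_strip_copy (l := []) (by simpa using run_strip_erase_all j [])).exec rfl ?_
  simp; omega

/-- Read `1^v` on tape `0` and write `1^(2v+2)` on tape `1`, clearing tape `0`. -/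
def double : Prog (Fin 2) Unit where
  State := Fin 3
  finState := inferInstance
  start := 0
  next := fun q s => match q with
    | 0 => match s 0 with
      | some b => (Sum.inl 0, ![(some b, .right), (some true, .right)])
      | none => (Sum.inl 1, ![(none, .left), (some true, .right)])
    | 1 => match s 0 with
      | some _ => (Sum.inl 1, ![(none, .left), (some true, .right)])
      | none => (Sum.inl 2, ![(none, .right), (some true, .stay)])
    | 2 => match s 1 with
      | some b => (Sum.inl 2, ![(s 0, .stay), (some b, .left)])
      | none => (Sum.inr (), ![(s 0, .stay), (none, .right)])

theorem run_double_back (l r : List Bool) :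
    double.Run (2 : Fin 3) ![.ofList [], .back l r] (l.length + 1) ()
      ![.ofList [], .ofList (l.reverse ++ r)] := by
  induction l generalizing r with
  | nil =>
    refine .exit_of (s := ![none, none]) ?_ rfl ?_
    · intro i; fin_cases i <;> simp
    · intro i; fin_cases i <;> simp
  | cons a l ih =>
    simp only [List.reverse_cons, List.append_assoc, List.singleton_append]
    refine .step_of (s := ![none, some a]) ?_ rfl ?_ (ih (a :: r))
    · intro i; fin_cases i <;> simp
    · intro i; fin_cases i <;> simp

theorem run_double_erase (l l' : List Bool) :
    double.Run (1 : Fin 3) ![.back l [], .zip l' []] (2 * l.length + l'.length + 3) ()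
      ![.ofList [], .ofList (l'.reverse ++ List.replicate (l.length + 1) true)] := by
  induction l generalizing l' with
  | nil =>
    refine .step_of (s := ![none, none]) ?_ rfl ?_ ?_ (τ₁ := ![.ofList [], .back (true :: l') []])
    · intro i; fin_cases i <;> simp
    · intro i; fin_cases i
      · simp
      · simp [Tape.back]
    · have := run_double_back (true :: l') []
      simpa [add_comm, add_left_comm, add_assoc] using this
  | cons a l ih =>
    have := ih (true :: l')
    rw [show (true :: l').reverse ++ List.replicate (l.length + 1) true
      = l'.reverse ++ List.replicate ((a :: l).length + 1) true by
        simp [List.replicate_succ]] at this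
    rw [show 2 * (a :: l).length + l'.length + 3 = 2 * l.length + (true :: l').length + 3 + 1 by
      simp; ring]
    refine .step_of (s := ![some a, none]) ?_ rfl ?_ this
    · intro i; fin_cases i <;> simp
    · intro i; fin_cases i <;> simp

theorem run_double_copy (l l' r : List Bool) :
    double.Run (0 : Fin 3) ![.zip l r, .zip l' []]
      (4 * r.length + 2 * l.length + l'.length + 5) ()
      ![.ofList [], .ofList (l'.reverse ++ List.replicate (2 * r.length + l.length + 2) true)] := by
  induction r generalizing l l' with
  | nil =>
    have := run_double_erase l (true :: l')
    rw [show (true :: l').reverse ++ List.replicate (l.length + 1) true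
      = l'.reverse ++ List.replicate (2 * ([] : List Bool).length + l.length + 2) true by
        simp [List.replicate_succ]] at this
    rw [show 4 * ([] : List Bool).length + 2 * l.length + l'.length + 5
      = 2 * l.length + (true :: l').length + 3 + 1 by simp; ring]
    refine .step_of (s := ![none, none]) ?_ rfl ?_ this
    · intro i; fin_cases i <;> simp
    · intro i; fin_cases i <;> simp
  | cons a r ih =>
    have := ih (a :: l) (true :: l')
    rw [show (true :: l').reverse ++ List.replicate (2 * r.length + (a :: l).length + 2) true
      = l'.reverse ++ List.replicate (2 * (a :: r).length + l.length + 2) true by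
        simp only [List.reverse_cons, List.append_assoc, List.singleton_append, List.length_cons,
          ← List.replicate_succ]
        congr 2; ring] at this
    rw [show 4 * (a :: r).length + 2 * l.length + l'.length + 5
      = 4 * r.length + 2 * (a :: l).length + (true :: l').length + 5 + 1 by simp; ring]
    refine .step_of (s := ![some a, none]) ?_ rfl ?_ this
    · intro i; fin_cases i <;> simp
    · intro i; fin_cases i <;> simp

theorem exec_double (v : ℕ) :
    double.Exec ![.ofList (List.replicate v true), .ofList []] ()
      ![.ofList [], .ofList (List.replicate (2 * v + 2) true)] (4 * v + 5) := by
  have := run_double_copy [] [] (List.replicate v true)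
  simp only [List.length_replicate, List.length_nil, List.reverse_nil, List.nil_append] at this
  exact this.exec rfl (by simp)

/-- Clear a tape. -/
def clear : Prog (Fin 1) Unit where
  State := Bool
  finState := inferInstance
  start := false
  next := fun q s => match q with
    | false => match s 0 with
      | some b => (Sum.inl false, ![(some b, .right)])
      | none => (Sum.inl true, ![(none, .left)])
    | true => match s 0 with
      | some _ => (Sum.inl true, ![(none, .left)])
      | none => (Sum.inr (), ![(none, .right)])

theorem run_clear_back (l : List Bool) :
    clear.Run true ![.back l []] (l.length + 1) () ![.ofList []] := by
  induction l with
  | nil =>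
    refine .exit_of (s := ![none]) ?_ rfl ?_
    · intro i; fin_cases i; simp
    · intro i; fin_cases i; simp
  | cons a l ih =>
    refine .step_of (s := ![some a]) ?_ rfl ?_ ih
    · intro i; fin_cases i; simp
    · intro i; fin_cases i; simp

theorem run_clear (l r : List Bool) :
    clear.Run false ![.zip l r] (2 * r.length + l.length + 2) () ![.ofList []] := by
  induction r generalizing l with
  | nil =>
    rw [show 2 * ([] : List Bool).length + l.length + 2 = l.length + 1 + 1 by simp]
    refine .step_of (s := ![none]) ?_ rfl ?_ (run_clear_back l)
    · intro i; fin_cases i; simp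
    · intro i; fin_cases i; simp
  | cons a r ih =>
    rw [show 2 * (a :: r).length + l.length + 2 = 2 * r.length + (a :: l).length + 2 + 1 by
      simp; ring]
    refine .step_of (s := ![some a]) ?_ rfl ?_ (ih (a :: l))
    · intro i; fin_cases i; simp
    · intro i; fin_cases i; simp

theorem exec_clear (s : List Bool) :
    clear.Exec ![.ofList s] () ![.ofList []] (2 * s.length + 2) :=
  (run_clear [] s).exec rfl (by simp)

/-- Check that the string on tape `0` is one letter longer than the string on tape `1`, and write
zeros on tape `2`, as many as there are letters on tape `1`. -/
def prepare : Prog (Fin 3) Bool where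
  State := Fin 3
  finState := inferInstance
  start := 0
  next := fun q s => match q with
    | 0 => (Sum.inl 1, ![(s 0, .right), (s 1, .stay), (s 2, .stay)])
    | 1 => match s 0, s 1 with
      | some a, some b => (Sum.inl 1, ![(some a, .right), (some b, .right), (some false, .right)])
      | none, none => (Sum.inl 2, ![(none, .left), (none, .left), (s 2, .left)])
      | _, _ => (Sum.inr false, fun i => (s i, .stay))
    | 2 => match s 1 with
      | some b => (Sum.inl 2, ![(s 0, .left), (some b, .left), (s 2, .left)])
      | none => (Sum.inr true, ![(s 0, .stay), (none, .right), (s 2, .right)])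

theorem run_prepare_back (f : Bool) (l₁ l₂ l₃ r₁ r₂ r₃ : List Bool)
    (h₁ : l₁.length = l₂.length) (h₃ : l₃.length = l₂.length) :
    prepare.Run (2 : Fin 3) ![.back (l₁ ++ [f]) r₁, .back l₂ r₂, .back l₃ r₃] (l₂.length + 1) true
      ![.ofList (f :: l₁.reverse ++ r₁), .ofList (l₂.reverse ++ r₂),
        .ofList (l₃.reverse ++ r₃)] := by
  induction l₂ generalizing l₁ l₃ r₁ r₂ r₃ with
  | nil =>
    obtain rfl := List.eq_nil_of_length_eq_zero h₁
    obtain rfl := List.eq_nil_of_length_eq_zero h₃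
    refine .exit_of (s := ![some f, none, none]) ?_ rfl ?_
    · intro i; fin_cases i <;> simp
    · intro i; fin_cases i <;> simp
  | cons b l₂ ih =>
    obtain ⟨a, l₁, rfl⟩ := List.exists_cons_of_length_eq_add_one h₁
    obtain ⟨c, l₃, rfl⟩ := List.exists_cons_of_length_eq_add_one h₃
    have := ih l₁ l₃ (a :: r₁) (b :: r₂) (c :: r₃) (by simpa using h₁) (by simpa using h₃)
    simp only [List.reverse_cons, List.append_assoc, List.cons_append,
      List.nil_append] at this ⊢
    refine .step_of (s := ![some a, some b, some c]) ?_ rfl ?_ this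
    · intro i; fin_cases i <;> simp
    · intro i; fin_cases i <;> simp

theorem run_prepare (f : Bool) (fs z l₁ l₂ l₃ : List Bool) (h₁ : l₁.length = l₂.length)
    (h₃ : l₃.length = l₂.length) (h : fs.length = z.length) :
    prepare.Run (1 : Fin 3) ![.zip (l₁ ++ [f]) fs, .zip l₂ z, .zip l₃ []]
      (2 * z.length + l₂.length + 2) true
      ![.ofList (f :: l₁.reverse ++ fs), .ofList (l₂.reverse ++ z),
        .ofList (l₃.reverse ++ List.replicate z.length false)] := by
  induction z generalizing fs l₁ l₂ l₃ with
  | nil =>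
    obtain rfl := List.eq_nil_of_length_eq_zero h
    have := run_prepare_back f l₁ l₂ l₃ [] [] [] h₁ h₃
    rw [show 2 * ([] : List Bool).length + l₂.length + 2 = l₂.length + 1 + 1 by simp]
    refine .step_of (s := ![none, none, none]) ?_ rfl ?_ this
    · intro i; fin_cases i <;> simp
    · intro i; fin_cases i <;> simp
  | cons b z ih =>
    obtain ⟨a, fs, rfl⟩ := List.exists_cons_of_length_eq_add_one h
    have := ih fs (a :: l₁) (b :: l₂) (false :: l₃) (by simpa using h₁) (by simpa using h₃)
      (by simpa using h)
    simp only [List.reverse_cons, List.append_assoc, List.cons_append,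
      List.nil_append] at this
    rw [show 2 * (b :: z).length + l₂.length + 2 = 2 * z.length + (b :: l₂).length + 2 + 1 by
      simp; ring]
    refine .step_of (s := ![some a, some b, none]) ?_ rfl ?_ this
    · intro i; fin_cases i <;> simp
    · intro i; fin_cases i <;> simp

theorem run_prepare_false (fs z l₁ l₂ l₃ : List Bool) (h : fs.length ≠ z.length) :
    ∃ t τ', prepare.Run (1 : Fin 3) ![.zip l₁ fs, .zip l₂ z, .zip l₃ []] t false τ' := by
  induction z generalizing fs l₁ l₂ l₃ with
  | nil =>
    obtain ⟨a, fs, rfl⟩ := List.exists_cons_of_ne_nil (List.ne_nil_of_length_pos (by simp at h; simpa [List.length_pos_iff] using h))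
    refine ⟨1, _, .exit_of (s := ![some a, none, none]) ?_ rfl fun i => rfl⟩
    intro i; fin_cases i <;> simp
  | cons b z ih =>
    cases fs with
    | nil =>
      refine ⟨1, _, .exit_of (s := ![none, some b, none]) ?_ rfl fun i => rfl⟩
      intro i; fin_cases i <;> simp
    | cons a fs =>
      obtain ⟨t, τ', hr⟩ := ih fs (a :: l₁) (b :: l₂) (false :: l₃) (by simpa using h)
      refine ⟨t + 1, τ', .step_of (s := ![some a, some b, none]) ?_ rfl ?_ hr⟩
      · intro i; fin_cases i <;> simp
      · intro i; fin_cases i <;> simp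

theorem exec_prepare (f : Bool) (fs z : List Bool) (h : fs.length = z.length) :
    prepare.Exec ![.ofList (f :: fs), .ofList z, .ofList []] true
      ![.ofList (f :: fs), .ofList z, .ofList (List.replicate z.length false)]
      (2 * z.length + 3) := by
  refine ⟨_, le_rfl, ?_⟩
  refine .step_of (s := ![some f, z.head?, none]) ?_ rfl ?_ (run_prepare f fs z [] [] [] rfl rfl h)
  · intro i; fin_cases i <;> simp
  · intro i; fin_cases i
    · simp
    · exact Tape.step_stay_of_read (by simp)
    · simp

theorem exec_prepare_false (f : Bool) (fs z : List Bool) (h : fs.length ≠ z.length) :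
    ∃ B τ', prepare.Exec ![.ofList (f :: fs), .ofList z, .ofList []] false τ' B := by
  obtain ⟨t, τ', hr⟩ := run_prepare_false fs z [f] [] [] h
  refine ⟨t + 1, τ', t + 1, le_rfl, ?_⟩
  refine .step_of (s := ![some f, z.head?, none]) ?_ rfl ?_ hr
  · intro i; fin_cases i <;> simp
  · intro i; fin_cases i
    · simp
    · exact Tape.step_stay_of_read (by simp)
    · simp

/-- Move the string on tape `0` to tape `1` (over a string of the same length), adding `b` modulo
`2` to its last letter. -/
def moveFlip (b : Bool) : Prog (Fin 2) Unit where
  State := Fin 3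
  finState := inferInstance
  start := 0
  next := fun q s => match q with
    | 0 => match s 0 with
      | some x => (Sum.inl 0, ![(some x, .right), (some x, .right)])
      | none => (Sum.inl 1, ![(none, .left), (s 1, .left)])
    | 1 => (Sum.inl 2, ![(none, .left), ((s 1).map (xor b), .left)])
    | 2 => match s 0 with
      | some _ => (Sum.inl 2, ![(none, .left), (s 1, .left)])
      | none => (Sum.inr (), ![(none, .right), (s 1, .right)])

theorem run_moveFlip_back (b : Bool) (l l' r' : List Bool) (h : l'.length = l.length) :
    (moveFlip b).Run (2 : Fin 3) ![.back l [], .back l' r'] (l.length + 1) ()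
      ![.ofList [], .ofList (l'.reverse ++ r')] := by
  induction l generalizing l' r' with
  | nil =>
    obtain rfl := List.eq_nil_of_length_eq_zero h
    refine .exit_of (s := ![none, none]) ?_ rfl ?_
    · intro i; fin_cases i <;> simp
    · intro i; fin_cases i <;> simp
  | cons a l ih =>
    obtain ⟨c, l', rfl⟩ := List.exists_cons_of_length_eq_add_one h
    have := ih l' (c :: r') (by simpa using h)
    simp only [List.reverse_cons, List.append_assoc, List.singleton_append]
    refine .step_of (s := ![some a, some c]) ?_ rfl ?_ this
    · intro i; fin_cases i <;> simp
    · intro i; fin_cases i <;> simp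

theorem run_moveFlip (b x : Bool) (s w l : List Bool) (h : w.length = s.length + 1) :
    (moveFlip b).Run (0 : Fin 3) ![.zip l (s ++ [x]), .zip l w] (2 * s.length + l.length + 4) ()
      ![.ofList [], .ofList (l.reverse ++ s ++ [xor b x])] := by
  induction s generalizing w l with
  | nil =>
    obtain ⟨c, w, rfl⟩ := List.exists_cons_of_length_eq_add_one h
    obtain rfl := List.eq_nil_of_length_eq_zero (by simpa using h)
    have := run_moveFlip_back b l l [xor b x] rfl
    rw [show 2 * ([] : List Bool).length + l.length + 4 = l.length + 1 + 1 + 1 + 1 by simp]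
    refine .step_of (s := ![some x, some c]) (τ₁ := ![.zip (x :: l) [], .zip (x :: l) []])
      ?_ rfl ?_ ?_
    · intro i; fin_cases i <;> simp
    · intro i; fin_cases i <;> simp
    refine .step_of (s := ![none, none]) (τ₁ := ![.back (x :: l) [], .back (x :: l) []])
      ?_ rfl ?_ ?_
    · intro i; fin_cases i <;> simp
    · intro i; fin_cases i <;> simp
    refine .step_of (s := ![some x, some x]) ?_ rfl ?_ (by simpa using this)
    · intro i; fin_cases i <;> simp
    · intro i; fin_cases i <;> simp
  | cons a s ih =>
    obtain ⟨c, w, rfl⟩ := List.exists_cons_of_length_eq_add_one h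
    have := ih w (a :: l) (by simpa using h)
    simp only [List.reverse_cons, List.append_assoc, List.cons_append,
      List.nil_append] at this ⊢
    rw [show 2 * (a :: s).length + l.length + 4 = 2 * s.length + (a :: l).length + 4 + 1 by
      simp; ring]
    refine .step_of (s := ![some a, some c]) ?_ rfl ?_ this
    · intro i; fin_cases i <;> simp
    · intro i; fin_cases i <;> simp

theorem exec_moveFlip (b x : Bool) (s w : List Bool) (h : w.length = s.length + 1) :
    (moveFlip b).Exec ![.ofList (s ++ [x]), .ofList w] ()
      ![.ofList [], .ofList (s ++ [xor b x])] (2 * s.length + 4) := by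
  simpa using (run_moveFlip b x s w [] h).exec rfl le_rfl

/-- Subtract one from the number in binary on the tape. The exit value tells whether it was `0`
(the tape is not preserved in this case). -/
def decrement : Prog (Fin 1) Bool where
  State := Bool ⊕ Bool
  finState := inferInstance
  start := Sum.inl true
  next := fun q s => match q with
    | Sum.inl c => match s 0 with
      | some b => (Sum.inl (Sum.inl (c && !b)), ![(some (xor c b), .right)])
      | none => (Sum.inl (Sum.inr c), ![(none, .left)])
    | Sum.inr c => match s 0 with
      | some b => (Sum.inl (Sum.inr c), ![(some b, .left)])
      | none => (Sum.inr c, ![(none, .right)])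

theorem run_decrement_back (c : Bool) (l r : List Bool) :
    decrement.Run (Sum.inr c : Bool ⊕ Bool) ![.back l r] (l.length + 1) c
      ![.ofList (l.reverse ++ r)] := by
  induction l generalizing r with
  | nil =>
    refine .exit_of (s := ![none]) ?_ rfl ?_
    · intro i; fin_cases i; simp
    · intro i; fin_cases i; simp
  | cons a l ih =>
    simp only [List.reverse_cons, List.append_assoc, List.singleton_append]
    refine .step_of (s := ![some a]) ?_ rfl ?_ (ih (a :: r))
    · intro i; fin_cases i; simp
    · intro i; fin_cases i; simp

theorem run_decrement (c : Bool) (l r : List Bool) :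
    ∃ r' : List Bool, r'.length = r.length ∧
      (c.toNat ≤ bitVal r → bitVal r' + c.toNat = bitVal r) ∧
      decrement.Run (Sum.inl c : Bool ⊕ Bool) ![.zip l r] (2 * r.length + l.length + 2)
        (decide (bitVal r < c.toNat)) ![.ofList (l.reverse ++ r')] := by
  induction r generalizing c l with
  | nil =>
    refine ⟨[], rfl, by simp [bitVal], ?_⟩
    have := run_decrement_back c l []
    have hc : decide (bitVal [] < c.toNat) = c := by cases c <;> simp [bitVal]
    rw [hc]
    rw [show 2 * ([] : List Bool).length + l.length + 2 = l.length + 1 + 1 by simp]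
    refine .step_of (s := ![none]) ?_ rfl ?_ this
    · intro i; fin_cases i; simp
    · intro i; fin_cases i; simp
  | cons b r ih =>
    obtain ⟨r', h1, h2, h3⟩ := ih (c && !b) (xor c b :: l)
    refine ⟨xor c b :: r', by simpa using h1, ?_, ?_⟩
    · intro h
      cases c <;> cases b <;> simp [bitVal] at h h2 ⊢ <;> omega
    · have hc : decide (bitVal (b :: r) < c.toNat) = decide (bitVal r < (c && !b).toNat) := by
        cases c <;> cases b <;> simp [bitVal]
      rw [hc, show 2 * (b :: r).length + l.length + 2
        = 2 * r.length + (xor c b :: l).length + 2 + 1 by simp; ring]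
      simp only [List.reverse_cons, List.append_assoc, List.singleton_append] at h3
      refine .step_of (s := ![some b]) ?_ rfl ?_ h3
      · intro i; fin_cases i; simp
      · intro i; fin_cases i; simp

theorem exec_decrement_zero (s : List Bool) (h : bitVal s = 0) :
    ∃ s' : List Bool, decrement.Exec ![.ofList s] true ![.ofList s'] (2 * s.length + 2) := by
  obtain ⟨s', -, -, h3⟩ := run_decrement true [] s
  exact ⟨s', by simpa [h] using h3.exec rfl le_rfl⟩

theorem exec_decrement (s : List Bool) (h : bitVal s ≠ 0) :
    ∃ s' : List Bool, s'.length = s.length ∧ bitVal s' + 1 = bitVal s ∧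
      decrement.Exec ![.ofList s] false ![.ofList s'] (2 * s.length + 2) := by
  obtain ⟨s', h1, h2, h3⟩ := run_decrement true [] s
  refine ⟨s', h1, h2 (Nat.one_le_iff_ne_zero.2 h), ?_⟩
  have hc : decide (bitVal s < true.toNat) = false := by
    simp [h]
  rw [hc] at h3
  simpa using h3.exec rfl le_rfl

/-- Compare the strings on the two tapes. -/
def equal : Prog (Fin 2) Bool where
  State := Unit
  finState := inferInstance
  start := ()
  next := fun _ s => match s 0, s 1 with
    | some a, some b => if a = b then (Sum.inl (), ![(some a, .right), (some b, .right)])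
      else (Sum.inr false, fun i => (s i, .stay))
    | none, none => (Sum.inr true, fun i => (s i, .stay))
    | _, _ => (Sum.inr false, fun i => (s i, .stay))

theorem run_equal (l l' s s' : List Bool) :
    ∃ t ≤ s.length + 1, ∃ τ', equal.Run () ![.zip l s, .zip l' s'] t (decide (s = s')) τ' := by
  induction s generalizing l l' s' with
  | nil =>
    cases s' with
    | nil =>
      refine ⟨1, by simp, _, .exit_of (s := ![none, none]) ?_ rfl fun i => rfl⟩
      intro i; fin_cases i <;> simp
    | cons b s' =>
      refine ⟨1, by simp, _, .exit_of (s := ![none, some b]) ?_ rfl fun i => rfl⟩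
      intro i; fin_cases i <;> simp
  | cons a s ih =>
    cases s' with
    | nil =>
      refine ⟨1, by simp, _, .exit_of (s := ![some a, none]) ?_ rfl fun i => rfl⟩
      intro i; fin_cases i <;> simp
    | cons b s' =>
      by_cases hab : a = b
      · subst hab
        obtain ⟨t, ht, τ', hr⟩ := ih (a :: l) (a :: l') s'
        refine ⟨t + 1, by simpa using ht, τ', ?_⟩
        rw [show decide (a :: s = a :: s') = decide (s = s') by simp]
        refine .step_of (s := ![some a, some a])
          (w := ![(some a, .right), (some a, .right)]) ?_ (by simp [equal]) ?_ hr
        · intro i; fin_cases i <;> simp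
        · intro i; fin_cases i <;> simp
      · refine ⟨1, by simp, _, .exit_of (s := ![some a, some b])
          (w := fun i => (![some a, some b] i, .stay)) ?_ (by simp [equal, hab]) fun i => rfl⟩
        intro i; fin_cases i <;> simp

theorem exec_equal (s s' : List Bool) :
    ∃ τ', equal.Exec ![.ofList s, .ofList s'] (decide (s = s')) τ' (s.length + 1) :=
  let ⟨t, ht, τ', hr⟩ := run_equal [] [] s s'
  ⟨τ', t, ht, hr⟩

/-- Read a letter and move right; do not move on a blank. -/
def readLetter : Prog (Fin 1) (Option Bool) :=
  act fun s => match s 0 with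
    | some b => (some b, ![(some b, .right)])
    | none => (none, ![(none, .stay)])

theorem exec_readLetter_cons (l r : List Bool) (b : Bool) :
    readLetter.Exec ![.zip l (b :: r)] (some b) ![.zip (b :: l) r] 1 := by
  refine exec_act _ (by simp) ?_
  funext i; fin_cases i; simp

theorem exec_readLetter_nil (l : List Bool) :
    readLetter.Exec ![.zip l []] none ![.zip l []] 1 := by
  refine exec_act _ (by simp) ?_
  funext i; fin_cases i; simp

end Prog

/-! ### Generating the field from the input length -/

section

variable {VW GW : Type}

/-- The tapes of the generator of the field: `a` (input), `o` (output), `s` and `k` (auxiliary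
strings); the work tapes of the two machines that are called as subroutines are blank. -/
def fieldTapes (a o s k : Tape) : Fin 1 ⊕ Option (Bool ⊕ VW ⊕ GW) → Tape :=
  Sum.elim (fun _ => a) fun i => i.elim o (Sum.elim (fun b => cond b k s) fun _ => Tape.ofList [])

/-- The tapes of the machine that computes the size from the input length. -/
def sizeTape : Fin 1 ⊕ Option VW → Fin 1 ⊕ Option (Bool ⊕ VW ⊕ GW)
  | Sum.inl i => Sum.inl i
  | Sum.inr none => Sum.inr (some (Sum.inl false))
  | Sum.inr (some w) => Sum.inr (some (Sum.inr (Sum.inl w)))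

/-- The tapes of the machine that generates irreducible polynomials. -/
def polyTape : Fin 1 ⊕ Option GW → Fin 1 ⊕ Option (Bool ⊕ VW ⊕ GW)
  | Sum.inl _ => Sum.inr (some (Sum.inl true))
  | Sum.inr none => Sum.inr none
  | Sum.inr (some w) => Sum.inr (some (Sum.inr (Sum.inr w)))

/-- The auxiliary tapes. -/
def auxTape : Fin 2 → Fin 1 ⊕ Option (Bool ⊕ VW ⊕ GW) :=
  ![Sum.inr (some (Sum.inl false)), Sum.inr (some (Sum.inl true))]

theorem sizeTape_injective : (sizeTape (VW := VW) (GW := GW)).Injective := by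
  rintro (i | _ | i) (j | _ | j) h <;> simp_all [sizeTape]

theorem polyTape_injective : (polyTape (VW := VW) (GW := GW)).Injective := by
  rintro (i | _ | i) (j | _ | j) h <;> simp_all [polyTape]
  exact Subsingleton.elim _ _

theorem auxTape_injective : (auxTape (VW := VW) (GW := GW)).Injective := by
  intro i j h
  fin_cases i <;> fin_cases j <;> simp_all [auxTape]

end

/-- The representation of a field of degree `2 v(n) + 2` can be generated from `n` in the time that
is allowed for fields of degree `10 v(n)`. The unary number `v(n)` does not exceed the time in which
it is computed, so that doubling it is no obstacle. -/
theorem exists_field_generator {u v : ℕ → ℕ} (hu : Monotone u) {G : Transducer 1} {c : ℕ}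
    {p : ℕ → (ZMod 2)[X]}
    (hG : ∀ m, 1 ≤ m → G.ComputesIn ![List.replicate m true] (fieldRep (p m)) (c * u m + c))
    (hv : ComputableInTime v fun n => u (10 * v n)) :
    ∃ (T : Transducer 1) (c' : ℕ), ∀ n, 1 ≤ n →
      T.ComputesIn ![n.bits] (fieldRep (p (2 * v n + 2))) (c' * u (10 * v n) + c') := by
  obtain ⟨V, d, hV⟩ := hv
  have := V.finWork
  have := G.finWork
  let P : Prog (Fin 1 ⊕ Option (Bool ⊕ V.Work ⊕ G.Work)) Unit :=
    ((Prog.ofTransducer V).map sizeTape).bind fun _ =>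
      (Prog.double.map auxTape).bind fun _ =>
        ((Prog.ofTransducer G).map polyTape).bind fun _ =>
          Prog.clear.map fun _ : Fin 1 => Sum.inr (some (Sum.inl true))
  refine ⟨P.toTransducer, 9 * d + c + c * u 2 + 20, fun n hn => ?_⟩
  have hlen : v n ≤ d * u (10 * v n) + d := by simpa using (hV n hn).length_le
  have h1 : ((Prog.ofTransducer V).map (sizeTape (GW := G.Work))).Exec
      (fieldTapes (.ofList n.bits) (.ofList []) (.ofList []) (.ofList [])) ()
      (fieldTapes (.ofList n.bits) (.ofList []) (.ofList (List.replicate (v n) true))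
        (.ofList [])) (d * u (10 * v n) + d + 1) := by
    refine (Prog.exec_ofTransducer (hV n hn)).map sizeTape_injective ?_ ?_ ?_
    · rintro (i | _ | i) <;> simp [sizeTape, fieldTapes]
    · rintro (i | _ | i) <;> simp [sizeTape, fieldTapes]
    · rintro (i | _ | (_ | _) | i | i) hi
      · rfl
      · rfl
      · exact absurd rfl (hi (Sum.inr none))
      · rfl
      · rfl
      · rfl
  have h2 : (Prog.double.map (auxTape (VW := V.Work) (GW := G.Work))).Exec
      (fieldTapes (.ofList n.bits) (.ofList []) (.ofList (List.replicate (v n) true))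
        (.ofList [])) ()
      (fieldTapes (.ofList n.bits) (.ofList []) (.ofList [])
        (.ofList (List.replicate (2 * v n + 2) true))) (4 * v n + 5) := by
    refine (Prog.exec_double (v n)).map auxTape_injective ?_ ?_ ?_
    · intro i; fin_cases i <;> simp [auxTape, fieldTapes]
    · intro i; fin_cases i <;> simp [auxTape, fieldTapes]
    · rintro (i | _ | (_ | _) | i | i) hi
      · rfl
      · rfl
      · exact absurd rfl (hi 0)
      · exact absurd rfl (hi 1)
      · rfl
      · rfl
  have h3 : ((Prog.ofTransducer G).map (polyTape (VW := V.Work))).Exec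
      (fieldTapes (.ofList n.bits) (.ofList []) (.ofList [])
        (.ofList (List.replicate (2 * v n + 2) true))) ()
      (fieldTapes (.ofList n.bits) (.ofList (fieldRep (p (2 * v n + 2)))) (.ofList [])
        (.ofList (List.replicate (2 * v n + 2) true))) (c * u (2 * v n + 2) + c + 1) := by
    refine (Prog.exec_ofTransducer (hG (2 * v n + 2) (by omega))).map polyTape_injective ?_ ?_ ?_
    · rintro (i | _ | i) <;> simp [polyTape, fieldTapes]
    · rintro (i | _ | i) <;> simp [polyTape, fieldTapes]
    · rintro (i | _ | (_ | _) | i | i) hi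
      · rfl
      · exact absurd rfl (hi (Sum.inr none))
      · rfl
      · exact absurd rfl (hi (Sum.inl 0))
      · rfl
      · rfl
  have h4 : (Prog.clear.map fun _ : Fin 1 => (Sum.inr (some (Sum.inl true)) :
        Fin 1 ⊕ Option (Bool ⊕ V.Work ⊕ G.Work))).Exec
      (fieldTapes (.ofList n.bits) (.ofList (fieldRep (p (2 * v n + 2)))) (.ofList [])
        (.ofList (List.replicate (2 * v n + 2) true))) ()
      (fieldTapes (.ofList n.bits) (.ofList (fieldRep (p (2 * v n + 2)))) (.ofList [])
        (.ofList [])) (2 * (2 * v n + 2) + 2) := by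
    have := Prog.exec_clear (List.replicate (2 * v n + 2) true)
    rw [List.length_replicate] at this
    refine this.map (fun i j _ => Subsingleton.elim i j) ?_ ?_ ?_
    · intro i; fin_cases i; simp [fieldTapes]
    · intro i; fin_cases i; simp [fieldTapes]
    · rintro (i | _ | (_ | _) | i | i) hi
      · rfl
      · rfl
      · rfl
      · exact absurd rfl (hi 0)
      · rfl
      · rfl
  have hP := (h1.bind (h2.bind (h3.bind h4)) : P.Exec _ _ _ _)
  have hu2 : u (2 * v n + 2) ≤ u (10 * v n) + u 2 := by
    rcases Nat.eq_zero_or_pos (v n) with h | h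
    · simp [h]
    · exact (hu (by omega)).trans (Nat.le_add_right _ _)
  refine Prog.Exec.computesIn (e := ()) ?_
  have e1 : (Sum.elim (fun i : Fin 1 => Tape.ofList (![n.bits] i)) fun _ => Tape.ofList []) =
      fieldTapes (VW := V.Work) (GW := G.Work) (.ofList n.bits) (.ofList []) (.ofList [])
        (.ofList []) := by
    funext i
    rcases i with i | _ | (_ | _) | i | i <;> simp [fieldTapes]
  have e2 : (Sum.elim (fun i : Fin 1 => Tape.ofList (![n.bits] i)) fun i =>
        i.elim (Tape.ofList (fieldRep (p (2 * v n + 2)))) fun _ => Tape.ofList []) =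
      fieldTapes (VW := V.Work) (GW := G.Work) (.ofList n.bits)
        (.ofList (fieldRep (p (2 * v n + 2)))) (.ofList []) (.ofList []) := by
    funext i
    rcases i with i | _ | (_ | _) | i | i <;> simp [fieldTapes]
  rw [e1, e2]
  refine hP.mono ?_
  have : c * u (2 * v n + 2) ≤ c * u (10 * v n) + c * u 2 := by
    rw [← mul_add]; exact Nat.mul_le_mul_left c hu2
  simp only [add_mul]
  have h0 := Nat.zero_le (c * u 2 * u (10 * v n))
  nlinarith

/-! ### Polynomial hashing -/

theorem segPoly_coeff (s : List Bool) (i : ℕ) :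
    (segPoly s).coeff i = if s.getD i false then 1 else 0 := by
  have h : (segPoly s).coeff i
      = ∑ j ∈ Finset.range s.length, if j = i then (if s.getD i false then (1 : ZMod 2) else 0)
        else 0 := by
    rw [segPoly, finsetSum_coeff]
    refine Finset.sum_congr rfl fun j _ => ?_
    by_cases hj : j = i
    · subst hj
      cases s.getD j false <;> simp
    · cases s.getD j false <;> simp [coeff_X_pow, hj, Ne.symm hj]
  rw [h, Finset.sum_ite_eq']
  split_ifs with h1 h2
  · rfl
  · rfl
  · rw [List.getD_eq_default _ _ (by simpa using h1)] at *
    simp_all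
  · rfl

theorem elemPoly_coeff (s : List Bool) (i : ℕ) :
    (elemPoly s).coeff i = if s.reverse.getD i false then 1 else 0 :=
  segPoly_coeff _ _

theorem degree_segPoly_lt (s : List Bool) : (segPoly s).degree < s.length := by
  rw [degree_lt_iff_coeff_zero]
  intro m hm
  rw [segPoly_coeff, List.getD_eq_default _ _ hm]
  simp

theorem degree_elemPoly_lt (s : List Bool) : (elemPoly s).degree < s.length := by
  simpa [elemPoly] using degree_segPoly_lt s.reverse

@[simp] theorem length_elemBits (k : ℕ) (g : (ZMod 2)[X]) : (elemBits k g).length = k := by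
  simp [elemBits]

theorem zmod_two_ite (c : ZMod 2) : (if decide (c = 1) then (1 : ZMod 2) else 0) = c := by
  revert c; decide

theorem elemPoly_elemBits {k : ℕ} {g : (ZMod 2)[X]} (h : g.degree < k) :
    elemPoly (elemBits k g) = g := by
  ext i
  rw [elemPoly_coeff, elemBits, List.reverse_reverse]
  rcases lt_or_ge i k with hi | hi
  · rw [List.getD_eq_getElem _ _ (by simpa using hi), List.getElem_ofFn, zmod_two_ite]
  · rw [List.getD_eq_default _ _ (by simpa using hi)]
    rw [degree_lt_iff_coeff_zero] at h
    simp [h i hi]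

theorem elemBits_elemPoly {k : ℕ} {s : List Bool} (h : s.length = k) :
    elemBits k (elemPoly s) = s := by
  subst h
  rw [← List.reverse_inj, elemBits, List.reverse_reverse]
  refine List.ext_getElem (by simp) fun i h1 h2 => ?_
  rw [List.getElem_ofFn]
  simp only [elemPoly_coeff]
  rw [List.getD_eq_getElem _ _ h2]
  cases s.reverse[i] <;> simp

theorem elemBits_zero (k : ℕ) : elemBits k 0 = List.replicate k false := by
  simp [elemBits]

theorem elemBits_succ (k : ℕ) (g : (ZMod 2)[X]) :
    elemBits (k + 1) g = (List.ofFn fun i : Fin k => decide (g.coeff (i + 1) = 1)).reverse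
      ++ [decide (g.coeff 0 = 1)] := by
  rw [elemBits, List.ofFn_succ, List.reverse_cons]
  rfl

/-- Adding a constant changes the last letter of the string of an element. -/
theorem exists_elemBits_eq {k : ℕ} (hk : 1 ≤ k) (g : (ZMod 2)[X]) (b : Bool) :
    ∃ s x, s.length + 1 = k ∧ elemBits k g = s ++ [x] ∧
      elemBits k (g + if b then 1 else 0) = s ++ [xor b x] := by
  obtain ⟨k, rfl⟩ := Nat.exists_eq_add_of_le' hk
  refine ⟨_, _, ?_, elemBits_succ k g, ?_⟩
  · simp
  · rw [elemBits_succ]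
    have h0 : decide ((g + if b then 1 else 0).coeff 0 = 1) = xor b (decide (g.coeff 0 = 1)) := by
      have : ∀ c : ZMod 2, decide (c + 1 = 1) = !decide (c = 1) := by decide
      cases b
      · simp
      · simpa using this (g.coeff 0)
    rw [h0]
    congr 4
    funext i
    cases b <;> simp [coeff_one]

theorem monic_of_irreducible {p : (ZMod 2)[X]} (hp : Irreducible p) : p.Monic := by
  have h : ∀ c : ZMod 2, c ≠ 0 → c = 1 := by decide
  exact h _ (leadingCoeff_ne_zero.2 hp.ne_zero)

theorem degree_modByMonic_lt_natDegree {p : (ZMod 2)[X]} (hp : Irreducible p) (g : (ZMod 2)[X]) :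
    (g %ₘ p).degree < p.natDegree := by
  rw [← degree_eq_natDegree hp.ne_zero]
  exact degree_modByMonic_lt g (monic_of_irreducible hp)

/-- The Horner step `g * Z + b` of the hash function, in the field given by `p`. -/
noncomputable def hashStep (p Z g : (ZMod 2)[X]) (b : Bool) : (ZMod 2)[X] :=
  (g * Z) %ₘ p + if b then 1 else 0

/-- The hash value of the string `y = b₁ ⋯ b_n` with key `Z`: the element `∑ b_i Z^(n-i)` of the
field given by `p`. -/
noncomputable def hashPoly (p Z : (ZMod 2)[X]) (y : List Bool) : (ZMod 2)[X] :=
  y.foldl (hashStep p Z) 0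

theorem degree_bit_lt {p : (ZMod 2)[X]} (hp : Irreducible p) (b : Bool) :
    (if b then (1 : (ZMod 2)[X]) else 0).degree < p.natDegree := by
  have : 0 < p.natDegree := hp.natDegree_pos
  cases b
  · simp
  · simpa using this

theorem degree_hashStep_lt {p : (ZMod 2)[X]} (hp : Irreducible p) (Z g : (ZMod 2)[X]) (b : Bool) :
    (hashStep p Z g b).degree < p.natDegree :=
  (degree_add_le _ _).trans_lt
    (max_lt (degree_modByMonic_lt_natDegree hp _) (degree_bit_lt hp b))

/-- The polynomial `∑ b_i X^(n-i)` of the string `b₁ ⋯ b_n`. -/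
noncomputable def wordPoly (y : List Bool) : (ZMod 2)[X] :=
  y.foldl (fun g b => g * X + C (if b then 1 else 0)) 0

theorem wordPoly_append (y : List Bool) (b : Bool) :
    wordPoly (y ++ [b]) = wordPoly y * X + C (if b then 1 else 0) := by
  simp [wordPoly]

theorem hashPoly_append (p Z : (ZMod 2)[X]) (y : List Bool) (b : Bool) :
    hashPoly p Z (y ++ [b]) = hashStep p Z (hashPoly p Z y) b := by
  simp [hashPoly]

theorem degree_wordPoly_lt (y : List Bool) : (wordPoly y).degree < y.length := by
  induction y using List.reverseRecOn with
  | nil => simp [wordPoly]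
  | append_singleton y b ih =>
    rw [degree_lt_iff_coeff_zero] at ih ⊢
    intro m hm
    simp only [List.length_append, List.length_singleton] at hm
    obtain ⟨m, rfl⟩ : ∃ m', m = m' + 1 := ⟨m - 1, by omega⟩
    rw [wordPoly_append, coeff_add, coeff_mul_X, ih m (by omega), coeff_C_succ, add_zero]

theorem wordPoly_injective {x y : List Bool} (h : x.length = y.length)
    (hxy : wordPoly x = wordPoly y) : x = y := by
  induction x using List.reverseRecOn generalizing y with
  | nil => exact (List.eq_nil_of_length_eq_zero h.symm).symm
  | append_singleton x a ih =>
    rcases List.eq_nil_or_concat y with rfl | ⟨y, b, rfl⟩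
    · simp at h
    rw [List.concat_eq_append, wordPoly_append, wordPoly_append] at hxy
    have h0 := congrArg (fun q => coeff q 0) hxy
    simp only [coeff_add, mul_coeff_zero, coeff_X_zero, mul_zero, coeff_C_zero, zero_add] at h0
    have hab : a = b := by cases a <;> cases b <;> simp_all
    subst hab
    have := mul_right_cancel₀ X_ne_zero (add_right_cancel hxy)
    rw [ih (by simpa using h) this, List.concat_eq_append]

theorem adjoinRoot_mk_modByMonic (p g : (ZMod 2)[X]) :
    AdjoinRoot.mk p (g %ₘ p) = AdjoinRoot.mk p g := by
  rw [AdjoinRoot.mk_eq_mk]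
  refine ⟨-(g /ₘ p), ?_⟩
  have := modByMonic_add_div g p
  linear_combination this

theorem adjoinRoot_mk_hashPoly (p Z : (ZMod 2)[X]) (y : List Bool) :
    AdjoinRoot.mk p (hashPoly p Z y) = ((wordPoly y).map (AdjoinRoot.of p)).eval
      (AdjoinRoot.mk p Z) := by
  induction y using List.reverseRecOn with
  | nil => simp [hashPoly, wordPoly]
  | append_singleton y b ih =>
    rw [hashPoly_append, hashStep, map_add, adjoinRoot_mk_modByMonic, map_mul, ih,
      wordPoly_append]
    cases b <;> simp

/-- Two different strings of length `n` have the same hash value for at most `n` keys, since these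
keys are roots of a nonzero polynomial of degree less than `n`. -/
theorem ncard_collision_le {p : (ZMod 2)[X]} (hp : Irreducible p) {k : ℕ} (hk : p.natDegree = k)
    {x y : List Bool} (hlen : y.length = x.length) (hne : y ≠ x) :
    {z : Fin k → Bool | hashPoly p (elemPoly (List.ofFn z)) y
      = hashPoly p (elemPoly (List.ofFn z)) x}.ncard ≤ x.length := by
  have : Fact (Irreducible p) := ⟨hp⟩
  set q : (ZMod 2)[X] := wordPoly y - wordPoly x with hq
  have hq0 : q ≠ 0 := fun h => hne (wordPoly_injective hlen (sub_eq_zero.1 h))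
  have hqm : q.map (AdjoinRoot.of p) ≠ 0 := (Polynomial.map_ne_zero_iff
    (AdjoinRoot.of p).injective).2 hq0
  have hdeg : (q.map (AdjoinRoot.of p)).natDegree ≤ x.length := by
    refine natDegree_map_le.trans (natDegree_le_of_degree_le ?_)
    refine (degree_sub_le _ _).trans (max_le ?_ (degree_wordPoly_lt x).le)
    rw [← hlen]
    exact (degree_wordPoly_lt y).le
  let F : (Fin k → Bool) → AdjoinRoot p := fun z => AdjoinRoot.mk p (elemPoly (List.ofFn z))
  have hF : F.Injective := by
    intro z z' h
    have hd : p ∣ elemPoly (List.ofFn z) - elemPoly (List.ofFn z') := AdjoinRoot.mk_eq_mk.1 h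
    have hlt : (elemPoly (List.ofFn z) - elemPoly (List.ofFn z')).degree < p.degree := by
      rw [degree_eq_natDegree hp.ne_zero, hk]
      refine (degree_sub_le _ _).trans_lt (max_lt ?_ ?_)
      · simpa using degree_elemPoly_lt (List.ofFn z)
      · simpa using degree_elemPoly_lt (List.ofFn z')
    have h0 := sub_eq_zero.1 (eq_zero_of_dvd_of_degree_lt hd hlt)
    have := congrArg (elemBits k) h0
    rw [elemBits_elemPoly (by simp), elemBits_elemPoly (by simp)] at this
    exact List.ofFn_injective this
  have hsub : F '' {z : Fin k → Bool | hashPoly p (elemPoly (List.ofFn z)) y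
      = hashPoly p (elemPoly (List.ofFn z)) x} ⊆ ((q.map (AdjoinRoot.of p)).roots.toFinset : Set _) := by
    rintro _ ⟨z, hz, rfl⟩
    have := congrArg (AdjoinRoot.mk p) hz
    rw [adjoinRoot_mk_hashPoly, adjoinRoot_mk_hashPoly] at this
    simp only [Finset.mem_coe, Multiset.mem_toFinset, mem_roots hqm, IsRoot.def]
    rw [hq, Polynomial.map_sub, eval_sub, this, sub_self]
  rw [← Set.ncard_image_of_injective _ hF]
  refine (Set.ncard_le_ncard hsub (Finset.finite_toSet _)).trans ?_
  rw [Set.ncard_coe_finset]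
  exact (Multiset.toFinset_card_le _).trans ((card_roots' _).trans hdeg)

/-- The keys for which the hash value of `x` is the hash value of another word of `L` of the same
length. -/
def badKeys (L : Language Bool) (p : (ZMod 2)[X]) (k : ℕ) (x : List Bool) : Set (Fin k → Bool) :=
  {z | ∃ y ∈ L, y.length = x.length ∧ y ≠ x ∧
    hashPoly p (elemPoly (List.ofFn z)) y = hashPoly p (elemPoly (List.ofFn z)) x}

theorem ncard_badKeys_le (L : Language Bool) {p : (ZMod 2)[X]} (hp : Irreducible p) {k : ℕ}
    (hk : p.natDegree = k) (x : List Bool) :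
    (badKeys L p k x).ncard ≤ {y : List Bool | y ∈ L ∧ y.length = x.length}.ncard * x.length := by
  have hfin : {y : List Bool | y ∈ L ∧ y.length = x.length}.Finite :=
    (List.finite_length_eq Bool x.length).subset fun y hy => hy.2
  classical
  let B : List Bool → Finset (Fin k → Bool) := fun y =>
    if y = x then ∅ else Finset.univ.filter fun z =>
      hashPoly p (elemPoly (List.ofFn z)) y = hashPoly p (elemPoly (List.ofFn z)) x
  have hsub : badKeys L p k x ⊆ (hfin.toFinset.biUnion B : Finset _) := by
    rintro z ⟨y, hyL, hyl, hne, hz⟩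
    simp only [Finset.coe_biUnion, Set.mem_iUnion, Finset.mem_coe]
    refine ⟨y, by simpa using ⟨hyL, hyl⟩, ?_⟩
    simp [B, hne, hz]
  refine (Set.ncard_le_ncard hsub (Finset.finite_toSet _)).trans ?_
  rw [Set.ncard_coe_finset, Set.ncard_eq_toFinset_card _ hfin]
  refine Finset.card_biUnion_le_card_mul _ _ _ fun y hy => ?_
  by_cases hne : y = x
  · simp [B, hne]
  · have hyl : y.length = x.length := by
      simp only [Set.Finite.mem_toFinset, Set.mem_ofPred_eq] at hy
      exact hy.2
    have := ncard_collision_le hp hk hyl hne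
    rw [Set.ncard_eq_toFinset_card'] at this
    simpa [B, hne] using this

/-! ### Binary numbers -/

theorem bitVal_append_replicate (s : List Bool) (j : ℕ) :
    bitVal (s ++ List.replicate j false) = bitVal s := by
  induction s with
  | nil =>
    induction j with
    | zero => rfl
    | succ j ih => simpa [List.replicate_succ, bitVal] using ih
  | cons b s ih => simp [bitVal, ih]

theorem bitVal_bits (n : ℕ) : bitVal n.bits = n := by
  induction n using Nat.binaryRec' with
  | zero => simp [bitVal]
  | bit b n h ih =>
    rw [Nat.bits_append_bit n b h, bitVal, ih, Nat.bit_val, add_comm]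

theorem exists_bits_eq_append {n : ℕ} (hn : 1 ≤ n) : ∃ u, n.bits = u ++ [true] := by
  induction n using Nat.binaryRec' with
  | zero => simp at hn
  | bit b n h ih =>
    rw [Nat.bits_append_bit n b h]
    rcases Nat.eq_zero_or_pos n with rfl | hn'
    · exact ⟨[], by simp [h rfl]⟩
    · obtain ⟨u, hu⟩ := ih hn'
      exact ⟨b :: u, by simp [hu]⟩

theorem exists_eq_bits_append (s : List Bool) :
    ∃ n j, s = Nat.bits n ++ List.replicate j false := by
  induction s with
  | nil => exact ⟨0, 0, by simp⟩
  | cons b s ih =>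
    obtain ⟨n, j, rfl⟩ := ih
    by_cases h : n = 0 → b = true
    · exact ⟨Nat.bit b n, j, by rw [Nat.bits_append_bit n b h, List.cons_append]⟩
    · push Not at h
      obtain ⟨rfl, hb⟩ := h
      simp only [Bool.not_eq_true] at hb
      exact ⟨0, j + 1, by simp [hb, List.replicate_succ]⟩

/-! ### Verification of hash values -/

/-- The string that encodes the length `n`, the key `z` and the hash value `g`: the interleaving of
`n` in binary, padded with zeros, with `z` and the string of the element `g`. -/
noncomputable def hashCode (p : (ZMod 2)[X]) (n : ℕ) (z : List Bool) (g : (ZMod 2)[X]) :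
    List Bool :=
  interleave (n.bits ++ List.replicate (p.natDegree - n.bits.length) false) z
    (elemBits p.natDegree g)

/-- The string `a` encodes the length of `y`, some key, and the hash value of `y` for this key, in
the field given by `q |y|`. -/
def IsHash (q : ℕ → (ZMod 2)[X]) (a y : List Bool) : Prop :=
  1 ≤ y.length ∧ y.length.bits.length ≤ (q y.length).natDegree ∧
    ∃ z : List Bool, z.length = (q y.length).natDegree ∧
      a = hashCode (q y.length) y.length z (hashPoly (q y.length) (elemPoly z) y)

/-- The registers of the verifier: input, word, counter, length, key, expected hash value, field,
current hash value, and product. -/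
inductive Reg where
  | input | word | count | length | key | hash | field | acc | prod

theorem finite_reg : Finite Reg :=
  Finite.of_surjective (fun i : Fin 9 => (![.input, .word, .count, .length, .key, .hash, .field,
    .acc, .prod] : Fin 9 → Reg) i) fun r => by
      cases r
      exacts [⟨0, rfl⟩, ⟨1, rfl⟩, ⟨2, rfl⟩, ⟨3, rfl⟩, ⟨4, rfl⟩, ⟨5, rfl⟩, ⟨6, rfl⟩, ⟨7, rfl⟩,
        ⟨8, rfl⟩]

/-- The tapes of the verifier: the registers and the blank work tapes of the two subroutines. -/
def verifierTapes {W : Type} (a y n l z h f g m : Tape) : Reg ⊕ W → Tape :=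
  Sum.elim (fun r => match r with
    | .input => a | .word => y | .count => n | .length => l | .key => z | .hash => h
    | .field => f | .acc => g | .prod => m) fun _ => Tape.ofList []

namespace Verifier

variable {TW MW : Type}

/-- The tapes of the machine that generates the field. -/
def fieldTape : Fin 1 ⊕ Option TW → Reg ⊕ (TW ⊕ MW)
  | Sum.inl _ => Sum.inl .length
  | Sum.inr none => Sum.inl .field
  | Sum.inr (some w) => Sum.inr (Sum.inl w)

/-- The tapes of the machine that multiplies. -/
def mulTape : Fin 3 ⊕ Option MW → Reg ⊕ (TW ⊕ MW)
  | Sum.inl i => Sum.inl (![.field, .acc, .key] i)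
  | Sum.inr none => Sum.inl .prod
  | Sum.inr (some w) => Sum.inr (Sum.inr w)

theorem fieldTape_injective : (fieldTape (TW := TW) (MW := MW)).Injective := by
  rintro (i | _ | i) (j | _ | j) h <;> simp_all [fieldTape]
  exact Subsingleton.elim _ _

theorem mulTape_injective : (mulTape (TW := TW) (MW := MW)).Injective := by
  rintro (i | _ | i) (j | _ | j) h
  · fin_cases i <;> fin_cases j <;> simp_all [mulTape]
  · fin_cases i <;> simp_all [mulTape]
  · simp_all [mulTape]
  · fin_cases j <;> simp_all [mulTape]
  all_goals simp_all [mulTape]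

theorem inl_comp_injective {W : Type} {k : ℕ} {r : Fin k → Reg} (hr : r.Injective) :
    (fun i => (Sum.inl (r i) : Reg ⊕ W)).Injective :=
  Sum.inl_injective.comp hr

theorem deinterleave_regs_injective :
    Function.Injective (![.input, .count, .key, .hash] : Fin 4 → Reg) := by
  intro i j hij
  fin_cases i <;> fin_cases j <;> simp_all

theorem strip_regs_injective : Function.Injective (![.count, .length] : Fin 2 → Reg) := by
  intro i j hij
  fin_cases i <;> fin_cases j <;> simp_all

theorem prepare_regs_injective : Function.Injective (![.field, .key, .acc] : Fin 3 → Reg) := by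
  intro i j hij
  fin_cases i <;> fin_cases j <;> simp_all

theorem moveFlip_regs_injective : Function.Injective (![.prod, .acc] : Fin 2 → Reg) := by
  intro i j hij
  fin_cases i <;> fin_cases j <;> simp_all

theorem equal_regs_injective : Function.Injective (![.acc, .hash] : Fin 2 → Reg) := by
  intro i j hij
  fin_cases i <;> fin_cases j <;> simp_all

/-- The processing of a letter `b` of the word in the evaluation of the hash function: multiply the
current value by the key, add `b`, and count down. The value `none` stands for the end of the
word. -/
noncomputable def processLetter (M : Transducer 3) :
    Option Bool → Prog (Reg ⊕ (TW ⊕ M.Work)) (Option Bool)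
  | none => .ret (some true)
  | some b => ((Prog.ofTransducer M).map mulTape).bind fun _ =>
      ((Prog.moveFlip b).map fun i => Sum.inl ((![.prod, .acc] : Fin 2 → Reg) i)).bind fun _ =>
        (Prog.decrement.map fun i => Sum.inl ((![.count] : Fin 1 → Reg) i)).bind fun u =>
          .ret (if u then some false else none)

/-- One round of the evaluation of the hash function. -/
noncomputable def round (M : Transducer 3) : Prog (Reg ⊕ (TW ⊕ M.Work)) (Option Bool) :=
  (Prog.readLetter.map fun i => Sum.inl ((![.word] : Fin 1 → Reg) i)).bind (processLetter M)

/-- If `P` exits with `true`, continue with `Q`; otherwise exit with `false`. -/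
def andThen {ι : Type} (P Q : Prog ι Bool) : Prog ι Bool :=
  P.bind fun b => match b with
    | true => Q
    | false => .ret false

theorem exec_andThen {ι : Type} {P Q : Prog ι Bool} {τ τ₁ τ' : ι → Tape} {e : Bool} {B B' : ℕ}
    (h : P.Exec τ true τ₁ B) (h' : Q.Exec τ₁ e τ' B') : (andThen P Q).Exec τ e τ' (B + B') :=
  h.bind h'

theorem exec_andThen_false {ι : Type} {P Q : Prog ι Bool} {τ τ' : ι → Tape} {B : ℕ}
    (h : P.Exec τ false τ' B) : (andThen P Q).Exec τ false τ' (B + 1) :=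
  h.bind (Prog.exec_ret _ _)

/-- The verifier of hash values: on input `(a, y)` it checks whether `IsHash q a y`. -/
noncomputable def program (T : Transducer 1) (M : Transducer 3) :
    Prog (Reg ⊕ (T.Work ⊕ M.Work)) Bool :=
  andThen (Prog.deinterleave.map fun i =>
    Sum.inl ((![.input, .count, .key, .hash] : Fin 4 → Reg) i)) <|
  andThen (Prog.strip.map fun i => Sum.inl ((![.count, .length] : Fin 2 → Reg) i)) <|
  ((Prog.ofTransducer T).map fieldTape).bind fun _ =>
  andThen (Prog.prepare.map fun i => Sum.inl ((![.field, .key, .acc] : Fin 3 → Reg) i)) <|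
  andThen (round M).loop <|
  andThen (Prog.decrement.map fun i => Sum.inl ((![.count] : Fin 1 → Reg) i)) <|
  Prog.equal.map fun i => Sum.inl ((![.acc, .hash] : Fin 2 → Reg) i)

section

variable {p : (ZMod 2)[X]} {M : Transducer 3} {b : ℕ}

theorem exec_round_cons (hp : Irreducible p)
    (hM : ∀ g g' : (ZMod 2)[X], g.degree < p.degree → g'.degree < p.degree →
      M.ComputesIn ![fieldRep p, elemBits p.natDegree g, elemBits p.natDegree g']
        (elemBits p.natDegree ((g * g') %ₘ p)) b)
    {a h t : Tape} {z : List Bool} (hz : z.length = p.natDegree) (l r s : List Bool) (x : Bool)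
    (hs : s.length = p.natDegree) {g : (ZMod 2)[X]} (hg : g.degree < p.natDegree) :
    (bitVal s ≠ 0 → ∃ s' : List Bool, s'.length = p.natDegree ∧ bitVal s' + 1 = bitVal s ∧
      (round (TW := TW) M).Exec
        (verifierTapes a (.zip l (x :: r)) (.ofList s) t (.ofList z) h (.ofList (fieldRep p))
          (.ofList (elemBits p.natDegree g)) (.ofList [])) none
        (verifierTapes a (.zip (x :: l) r) (.ofList s') t (.ofList z) h (.ofList (fieldRep p))
          (.ofList (elemBits p.natDegree (hashStep p (elemPoly z) g x))) (.ofList []))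
        (b + 4 * p.natDegree + 7)) ∧
    (bitVal s = 0 → ∃ B τ', (round (TW := TW) M).Exec
        (verifierTapes a (.zip l (x :: r)) (.ofList s) t (.ofList z) h (.ofList (fieldRep p))
          (.ofList (elemBits p.natDegree g)) (.ofList [])) (some false) τ' B) := by
  have hk : 1 ≤ p.natDegree := hp.natDegree_pos
  have h1 : (Prog.readLetter.map fun i =>
      (Sum.inl ((![.word] : Fin 1 → Reg) i) : Reg ⊕ (TW ⊕ M.Work))).Exec
        (verifierTapes a (.zip l (x :: r)) (.ofList s) t (.ofList z) h (.ofList (fieldRep p))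
          (.ofList (elemBits p.natDegree g)) (.ofList [])) (some x)
        (verifierTapes a (.zip (x :: l) r) (.ofList s) t (.ofList z) h (.ofList (fieldRep p))
          (.ofList (elemBits p.natDegree g)) (.ofList [])) 1 := by
    refine (Prog.exec_readLetter_cons l r x).map
      (inl_comp_injective fun i j _ => Subsingleton.elim i j) ?_ ?_ ?_
    · intro i; fin_cases i; rfl
    · intro i; fin_cases i; rfl
    · rintro (_ | _) hi
      · rename_i i
        cases i <;> first | rfl | exact absurd rfl (hi 0)
      · rfl
  have h2 : ((Prog.ofTransducer M).map (mulTape (TW := TW))).Exec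
        (verifierTapes a (.zip (x :: l) r) (.ofList s) t (.ofList z) h (.ofList (fieldRep p))
          (.ofList (elemBits p.natDegree g)) (.ofList [])) ()
        (verifierTapes a (.zip (x :: l) r) (.ofList s) t (.ofList z) h (.ofList (fieldRep p))
          (.ofList (elemBits p.natDegree g))
          (.ofList (elemBits p.natDegree ((g * elemPoly z) %ₘ p)))) (b + 1) := by
    have hz' : (elemPoly z).degree < p.degree := by
      rw [degree_eq_natDegree hp.ne_zero, ← hz]
      exact degree_elemPoly_lt z
    have hg' : g.degree < p.degree := by rwa [degree_eq_natDegree hp.ne_zero]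
    have hc := hM g (elemPoly z) hg' hz'
    rw [elemBits_elemPoly hz] at hc
    refine (Prog.exec_ofTransducer hc).map mulTape_injective ?_ ?_ ?_
    · rintro (i | _ | i)
      · fin_cases i <;> rfl
      · rfl
      · rfl
    · rintro (i | _ | i)
      · fin_cases i <;> rfl
      · rfl
      · rfl
    · rintro (i | i) hi
      · cases i <;> first | rfl | exact absurd rfl (hi (Sum.inr none))
      · rfl
  have h3 : ((Prog.moveFlip x).map fun i =>
      (Sum.inl ((![.prod, .acc] : Fin 2 → Reg) i) : Reg ⊕ (TW ⊕ M.Work))).Exec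
        (verifierTapes a (.zip (x :: l) r) (.ofList s) t (.ofList z) h (.ofList (fieldRep p))
          (.ofList (elemBits p.natDegree g))
          (.ofList (elemBits p.natDegree ((g * elemPoly z) %ₘ p)))) ()
        (verifierTapes a (.zip (x :: l) r) (.ofList s) t (.ofList z) h (.ofList (fieldRep p))
          (.ofList (elemBits p.natDegree (hashStep p (elemPoly z) g x))) (.ofList []))
        (2 * p.natDegree + 2) := by
    obtain ⟨w, c, hw, hw1, hw2⟩ := exists_elemBits_eq hk ((g * elemPoly z) %ₘ p) x
    rw [hashStep, hw1, hw2]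
    refine ((Prog.exec_moveFlip x c w (elemBits p.natDegree g) (by simp [hw])).map
      (inl_comp_injective moveFlip_regs_injective) ?_ ?_ ?_).mono (by omega)
    · intro i; fin_cases i <;> rfl
    · intro i; fin_cases i <;> rfl
    · rintro (i | i) hi
      · cases i <;> first | rfl | exact absurd rfl (hi 0) | exact absurd rfl (hi 1)
      · rfl
  have h4 : ∀ {e : Bool} {s' : List Bool} {B : ℕ},
      Prog.decrement.Exec ![.ofList s] e ![.ofList s'] B →
      (Prog.decrement.map fun i =>
        (Sum.inl ((![.count] : Fin 1 → Reg) i) : Reg ⊕ (TW ⊕ M.Work))).Exec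
        (verifierTapes a (.zip (x :: l) r) (.ofList s) t (.ofList z) h (.ofList (fieldRep p))
          (.ofList (elemBits p.natDegree (hashStep p (elemPoly z) g x))) (.ofList [])) e
        (verifierTapes a (.zip (x :: l) r) (.ofList s') t (.ofList z) h (.ofList (fieldRep p))
          (.ofList (elemBits p.natDegree (hashStep p (elemPoly z) g x))) (.ofList [])) B := by
    intro e s' B hd
    refine hd.map (inl_comp_injective fun i j _ => Subsingleton.elim i j) ?_ ?_ ?_
    · intro i; fin_cases i; rfl
    · intro i; fin_cases i; rfl
    · rintro (i | i) hi
      · cases i <;> first | rfl | exact absurd rfl (hi 0)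
      · rfl
  constructor
  · intro hne
    obtain ⟨s', hs', hv, hd⟩ := Prog.exec_decrement s hne
    exact ⟨s', hs'.trans hs, hv,
      (h1.bind (Q := processLetter M) (h2.bind (h3.bind ((h4 hd).bind (Prog.exec_ret _ _))))).mono (by omega)⟩
  · intro h0
    obtain ⟨s', hd⟩ := Prog.exec_decrement_zero s h0
    exact ⟨_, _, h1.bind (Q := processLetter M) (h2.bind (h3.bind ((h4 hd).bind (Prog.exec_ret _ _))))⟩

theorem exec_round_nil {a n t z h f g m : Tape} (l : List Bool) :
    (round (TW := TW) M).Exec (verifierTapes a (.zip l []) n t z h f g m) (some true)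
      (verifierTapes a (.zip l []) n t z h f g m) 2 := by
  have h1 : (Prog.readLetter.map fun i =>
      (Sum.inl ((![.word] : Fin 1 → Reg) i) : Reg ⊕ (TW ⊕ M.Work))).Exec
        (verifierTapes a (.zip l []) n t z h f g m) none
        (verifierTapes a (.zip l []) n t z h f g m) 1 := by
    refine (Prog.exec_readLetter_nil l).map
      (inl_comp_injective fun i j _ => Subsingleton.elim i j) ?_ ?_ fun _ _ => rfl
    · intro i; fin_cases i; rfl
    · intro i; fin_cases i; rfl
  exact h1.bind (Q := processLetter M) (Prog.exec_ret _ _)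

theorem exec_loop (hp : Irreducible p)
    (hM : ∀ g g' : (ZMod 2)[X], g.degree < p.degree → g'.degree < p.degree →
      M.ComputesIn ![fieldRep p, elemBits p.natDegree g, elemBits p.natDegree g']
        (elemBits p.natDegree ((g * g') %ₘ p)) b)
    {a h t : Tape} {z : List Bool} (hz : z.length = p.natDegree) (l r s : List Bool)
    (hs : s.length = p.natDegree) {g : (ZMod 2)[X]} (hg : g.degree < p.natDegree) :
    (r.length ≤ bitVal s → ∃ s' : List Bool, s'.length = p.natDegree ∧
      bitVal s' + r.length = bitVal s ∧ ∃ w : Tape, (round (TW := TW) M).loop.Exec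
        (verifierTapes a (.zip l r) (.ofList s) t (.ofList z) h (.ofList (fieldRep p))
          (.ofList (elemBits p.natDegree g)) (.ofList [])) true
        (verifierTapes a w (.ofList s') t (.ofList z) h (.ofList (fieldRep p))
          (.ofList (elemBits p.natDegree (r.foldl (hashStep p (elemPoly z)) g))) (.ofList []))
        (r.length * (b + 4 * p.natDegree + 7) + 2)) ∧
    (bitVal s < r.length → ∃ B τ', (round (TW := TW) M).loop.Exec
        (verifierTapes a (.zip l r) (.ofList s) t (.ofList z) h (.ofList (fieldRep p))
          (.ofList (elemBits p.natDegree g)) (.ofList [])) false τ' B) := by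
  induction r generalizing l s g with
  | nil =>
    refine ⟨fun _ => ⟨s, hs, rfl, .zip l [], ?_⟩, fun h => absurd h (Nat.not_lt_zero _)⟩
    exact (exec_round_nil l).loop_done.mono (by simp)
  | cons x r ih =>
    obtain ⟨h1, h2⟩ := exec_round_cons (TW := TW) (a := a) (h := h) (t := t) hp hM hz l r s x hs hg
    by_cases h0 : bitVal s = 0
    · refine ⟨fun hle => by simp [h0] at hle, fun _ => ?_⟩
      obtain ⟨B, τ', hr⟩ := h2 h0
      exact ⟨B, τ', hr.loop_done⟩
    · obtain ⟨s', hs', hv, hr⟩ := h1 h0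
      obtain ⟨ih1, ih2⟩ := ih (x :: l) s' hs' (degree_hashStep_lt hp (elemPoly z) g x)
      constructor
      · intro hle
        rw [List.length_cons] at hle
        obtain ⟨s'', hs'', hv', w, hr'⟩ := ih1 (by omega)
        refine ⟨s'', hs'', by rw [List.length_cons]; omega, w, ?_⟩
        refine (hr.loop_again hr').mono (le_of_eq ?_)
        rw [List.length_cons]; ring
      · intro hlt
        rw [List.length_cons] at hlt
        obtain ⟨B, τ', hr'⟩ := ih2 (by omega)
        exact ⟨_, τ', hr.loop_again hr'⟩

end

/-- The verifier on an interleaving whose first track encodes a positive number. -/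
theorem exec_program_interleave {T : Transducer 1} {M : Transducer 3} {p : (ZMod 2)[X]}
    {n b b' : ℕ} (hn : 1 ≤ n) (hp : Irreducible p) (hT : T.ComputesIn ![n.bits] (fieldRep p) b')
    (hM : ∀ g g' : (ZMod 2)[X], g.degree < p.degree → g'.degree < p.degree →
      M.ComputesIn ![fieldRep p, elemBits p.natDegree g, elemBits p.natDegree g']
        (elemBits p.natDegree ((g * g') %ₘ p)) b)
    {j : ℕ} {z h : List Bool} (hz : z.length = (n.bits ++ List.replicate j false).length)
    (hh : h.length = (n.bits ++ List.replicate j false).length) (y : List Bool) :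
    (z.length = p.natDegree ∧ y.length = n ∧
        h = elemBits p.natDegree (hashPoly p (elemPoly z) y) →
      ∃ τ', (program T M).Exec
        (verifierTapes (.ofList (interleave (n.bits ++ List.replicate j false) z h)) (.ofList y)
          (.ofList []) (.ofList []) (.ofList []) (.ofList []) (.ofList []) (.ofList [])
          (.ofList [])) true τ'
        (b' + n * (b + 4 * p.natDegree + 7) + 11 * p.natDegree + 13)) ∧
    (¬ (z.length = p.natDegree ∧ y.length = n ∧
        h = elemBits p.natDegree (hashPoly p (elemPoly z) y)) →
      ∃ B τ', (program T M).Exec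
        (verifierTapes (.ofList (interleave (n.bits ++ List.replicate j false) z h)) (.ofList y)
          (.ofList []) (.ofList []) (.ofList []) (.ofList []) (.ofList []) (.ofList [])
          (.ofList [])) false τ' B) := by
  set s := n.bits ++ List.replicate j false with hs
  have hval : bitVal s = n := by rw [hs, bitVal_append_replicate, bitVal_bits]
  obtain ⟨τ, hdei⟩ := Prog.exec_deinterleave hz hh
  have h1 : (Prog.deinterleave.map fun i => (Sum.inl ((![.input, .count, .key, .hash] :
      Fin 4 → Reg) i) : Reg ⊕ (T.Work ⊕ M.Work))).Exec
        (verifierTapes (.ofList (interleave s z h)) (.ofList y)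
          (.ofList []) (.ofList []) (.ofList []) (.ofList []) (.ofList []) (.ofList [])
          (.ofList [])) true
        (verifierTapes τ (.ofList y) (.ofList s) (.ofList []) (.ofList z) (.ofList h) (.ofList [])
          (.ofList []) (.ofList [])) (4 * s.length + 2) := by
    refine hdei.map (inl_comp_injective deinterleave_regs_injective) ?_ ?_ ?_
    · intro i; fin_cases i <;> rfl
    · intro i; fin_cases i <;> rfl
    · rintro (i | i) hi
      · cases i <;> first | rfl | exact absurd rfl (hi 0) | exact absurd rfl (hi 1) |
          exact absurd rfl (hi 2) | exact absurd rfl (hi 3)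
      · rfl
  have h2 : (Prog.strip.map fun i => (Sum.inl ((![.count, .length] : Fin 2 → Reg) i) :
      Reg ⊕ (T.Work ⊕ M.Work))).Exec
        (verifierTapes τ (.ofList y) (.ofList s) (.ofList []) (.ofList z) (.ofList h) (.ofList [])
          (.ofList []) (.ofList [])) true
        (verifierTapes τ (.ofList y) (.ofList s) (.ofList n.bits) (.ofList z) (.ofList h)
          (.ofList []) (.ofList []) (.ofList [])) (2 * s.length + 2) := by
    obtain ⟨u, hu⟩ := exists_bits_eq_append hn
    have hst := Prog.exec_strip u j
    have e : u ++ true :: List.replicate j false = s := by rw [hs, hu]; simp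
    rw [e, ← hu] at hst
    refine hst.map (inl_comp_injective strip_regs_injective) ?_ ?_ ?_
    · intro i; fin_cases i <;> rfl
    · intro i; fin_cases i <;> rfl
    · rintro (i | i) hi
      · cases i <;> first | rfl | exact absurd rfl (hi 0) | exact absurd rfl (hi 1)
      · rfl
  have h3 : ((Prog.ofTransducer T).map (fieldTape (MW := M.Work))).Exec
        (verifierTapes τ (.ofList y) (.ofList s) (.ofList n.bits) (.ofList z) (.ofList h)
          (.ofList []) (.ofList []) (.ofList [])) ()
        (verifierTapes τ (.ofList y) (.ofList s) (.ofList n.bits) (.ofList z) (.ofList h)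
          (.ofList (fieldRep p)) (.ofList []) (.ofList [])) (b' + 1) := by
    refine (Prog.exec_ofTransducer hT).map fieldTape_injective ?_ ?_ ?_
    · rintro (i | _ | i)
      · fin_cases i; rfl
      · rfl
      · rfl
    · rintro (i | _ | i)
      · fin_cases i; rfl
      · rfl
      · rfl
    · rintro (i | i) hi
      · cases i <;> first | rfl | exact absurd rfl (hi (Sum.inr none))
      · rfl
  obtain ⟨f, fs, hf⟩ : ∃ f fs, fieldRep p = f :: fs :=
    List.exists_cons_of_length_eq_add_one (n := p.natDegree) (by simp [fieldRep])
  have hfs : fs.length = p.natDegree := by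
    have := congrArg List.length hf
    simpa [fieldRep] using this.symm
  by_cases hzk : z.length = p.natDegree
  swap
  · refine ⟨fun h => absurd h.1 hzk, fun _ => ?_⟩
    obtain ⟨B, τ', hpr⟩ := Prog.exec_prepare_false f fs z (by rw [hfs]; exact Ne.symm hzk)
    have h4 := hpr.map_extend (inl_comp_injective (W := T.Work ⊕ M.Work) prepare_regs_injective)
      (τ := verifierTapes τ (.ofList y) (.ofList s) (.ofList n.bits) (.ofList z) (.ofList h)
          (.ofList (fieldRep p)) (.ofList []) (.ofList []))
      (by rw [hf]; intro i; fin_cases i <;> rfl)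
    exact ⟨_, _, exec_andThen h1 (exec_andThen h2 (h3.bind (exec_andThen_false h4)))⟩
  have h4 : (Prog.prepare.map fun i => (Sum.inl ((![.field, .key, .acc] : Fin 3 → Reg) i) :
      Reg ⊕ (T.Work ⊕ M.Work))).Exec
        (verifierTapes τ (.ofList y) (.ofList s) (.ofList n.bits) (.ofList z) (.ofList h)
          (.ofList (fieldRep p)) (.ofList []) (.ofList [])) true
        (verifierTapes τ (.ofList y) (.ofList s) (.ofList n.bits) (.ofList z) (.ofList h)
          (.ofList (fieldRep p)) (.ofList (elemBits p.natDegree 0)) (.ofList []))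
        (2 * z.length + 3) := by
    have hpr := Prog.exec_prepare f fs z (hfs.trans hzk.symm)
    rw [elemBits_zero, ← hzk, hf]
    refine hpr.map (inl_comp_injective prepare_regs_injective) ?_ ?_ ?_
    · intro i; fin_cases i <;> rfl
    · intro i; fin_cases i <;> rfl
    · rintro (i | i) hi
      · cases i <;> first | rfl | exact absurd rfl (hi 0) | exact absurd rfl (hi 1) |
          exact absurd rfl (hi 2)
      · rfl
  have hsk : s.length = p.natDegree := by rw [← hz, hzk]
  obtain ⟨h5, h5'⟩ := exec_loop (TW := T.Work) (a := τ) (h := .ofList h) (t := .ofList n.bits) hp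
    hM hzk [] y s hsk (g := 0) (by simp)
  rcases lt_or_ge (bitVal s) y.length with hlt | hle
  · refine ⟨fun h => absurd h.2.1 (by omega), fun _ => ?_⟩
    obtain ⟨B, τ', hr⟩ := h5' hlt
    exact ⟨_, _, exec_andThen h1 (exec_andThen h2 (h3.bind (exec_andThen h4
      (exec_andThen_false hr))))⟩
  obtain ⟨s', hs', hv, w, h5⟩ := h5 hle
  change (round M).loop.Exec _ _ (verifierTapes τ w (.ofList s') (.ofList n.bits) (.ofList z)
    (.ofList h) (.ofList (fieldRep p))
    (.ofList (elemBits p.natDegree (hashPoly p (elemPoly z) y))) (.ofList [])) _ at h5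
  have h6 : ∀ {e : Bool} {s'' : List Bool} {B : ℕ},
      Prog.decrement.Exec ![.ofList s'] e ![.ofList s''] B →
      (Prog.decrement.map fun i =>
        (Sum.inl ((![.count] : Fin 1 → Reg) i) : Reg ⊕ (T.Work ⊕ M.Work))).Exec
        (verifierTapes τ w (.ofList s') (.ofList n.bits) (.ofList z) (.ofList h)
          (.ofList (fieldRep p)) (.ofList (elemBits p.natDegree (hashPoly p (elemPoly z) y)))
          (.ofList [])) e
        (verifierTapes τ w (.ofList s'') (.ofList n.bits) (.ofList z) (.ofList h)
          (.ofList (fieldRep p)) (.ofList (elemBits p.natDegree (hashPoly p (elemPoly z) y)))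
          (.ofList [])) B := by
    intro e s'' B hd
    refine hd.map (inl_comp_injective fun i j _ => Subsingleton.elim i j) ?_ ?_ ?_
    · intro i; fin_cases i; rfl
    · intro i; fin_cases i; rfl
    · rintro (i | i) hi
      · cases i <;> first | rfl | exact absurd rfl (hi 0)
      · rfl
  by_cases h0 : bitVal s' = 0
  swap
  · refine ⟨fun h => absurd h.2.1 (by omega), fun _ => ?_⟩
    obtain ⟨s'', -, -, hd⟩ := Prog.exec_decrement s' h0
    exact ⟨_, _, exec_andThen h1 (exec_andThen h2 (h3.bind (exec_andThen h4
      (exec_andThen h5 (exec_andThen_false (h6 hd))))))⟩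
  obtain ⟨s'', hd⟩ := Prog.exec_decrement_zero s' h0
  obtain ⟨τ', he⟩ := Prog.exec_equal (elemBits p.natDegree (hashPoly p (elemPoly z) y)) h
  have h7 := he.map_extend (inl_comp_injective (W := T.Work ⊕ M.Work) equal_regs_injective)
      (τ := verifierTapes τ w (.ofList s'') (.ofList n.bits) (.ofList z) (.ofList h)
          (.ofList (fieldRep p)) (.ofList (elemBits p.natDegree (hashPoly p (elemPoly z) y)))
          (.ofList []))
      (by intro i; fin_cases i <;> rfl)
  have hall : (program T M).Exec _ _ _ _ := exec_andThen h1 (exec_andThen h2 (h3.bind (exec_andThen h4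
      (exec_andThen h5 (exec_andThen (h6 hd) h7)))))
  have hyn : y.length = n := by omega
  constructor
  · rintro ⟨-, -, hhash⟩
    rw [decide_eq_true hhash.symm] at hall
    refine ⟨_, Prog.Exec.mono hall ?_⟩
    rw [hzk, hsk, hs', hyn, length_elemBits]
    omega
  · intro hnot
    have : ¬ elemBits p.natDegree (hashPoly p (elemPoly z) y) = h := fun h' =>
      hnot ⟨hzk, hyn, h'.symm⟩
    rw [decide_eq_false this] at hall
    exact ⟨_, _, hall⟩

/-- The verifier decides `IsHash q` and, if the answer is positive, takes time proportional to the
allowed number of field operations. -/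
theorem exec_program {T : Transducer 1} {M : Transducer 3} {q : ℕ → (ZMod 2)[X]}
    {b b' : ℕ → ℕ} (hq : ∀ n, Irreducible (q n))
    (hT : ∀ n, 1 ≤ n → T.ComputesIn ![n.bits] (fieldRep (q n)) (b' n))
    (hM : ∀ n, ∀ g g' : (ZMod 2)[X], g.degree < (q n).degree → g'.degree < (q n).degree →
      M.ComputesIn ![fieldRep (q n), elemBits (q n).natDegree g, elemBits (q n).natDegree g']
        (elemBits (q n).natDegree ((g * g') %ₘ q n)) (b n)) (a y : List Bool) :
    (IsHash q a y → ∃ τ', (program T M).Exec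
        (verifierTapes (.ofList a) (.ofList y)
          (.ofList []) (.ofList []) (.ofList []) (.ofList []) (.ofList []) (.ofList [])
          (.ofList [])) true τ'
        (b' y.length + y.length * (b y.length + 4 * (q y.length).natDegree + 7)
          + 11 * (q y.length).natDegree + 13)) ∧
    (¬ IsHash q a y → ∃ B τ', (program T M).Exec
        (verifierTapes (.ofList a) (.ofList y)
          (.ofList []) (.ofList []) (.ofList []) (.ofList []) (.ofList []) (.ofList [])
          (.ofList [])) false τ' B) := by
  constructor
  · rintro ⟨hn, hlen, z, hz, rfl⟩
    have hlen' : (y.length.bits ++ List.replicate ((q y.length).natDegree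
        - y.length.bits.length) false).length = (q y.length).natDegree := by
      rw [List.length_append, List.length_replicate]; omega
    exact (exec_program_interleave hn (hq _) (hT _ hn) (hM _) (hz.trans hlen'.symm)
      ((length_elemBits _ _).trans hlen'.symm) y).1 ⟨hz, rfl, rfl⟩
  · intro hnot
    by_cases hex : ∃ s z h : List Bool, z.length = s.length ∧ h.length = s.length ∧
      a = interleave s z h
    swap
    · obtain ⟨B, τ', hr⟩ := Prog.exec_deinterleave_false hex
      have h1 := hr.map_extend (inl_comp_injective (W := T.Work ⊕ M.Work) deinterleave_regs_injective)
        (τ := verifierTapes (.ofList a) (.ofList y)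
          (.ofList []) (.ofList []) (.ofList []) (.ofList []) (.ofList []) (.ofList [])
          (.ofList [])) (by intro i; fin_cases i <;> rfl)
      exact ⟨_, _, exec_andThen_false h1⟩
    obtain ⟨s, z, h, hz, hh, rfl⟩ := hex
    obtain ⟨n, j, rfl⟩ := exists_eq_bits_append s
    rcases Nat.eq_zero_or_pos n with rfl | hn
    · obtain ⟨τ, hdei⟩ := Prog.exec_deinterleave hz hh
      have h1 := hdei.map_extend (inl_comp_injective (W := T.Work ⊕ M.Work) deinterleave_regs_injective)
        (τ := verifierTapes (.ofList (interleave (Nat.bits 0 ++ List.replicate j false) z h))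
          (.ofList y) (.ofList []) (.ofList []) (.ofList []) (.ofList []) (.ofList []) (.ofList [])
          (.ofList [])) (by intro i; fin_cases i <;> rfl)
      have h2 := (Prog.exec_strip_zero j).map_extend
        (inl_comp_injective (W := T.Work ⊕ M.Work) strip_regs_injective)
        (τ := Function.extend (fun i => Sum.inl ((![.input, .count, .key, .hash] : Fin 4 → Reg) i))
          ![τ, .ofList (Nat.bits 0 ++ List.replicate j false), .ofList z, .ofList h]
          (verifierTapes (.ofList (interleave (Nat.bits 0 ++ List.replicate j false) z h))
          (.ofList y) (.ofList []) (.ofList []) (.ofList []) (.ofList []) (.ofList []) (.ofList [])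
          (.ofList []))) (by
            intro i
            fin_cases i
            · exact ((inl_comp_injective deinterleave_regs_injective).extend_apply _ _ 1).trans (by simp)
            · refine (Function.extend_apply' _ _ _ ?_).trans rfl
              rintro ⟨i, hi⟩
              fin_cases i <;> simp at hi)
      exact ⟨_, _, exec_andThen h1 (exec_andThen_false h2)⟩
    · refine (exec_program_interleave hn (hq _) (hT _ hn) (hM _) hz hh y).2 ?_
      rintro ⟨h1, rfl, rfl⟩
      refine hnot ⟨hn, ?_, z, h1, ?_⟩
      · rw [← h1, hz, List.length_append]; omega
      · have hj : (q y.length).natDegree - y.length.bits.length = j := by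
          rw [← h1, hz, List.length_append, List.length_replicate]; omega
        rw [hashCode, hj]

end Verifier

/-! ### Guessing a word and verifying it -/

/-- A nondeterministic transition rule `δ` leads from state `q` and tapes `τ` to a state in `F` in at
most `T` steps. -/
inductive AccFrom {Q ι : Type} (δ : Q → (ι → Option Bool) → Set (Act Q ι)) (F : Set Q) :
    ℕ → Q → (ι → Tape) → Prop
  | here {T q τ} (h : q ∈ F) : AccFrom δ F T q τ
  | step {T q τ τ'} {a : Act Q ι} (ha : a ∈ δ q fun i => (τ i).read)
      (hτ : (fun i => (τ i).step (a.2 i)) = τ') (h : AccFrom δ F T a.1 τ') :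
      AccFrom δ F (T + 1) q τ

theorem AccFrom.of_notMem {Q ι : Type} {δ : Q → (ι → Option Bool) → Set (Act Q ι)} {F : Set Q}
    {T : ℕ} {q : Q} {τ : ι → Tape} (h : AccFrom δ F T q τ) (hq : q ∉ F) :
    ∃ T', T = T' + 1 ∧ ∃ a ∈ δ q fun i => (τ i).read,
      AccFrom δ F T' a.1 fun i => (τ i).step (a.2 i) := by
  cases h with
  | here h => exact absurd h hq
  | step ha hτ h =>
    subst hτ
    exact ⟨_, rfl, _, ha, h⟩

theorem AccFrom.mono {Q ι : Type} {δ : Q → (ι → Option Bool) → Set (Act Q ι)} {F : Set Q}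
    {T T' : ℕ} {q : Q} {τ : ι → Tape} (h : AccFrom δ F T q τ) (hT : T ≤ T') :
    AccFrom δ F T' q τ := by
  induction h generalizing T' with
  | here h => exact .here h
  | step ha hτ _ ih =>
    obtain ⟨d, rfl⟩ := Nat.exists_eq_add_of_le' hT
    exact .step ha hτ (ih (Nat.le_add_left _ _))

theorem NTM.acceptsIn_iff (M : NTM) (x : List Bool) (T : ℕ) :
    M.AcceptsIn x T ↔ AccFrom M.next M.accept T M.start
      fun i => i.elim (Tape.ofList x) fun _ => Tape.ofList [] := by
  have hτ : (fun i : Option M.Work => Tape.ofList (i.elim x fun _ => []))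
      = fun i => i.elim (Tape.ofList x) fun _ => Tape.ofList [] := by
    funext i; cases i <;> rfl
  rw [NTM.AcceptsIn, Cfg.ofStrings_eq_ofTapes, hτ]
  generalize M.start = q
  generalize (fun i : Option M.Work => i.elim (Tape.ofList x) fun _ => Tape.ofList []) = τ
  constructor
  · rintro ⟨t, ht, c, hr, hc⟩
    induction t generalizing q τ T with
    | zero =>
      cases hr
      exact .here hc
    | succ t ih =>
      obtain ⟨a, ha, hr⟩ := hr
      obtain ⟨T, rfl⟩ : ∃ T', T = T' + 1 := ⟨T - 1, by omega⟩
      exact .step ha rfl (ih T a.1 _ (by omega) hr)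
  · intro h
    induction h with
    | here h => exact ⟨0, Nat.zero_le _, _, rfl, h⟩
    | step ha hτ _ ih =>
      obtain ⟨t, ht, c, hr, hc⟩ := ih
      subst hτ
      exact ⟨t + 1, by omega, c, ⟨_, ha, hr⟩, hc⟩

namespace GuessVerify

variable {ι W : Type} (iA iY : ι)

open Classical in
/-- The tapes of the verifier: its tape `iA` is the input tape. -/
noncomputable def verifyTape (i : ι) : Option (ι ⊕ Option W) :=
  if i = iA then none else some (Sum.inl i)

/-- The tapes of the machine that is run on the guessed word. -/
def runTape (i : Option W) : Option (ι ⊕ Option W) := some (Sum.inr i)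

/-- The two tapes on which a word is guessed, one for the verifier and one for the final run. -/
def IsGuessTape (i : Option (ι ⊕ Option W)) : Prop :=
  i = some (Sum.inl iY) ∨ i = some (Sum.inr none)

/-- The two phases before the verification: guessing a word, and moving the heads back. -/
inductive Phase where
  | guess
  | rewind

variable (D : Prog ι Bool) (M : NTM)

open Classical in
/-- The transition rule of the machine that guesses a word, runs the verifier `D` on the input and
this word and, if the answer is positive, runs `M` on the word. -/
noncomputable def next : Phase ⊕ D.State ⊕ M.State →
    (Option (ι ⊕ Option M.Work) → Option Bool) →
    Set (Act (Phase ⊕ D.State ⊕ M.State) (Option (ι ⊕ Option M.Work)))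
  | Sum.inl .guess, s =>
    {a | (∃ b : Bool, a = (Sum.inl .guess, fun i =>
        if IsGuessTape iY i then (some b, .right) else (s i, .stay))) ∨
      a = (Sum.inl .rewind, fun i => (s i, if IsGuessTape iY i then .left else .stay))}
  | Sum.inl .rewind, s =>
    {(if s (some (Sum.inr none)) = none then Sum.inr (Sum.inl D.start) else Sum.inl .rewind,
      fun i => (s i, if IsGuessTape iY i then
        (if s (some (Sum.inr none)) = none then .right else .left) else .stay))}
  | Sum.inr (Sum.inl q), s =>
    {a | a.2 = Function.extend (verifyTape iA) (D.next q (s ∘ verifyTape iA)).2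
          (fun i => (s i, .stay)) ∧
      match (D.next q (s ∘ verifyTape iA)).1 with
      | Sum.inl q' => a.1 = Sum.inr (Sum.inl q')
      | Sum.inr e => e = true ∧ a.1 = Sum.inr (Sum.inr M.start)}
  | Sum.inr (Sum.inr q), s =>
    {a | ∃ a' ∈ M.next q (s ∘ runTape), a = (Sum.inr (Sum.inr a'.1),
      Function.extend runTape a'.2 fun i => (s i, .stay))}

/-- The accepting states. -/
def accept : Set (Phase ⊕ D.State ⊕ M.State) := {q | ∃ q' ∈ M.accept, q = Sum.inr (Sum.inr q')}

open Classical in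
/-- The tapes with input `a` when the guessed word is on the tapes `w`. -/
noncomputable def guessTapes (a : List Bool) (w : Tape) (i : Option (ι ⊕ Option W)) : Tape :=
  if i = none then Tape.ofList a else if IsGuessTape iY i then w else Tape.ofList []

open Classical in
/-- The tapes of the verifier with input `a` and guess `y`. -/
noncomputable def inputTapes (a y : List Bool) (i : ι) : Tape :=
  if i = iA then Tape.ofList a else if i = iY then Tape.ofList y else Tape.ofList []

variable {D iA iY M}

theorem verifyTape_injective : (verifyTape (W := W) iA).Injective := by
  intro i j h
  simp only [verifyTape] at h
  split_ifs at h with h1 h2 h2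
  · exact h1.trans h2.symm
  · simpa using h

theorem runTape_injective : (runTape (ι := ι) (W := W)).Injective := by
  intro i j h
  simpa [runTape] using h

theorem not_isGuessTape_none : ¬ IsGuessTape (W := W) iY none := by
  rintro (h | h) <;> simp at h

theorem guessTapes_of_isGuessTape {a : List Bool} {w : Tape} {i : Option (ι ⊕ Option W)}
    (hi : IsGuessTape iY i) : guessTapes iY a w i = w := by
  have hn : i ≠ none := by rintro rfl; exact not_isGuessTape_none hi
  simp [guessTapes, hi, hn]

theorem guessTapes_of_not {a : List Bool} {w w' : Tape} {i : Option (ι ⊕ Option W)}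
    (hi : ¬ IsGuessTape iY i) : guessTapes iY a w i = guessTapes iY a w' i := by
  simp [guessTapes, hi]

open Classical in
theorem step_guessTapes_read {a : List Bool} {w w' : Tape} {m : Move}
    (h : w.step (w.read, m) = w') :
    (fun i : Option (ι ⊕ Option W) => (guessTapes iY a w i).step
      ((guessTapes iY a w i).read, if IsGuessTape iY i then m else .stay))
      = guessTapes iY a w' := by
  funext i
  by_cases hi : IsGuessTape iY i
  · rw [if_pos hi, guessTapes_of_isGuessTape hi, guessTapes_of_isGuessTape hi, h]
  · rw [if_neg hi, Tape.step_read_stay]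
    exact guessTapes_of_not hi

open Classical in
theorem step_guessTapes_write {a : List Bool} {w w' : Tape} {b : Bool}
    (h : w.step (some b, .right) = w') :
    (fun i : Option (ι ⊕ Option W) => (guessTapes iY a w i).step
      (if IsGuessTape iY i then (some b, .right) else ((guessTapes iY a w i).read, .stay)))
      = guessTapes iY a w' := by
  funext i
  by_cases hi : IsGuessTape iY i
  · rw [if_pos hi, guessTapes_of_isGuessTape hi, guessTapes_of_isGuessTape hi, h]
  · rw [if_neg hi, Tape.step_read_stay]
    exact guessTapes_of_not hi

theorem guessTapes_comp_verifyTape (hne : iA ≠ iY) (a y : List Bool) :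
    guessTapes iY a (.ofList y) ∘ verifyTape (W := W) iA = inputTapes iA iY a y := by
  funext i
  by_cases h1 : i = iA
  · simp [guessTapes, verifyTape, inputTapes, h1]
  · by_cases h2 : i = iY
    · subst h2
      simp [guessTapes, verifyTape, inputTapes, h1, IsGuessTape]
    · simp [guessTapes, verifyTape, inputTapes, h1, h2, IsGuessTape]

theorem guessTapes_comp_runTape (a y : List Bool) :
    guessTapes iY a (.ofList y) ∘ runTape (W := W)
      = fun i => i.elim (Tape.ofList y) fun _ => Tape.ofList [] := by
  funext i
  cases i <;> simp [guessTapes, runTape, IsGuessTape]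

theorem run_accFrom_iff (T : ℕ) (q : M.State) (τ : Option (ι ⊕ Option M.Work) → Tape) :
    AccFrom (next iA iY D M) (accept D M) T (Sum.inr (Sum.inr q)) τ ↔
      AccFrom M.next M.accept T q (τ ∘ runTape) := by
  have hmem : ∀ q : M.State, Sum.inr (Sum.inr q) ∈ accept D M ↔ q ∈ M.accept := by
    intro q
    constructor
    · rintro ⟨q', hq', h⟩
      cases h
      exact hq'
    · exact fun h => ⟨q, h, rfl⟩
  have hstep : ∀ (τ : Option (ι ⊕ Option M.Work) → Tape) (w : Option M.Work → Option Bool × Move),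
      (fun i => (τ i).step (Function.extend runTape w (fun i => ((τ i).read, .stay)) i)) ∘ runTape
        = fun x => ((τ ∘ runTape) x).step (w x) := by
    intro τ w
    funext x
    simp [runTape_injective.extend_apply]
  constructor
  · intro h
    generalize hq : (Sum.inr (Sum.inr q) : Phase ⊕ D.State ⊕ M.State) = q' at h
    induction h generalizing q with
    | here h =>
      subst hq
      exact .here ((hmem q).1 h)
    | step ha hτ h ih =>
      subst hq hτ
      obtain ⟨a', ha', rfl⟩ := ha
      have := ih a'.1 rfl
      rw [hstep] at this
      exact .step ha' rfl this
  · intro h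
    generalize hσ : τ ∘ runTape = σ at h
    induction h generalizing τ with
    | here h => exact .here ((hmem _).2 h)
    | step ha hτ h ih =>
      subst hσ
      exact .step (a := (Sum.inr (Sum.inr _), Function.extend runTape _ _)) ⟨_, ha, rfl⟩ rfl
        (ih _ ((hstep _ _).trans hτ))

theorem inl_notMem_accept (q : Phase) : Sum.inl q ∉ accept D M := by
  rintro ⟨q', _, h⟩
  cases h

theorem verify_notMem_accept (q : D.State) : Sum.inr (Sum.inl q) ∉ accept D M := by
  rintro ⟨q', _, h⟩
  cases h

theorem extend_verifyTape_comp (τ : Option (ι ⊕ Option W) → Tape)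
    (w : ι → Option Bool × Move) :
    (fun i => (τ i).step (Function.extend (verifyTape iA) w (fun i => ((τ i).read, .stay)) i))
      ∘ verifyTape iA = fun x => ((τ ∘ verifyTape iA) x).step (w x) := by
  funext x
  simp [verifyTape_injective.extend_apply]

theorem extend_verifyTape_comp_runTape (τ : Option (ι ⊕ Option W) → Tape)
    (w : ι → Option Bool × Move) :
    (fun i => (τ i).step (Function.extend (verifyTape iA) w (fun i => ((τ i).read, .stay)) i))
      ∘ runTape = τ ∘ runTape := by
  funext x
  have : ¬ ∃ i, verifyTape iA i = (runTape x : Option (ι ⊕ Option W)) := by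
    rintro ⟨i, hi⟩
    simp only [verifyTape, runTape] at hi
    split_ifs at hi
    simp at hi
  simp only [Function.comp]
  rw [Function.extend_apply' _ _ _ this, Tape.step_read_stay]

theorem verify_accFrom {q : D.State} {τ₀ τ₀' : ι → Tape} {t T : ℕ} {e : Bool}
    (h : D.Run q τ₀ t e τ₀') (he : e = true) {τ : Option (ι ⊕ Option M.Work) → Tape}
    (hτ : τ ∘ verifyTape iA = τ₀) (hM : AccFrom M.next M.accept T M.start (τ ∘ runTape)) :
    AccFrom (next iA iY D M) (accept D M) (T + t) (Sum.inr (Sum.inl q)) τ := by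
  induction h generalizing τ with
  | @exit q τ₀ e w τ' h hs =>
    subst hτ
    change (D.next q ((fun i => (τ i).read) ∘ verifyTape iA)) = _ at h
    refine .step (a := (Sum.inr (Sum.inr M.start), Function.extend (verifyTape iA) w
      fun i => ((τ i).read, .stay))) ?_ rfl ?_
    · change _ ∧ _
      rw [h]
      exact ⟨rfl, he, rfl⟩
    · refine (run_accFrom_iff _ _ _).2 ?_
      rw [extend_verifyTape_comp_runTape]
      exact hM
  | @step q τ₀ q' w τ₁ t e τ' h hs _ ih =>
    subst hτ
    change (D.next q ((fun i => (τ i).read) ∘ verifyTape iA)) = _ at h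
    refine .step (a := (Sum.inr (Sum.inl q'), Function.extend (verifyTape iA) w
      fun i => ((τ i).read, .stay))) ?_ rfl ?_
    · change _ ∧ _
      rw [h]
      exact ⟨rfl, rfl⟩
    · refine ih he ?_ ?_
      · rw [← hs, ← extend_verifyTape_comp τ w]
      · rw [extend_verifyTape_comp_runTape]
        exact hM

theorem of_verify_accFrom {q : D.State} {τ₀ τ₀' : ι → Tape} {t T : ℕ} {e : Bool}
    (h : D.Run q τ₀ t e τ₀') {τ : Option (ι ⊕ Option M.Work) → Tape}
    (hτ : τ ∘ verifyTape iA = τ₀)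
    (hN : AccFrom (next iA iY D M) (accept D M) T (Sum.inr (Sum.inl q)) τ) :
    e = true ∧ ∃ T', AccFrom M.next M.accept T' M.start (τ ∘ runTape) := by
  induction h generalizing τ T with
  | @exit q τ₀ e w τ' h hs =>
    subst hτ
    change (D.next q ((fun i => (τ i).read) ∘ verifyTape iA)) = _ at h
    obtain ⟨T', -, a, ha, hacc⟩ := hN.of_notMem (verify_notMem_accept q)
    change _ ∧ _ at ha
    rw [h] at ha
    obtain ⟨ha2, he, ha1⟩ := ha
    rw [ha2, ha1] at hacc
    refine ⟨he, T', ?_⟩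
    have := (run_accFrom_iff _ _ _).1 hacc
    rwa [extend_verifyTape_comp_runTape] at this
  | @step q τ₀ q' w τ₁ t e τ' h hs _ ih =>
    subst hτ
    change (D.next q ((fun i => (τ i).read) ∘ verifyTape iA)) = _ at h
    obtain ⟨T', -, a, ha, hacc⟩ := hN.of_notMem (verify_notMem_accept q)
    change _ ∧ _ at ha
    rw [h] at ha
    obtain ⟨ha2, ha1⟩ := ha
    rw [ha2] at hacc
    rw [show a.1 = _ from ha1] at hacc
    have := ih (by rw [← hs, ← extend_verifyTape_comp τ w]) hacc
    rwa [extend_verifyTape_comp_runTape] at this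

theorem rewind_accFrom_iff {a l r : List Bool} {T : ℕ} :
    AccFrom (next iA iY D M) (accept D M) (T + l.length + 1) (Sum.inl .rewind)
      (guessTapes iY a (.back l r)) ↔
    AccFrom (next iA iY D M) (accept D M) T (Sum.inr (Sum.inl D.start))
      (guessTapes iY a (.ofList (l.reverse ++ r))) := by
  have hread : ∀ l r : List Bool, (guessTapes (W := M.Work) iY a (.back l r)
      (some (Sum.inr none))).read = l.head? := fun l r => by
    rw [guessTapes_of_isGuessTape (Or.inr rfl), Tape.read_back]
  induction l generalizing r with
  | nil =>
    have hs := step_guessTapes_read (W := M.Work) (iY := iY) (a := a) (w := .back [] r)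
      (w' := .ofList r) (m := .right) (by simp)
    have h0 := hread [] r
    constructor
    · intro h
      obtain ⟨T', hT, b, hb, hacc⟩ := h.of_notMem (inl_notMem_accept _)
      obtain rfl : T = T' := by simpa using hT
      obtain rfl := Set.mem_singleton_iff.1 hb
      simp only [h0, List.head?_nil, if_true] at hacc
      rwa [hs] at hacc
    · intro h
      refine .step (T := T) (Set.mem_singleton _) rfl ?_
      simp only [h0, List.head?_nil, if_true]
      rwa [hs]
  | cons b l ih =>
    have hs := step_guessTapes_read (W := M.Work) (iY := iY) (a := a) (w := .back (b :: l) r)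
      (w' := .back l (b :: r)) (m := .left) (by simp)
    have h0 := hread (b :: l) r
    rw [List.reverse_cons, List.append_assoc, List.singleton_append, List.length_cons,
      ← add_assoc]
    refine Iff.trans ?_ (ih (r := b :: r))
    constructor
    · intro h
      obtain ⟨T', hT, c, hc, hacc⟩ := h.of_notMem (inl_notMem_accept _)
      obtain rfl : T + l.length + 1 = T' := by simpa using hT
      obtain rfl := Set.mem_singleton_iff.1 hc
      simp only [h0, List.head?_cons, reduceCtorEq, if_false] at hacc
      rwa [hs] at hacc
    · intro h
      refine .step (Set.mem_singleton _) rfl ?_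
      simp only [h0, List.head?_cons, reduceCtorEq, if_false]
      rwa [hs]

theorem guess_accFrom {a l : List Bool} {T : ℕ} (y : List Bool)
    (h : AccFrom (next iA iY D M) (accept D M) T (Sum.inl .rewind)
      (guessTapes iY a (.back (y.reverse ++ l) []))) :
    AccFrom (next iA iY D M) (accept D M) (T + y.length + 1) (Sum.inl .guess)
      (guessTapes iY a (.zip l [])) := by
  induction y generalizing l with
  | nil => exact .step (Or.inr rfl) (step_guessTapes_read (by simp)) h
  | cons b y ih =>
    exact .step (Or.inl ⟨b, rfl⟩) (step_guessTapes_write (by simp))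
      (ih (l := b :: l) (by simpa using h))

theorem of_guess_accFrom {a l : List Bool} {T : ℕ}
    (h : AccFrom (next iA iY D M) (accept D M) T (Sum.inl .guess)
      (guessTapes iY a (.zip l []))) :
    ∃ l' T', AccFrom (next iA iY D M) (accept D M) T' (Sum.inl .rewind)
      (guessTapes iY a (.back l' [])) := by
  induction T generalizing l with
  | zero =>
    obtain ⟨T', hT, -⟩ := h.of_notMem (inl_notMem_accept _)
    omega
  | succ T ih =>
    obtain ⟨T', hT, b, hb, hacc⟩ := h.of_notMem (inl_notMem_accept _)
    obtain rfl : T = T' := by simpa using hT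
    rcases hb with ⟨b, rfl⟩ | rfl
    · rw [step_guessTapes_write (w' := .zip (b :: l) []) (by simp)] at hacc
      exact ih hacc
    · rw [step_guessTapes_read (w' := .back l []) (by simp)] at hacc
      exact ⟨l, T, hacc⟩

theorem finite_phase : Finite Phase :=
  Finite.of_surjective (fun b : Bool => if b then Phase.guess else Phase.rewind) fun p => by
    cases p
    exacts [⟨true, rfl⟩, ⟨false, rfl⟩]

end GuessVerify

open GuessVerify in
/-- A nondeterministic machine can guess a word, verify it with the deterministic program `D`, and
run the nondeterministic machine `M` on it. -/
theorem exists_guess_verify {ι : Type} [Finite ι] (D : Prog ι Bool) {iA iY : ι} (hne : iA ≠ iY)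
    (hD : ∀ a y, ∃ e B τ', D.Exec (inputTapes iA iY a y) e τ' B)
    (M : NTM) : ∃ N : NTM, ∀ a : List Bool,
      (∀ y t T τ', D.Exec (inputTapes iA iY a y) true τ' t → M.AcceptsIn y T →
        N.AcceptsIn a (T + t + 2 * y.length + 2)) ∧
      (∀ T, N.AcceptsIn a T → ∃ y T', M.AcceptsIn y T' ∧
        ∀ e B τ', D.Exec (inputTapes iA iY a y) e τ' B → e = true) := by
  let N : NTM :=
    { Work := ι ⊕ Option M.Work
      State := Phase ⊕ D.State ⊕ M.State
      finWork := have := M.finWork; inferInstance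
      finState := have := M.finState; have := D.finState; have := finite_phase; inferInstance
      start := Sum.inl .guess
      accept := accept D M
      next := next iA iY D M }
  have hN : ∀ a T, N.AcceptsIn a T ↔ AccFrom (next iA iY D M) (accept D M) T (Sum.inl .guess)
      (guessTapes iY a (.ofList [])) := by
    intro a T
    have h : (guessTapes iY a (.ofList []) : Option (ι ⊕ Option M.Work) → Tape)
        = fun i => i.elim (Tape.ofList a) fun _ => Tape.ofList [] := by
      funext i
      cases i <;> simp [guessTapes]
    rw [h]
    exact N.acceptsIn_iff a T
  refine ⟨N, fun a => ⟨fun y t T τ' hD hM => ?_, fun T hacc => ?_⟩⟩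
  · rw [NTM.acceptsIn_iff, ← guessTapes_comp_runTape (ι := ι) (iY := iY) a y] at hM
    obtain ⟨t', ht, hr⟩ := hD
    have h1 := verify_accFrom (iY := iY) hr rfl (guessTapes_comp_verifyTape hne a y) hM
    have h2 := (rewind_accFrom_iff (l := y.reverse) (r := [])).2 (by simpa using h1)
    have h3 := guess_accFrom (l := []) y (by simpa using h2)
    exact (hN _ _).2 (h3.mono (by omega))
  · rw [hN] at hacc
    obtain ⟨l, T₁, h⟩ := of_guess_accFrom hacc
    have h1 := rewind_accFrom_iff.1 (h.mono (show T₁ ≤ T₁ + l.length + 1 by omega))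
    rw [List.append_nil] at h1
    have hcomp := guessTapes_comp_verifyTape (W := M.Work) hne a l.reverse
    obtain ⟨e, B, τ', t, -, hr⟩ := hD a l.reverse
    obtain ⟨he, T', hM⟩ := of_verify_accFrom hr hcomp h1
    refine ⟨l.reverse, T', ?_, ?_⟩
    · rwa [NTM.acceptsIn_iff, ← guessTapes_comp_runTape (ι := ι) (iY := iY) a l.reverse]
    · rintro e' B τ'' ⟨t', -, hr'⟩
      rw [← he, (hr.unique hr').1]

/-! ### The language of hash values -/

/-- The strings that encode a length `n`, a key, and the hash value of some word of `L` of
length `n` for this key. -/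
def hashLanguage (q : ℕ → (ZMod 2)[X]) (L : Language Bool) : Language Bool :=
  {a | ∃ y ∈ L, IsHash q a y}

theorem le_logSize (f : ℕ → ℕ) {m n : ℕ} (h : 2 ^ m ≤ n) : m ≤ logSize f n :=
  (Nat.le_log_of_pow_le one_lt_two h).trans (Nat.le_add_right _ _)

theorem eventually_le_logSize (f : ℕ → ℕ) (m : ℕ) : ∀ᶠ n in atTop, m ≤ logSize f n :=
  (eventually_ge_atTop (2 ^ m)).mono fun _ h => le_logSize f h

theorem length_bits_le (n : ℕ) : n.bits.length ≤ Nat.log 2 n + 1 := by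
  have : n.bits.length = n.size := Nat.size_eq_bits_len n
  rw [this, Nat.size_le]
  exact Nat.lt_pow_succ_log_self one_lt_two n

theorem length_hashCode {p : (ZMod 2)[X]} {n : ℕ} {z : List Bool} {g : (ZMod 2)[X]}
    (hn : n.bits.length ≤ p.natDegree) (hz : z.length = p.natDegree) :
    (hashCode p n z g).length = 3 * p.natDegree := by
  have h : (n.bits ++ List.replicate (p.natDegree - n.bits.length) false).length
      = p.natDegree := by
    rw [List.length_append, List.length_replicate]; omega
  rw [hashCode, length_interleave (hz.trans h.symm) ((length_elemBits _ _).trans h.symm), h]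

theorem verifierTapes_eq_inputTapes {W : Type} (a y : List Bool) :
    (verifierTapes (.ofList a) (.ofList y) (.ofList []) (.ofList []) (.ofList []) (.ofList [])
      (.ofList []) (.ofList []) (.ofList []) : Reg ⊕ W → Tape)
      = GuessVerify.inputTapes (Sum.inl .input) (Sum.inl .word) a y := by
  funext i
  rcases i with i | i
  · cases i <;> simp [verifierTapes, GuessVerify.inputTapes]
  · simp [verifierTapes, GuessVerify.inputTapes]

/-- A bound that holds for large arguments holds for all arguments after adding a constant. -/
theorem exists_forall_le_mul_add {W t : ℕ → ℕ} {C : ℕ} (h : ∀ᶠ n in atTop, W n ≤ C * t n + C) :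
    ∃ c, ∀ n, W n ≤ c * t n + c := by
  obtain ⟨N, hN⟩ := eventually_atTop.1 h
  refine ⟨C + ∑ i ∈ Finset.range N, W i, fun n => ?_⟩
  rcases lt_or_ge n N with hn | hn
  · have := Finset.single_le_sum (f := W) (fun i _ => Nat.zero_le _) (Finset.mem_range.2 hn)
    omega
  · have := hN n hn
    have h2 := Nat.mul_le_mul_right (t n) (Nat.le_add_right C (∑ i ∈ Finset.range N, W i))
    omega

/-- The arithmetic of the running time: `v` is the size parameter, `k = 2 v + 2` the degree of the
field, and the operations take time `c₂ * w + c₂` where `w ≤ w'`. -/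
theorem verification_time_le {v n t U w w' cL c' c₂ : ℕ} (hv : 1 ≤ v) (hw : w ≤ w') (hw1 : 1 ≤ w)
    (hk : 2 * v + 2 ≤ c₂ * w + c₂) :
    (cL * t + cL) + (c' * U + c' + n * ((c₂ * w + c₂) + 4 * (2 * v + 2) + 7)
      + 11 * (2 * v + 2) + 13) + 2 * n + 2
    ≤ (cL + c' + 10 * c₂ + 20) * (10 * v + t + U + n * w') + (cL + c' + 10 * c₂ + 20) := by
  have h1 : (c₂ * w + c₂) + 4 * (2 * v + 2) + 7 + 2 ≤ (10 * c₂ + 9) * w' := by nlinarith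
  have h2 := Nat.mul_le_mul_left n h1
  have h3 : n * ((10 * c₂ + 9) * w') = (10 * c₂ + 9) * (n * w') := by ring
  have h4 : n * ((c₂ * w + c₂) + 4 * (2 * v + 2) + 7 + 2)
      = n * ((c₂ * w + c₂) + 4 * (2 * v + 2) + 7) + 2 * n := by ring
  have h5 : (cL + c' + 10 * c₂ + 20) * (10 * v + t + U + n * w')
      = cL * t + c' * U + (10 * c₂ + 9) * (n * w') + 20 * (10 * v)
        + (cL + c' + 10 * c₂) * (10 * v) + (c' + 10 * c₂ + 20) * t + (cL + 10 * c₂ + 20) * U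
        + (cL + c' + 11) * (n * w') := by ring
  have h6 := Nat.zero_le ((cL + c' + 10 * c₂) * (10 * v))
  have h7 := Nat.zero_le ((c' + 10 * c₂ + 20) * t)
  have h8 := Nat.zero_le ((cL + 10 * c₂ + 20) * U)
  have h9 := Nat.zero_le ((cL + c' + 11) * (n * w'))
  omega

/-- Hash values of the words of `L` can be verified nondeterministically in the time that is allowed
by the hypothesis on `t₂`. A code has length `3 k ≥ v(n)`, so that time `t₂ (v(n))` is available. -/
theorem hashLanguage_mem_NTIME {f t₁ t₂ u₁ u₂ : ℕ → ℕ} (ht₂ : Monotone t₂) (hu₂ : Monotone u₂)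
    (htime : ∀ᶠ n : ℕ in atTop,
      10 * logSize f n + t₁ n + u₁ (10 * logSize f n) + n * u₂ (10 * logSize f n)
        ≤ t₂ (logSize f n))
    (hops : FieldOperationsIn u₂) {L : Language Bool} (hL : L ∈ NTIME t₁)
    {q : ℕ → (ZMod 2)[X]} (hq : ∀ n, Irreducible (q n))
    (hdeg : ∀ n, (q n).natDegree = 2 * logSize f n + 2) {T : Transducer 1} {c' : ℕ}
    (hT : ∀ n, 1 ≤ n → T.ComputesIn ![n.bits] (fieldRep (q n))
      (c' * u₁ (10 * logSize f n) + c')) :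
    hashLanguage q L ∈ NTIME t₂ := by
  obtain ⟨_, M, c₂, hM⟩ := hops
  obtain ⟨ML, cL, hML⟩ := hL
  have hmul : ∀ n, ∀ g g' : (ZMod 2)[X], g.degree < (q n).degree → g'.degree < (q n).degree →
      M.ComputesIn ![fieldRep (q n), elemBits (q n).natDegree g, elemBits (q n).natDegree g']
        (elemBits (q n).natDegree ((g * g') %ₘ q n)) (c₂ * u₂ (2 * logSize f n + 2) + c₂) := by
    intro n g g' hg hg'
    have := (hM (q n) (hq n) g g' hg hg').2
    rwa [hdeg n] at this ⊢
  -- A machine needs time `k` for writing an element of `GF(2^k)`.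
  have hk : ∀ n, 2 * logSize f n + 2 ≤ c₂ * u₂ (2 * logSize f n + 2) + c₂ := by
    intro n
    have h0 : (0 : (ZMod 2)[X]).degree < (q n).degree := by
      rw [degree_zero, bot_lt_iff_ne_bot]
      exact fun h => (hq n).ne_zero (degree_eq_bot.1 h)
    have := (hmul n 0 0 h0 h0).length_le
    rwa [length_elemBits, hdeg n] at this
  have hver := Verifier.exec_program (T := T) (M := M) (b := fun n =>
    c₂ * u₂ (2 * logSize f n + 2) + c₂) (b' := fun n => c' * u₁ (10 * logSize f n) + c') hq hT hmul
  simp only [verifierTapes_eq_inputTapes, hdeg] at hver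
  have := T.finWork
  have := M.finWork
  have := finite_reg
  obtain ⟨N, hN⟩ := exists_guess_verify (Verifier.program T M) (iA := Sum.inl .input)
    (iY := Sum.inl .word) (by simp) (fun a y => by
      by_cases h : IsHash q a y
      · obtain ⟨τ', hr⟩ := (hver a y).1 h
        exact ⟨_, _, _, hr⟩
      · obtain ⟨B, τ', hr⟩ := (hver a y).2 h
        exact ⟨_, _, _, hr⟩) ML
  obtain ⟨c, hc⟩ : ∃ c, ∀ n, (cL * t₁ n + cL) + (c' * u₁ (10 * logSize f n) + c'
      + n * ((c₂ * u₂ (2 * logSize f n + 2) + c₂) + 4 * (2 * logSize f n + 2) + 7)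
      + 11 * (2 * logSize f n + 2) + 13) + 2 * n + 2
      ≤ c * t₂ (3 * (2 * logSize f n + 2)) + c := by
    apply exists_forall_le_mul_add (C := cL + c' + 10 * c₂ + 20)
    filter_upwards [htime, eventually_le_logSize f 1, eventually_le_logSize f c₂] with n h1 h2 h3
    -- The value `0` of `u₂` would bound the degree by `c₂`.
    have hw1 : 1 ≤ u₂ (2 * logSize f n + 2) := by
      by_contra h0
      have := hk n
      rw [Nat.lt_one_iff.1 (not_le.1 h0)] at this
      omega
    refine (verification_time_le h2 (hu₂ (show 2 * logSize f n + 2 ≤ 10 * logSize f n by omega))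
      hw1 (hk n)).trans ?_
    have := Nat.mul_le_mul_left (cL + c' + 10 * c₂ + 20)
      (h1.trans (ht₂ (show logSize f n ≤ 3 * (2 * logSize f n + 2) by omega)))
    omega
  refine ⟨N, c, fun a => ⟨?_, fun ha T' hacc => ?_⟩⟩
  · rintro ⟨y, hy, hash⟩
    obtain ⟨τ', hr⟩ := (hver a y).1 hash
    have hlen : a.length = 3 * (2 * logSize f y.length + 2) := by
      obtain ⟨-, h1, z, hz, rfl⟩ := hash
      rw [length_hashCode h1 hz, hdeg]
    have hacc := (hN a).1 y _ _ τ' hr ((hML y).1 hy)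
    obtain ⟨t, ht, h⟩ := hacc
    refine ⟨t, ht.trans ?_, h⟩
    rw [hlen]
    exact hc y.length
  · obtain ⟨y, T'', hy, hD⟩ := (hN a).2 T' hacc
    refine ha ⟨y, ?_, ?_⟩
    · by_contra hyL
      exact (hML y).2 hyL T'' hy
    · by_contra hash
      obtain ⟨B, τ', hr⟩ := (hver a y).2 hash
      exact absurd (hD _ _ _ hr) (by simp)

/-! ### Coin rules and bounded memory -/

theorem CoinRule.step_of {Q ι : Type} {δ : CoinRule Q ι} {q q' : Q} {τ τ' : ι → Tape}
    {s : ι → Option Bool} {a : Bool → Act Q ι} {b : Bool} (hs : ∀ i, (τ i).read = s i)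
    (h : δ q s = some a) (hq : (a b).1 = q') (hτ : ∀ i, (τ i).step ((a b).2 i) = τ' i) :
    δ.step (Cfg.ofTapes q τ) b = Cfg.ofTapes q' τ' := by
  have h' : δ (Cfg.ofTapes q τ).state (Cfg.ofTapes q τ).scan = some a := by
    rw [← h, ← funext hs]
    rfl
  rw [CoinRule.step, h', ← funext hτ, ← hq]
  rfl

theorem CoinRule.run_cons {Q ι : Type} (δ : CoinRule Q ι) (c : Cfg Q ι) (b : Bool)
    (ω : List Bool) : δ.run c (b :: ω) = δ.run (δ.step c b) ω := rfl

theorem CoinRule.run_append {Q ι : Type} (δ : CoinRule Q ι) (c : Cfg Q ι) (ω ω' : List Bool) :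
    δ.run c (ω ++ ω') = δ.run (δ.run c ω) ω' :=
  List.foldl_append

theorem CoinRule.run_of_halted {Q ι : Type} {δ : CoinRule Q ι} {c : Cfg Q ι} (h : δ.Halted c)
    (ω : List Bool) : δ.run c ω = c := by
  induction ω with
  | nil => rfl
  | cons b ω ih =>
    have hs : δ.step c b = c := by rw [CoinRule.step, h]
    rw [run_cons, hs, ih]

theorem Cfg.FitsIn.mono {Q ι : Type} {c : Cfg Q ι} {S S' : ℕ} (h : c.FitsIn S) (hS : S ≤ S') :
    c.FitsIn S' := fun i =>
  ⟨(h i).1.trans (by exact_mod_cast hS), fun z hz => ((h i).2 z hz).trans (by exact_mod_cast hS)⟩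

theorem Cfg.FitsIn.apply {Q ι : Type} {c : Cfg Q ι} {S : ℕ} (h : c.FitsIn S) (a : Act Q ι) :
    (c.apply a).FitsIn (S + 1) := by
  intro i
  obtain ⟨h1, h2⟩ := h i
  constructor
  · have : |(a.2 i).2.toInt| ≤ 1 := by cases (a.2 i).2 <;> simp [Move.toInt]
    have := abs_add_le (c.head i) (a.2 i).2.toInt
    simp only [Cfg.apply]
    push_cast
    omega
  · intro z hz
    by_cases hzi : z = c.head i
    · subst hzi
      push_cast
      omega
    · simp only [Cfg.apply] at hz
      rw [Function.update_of_ne hzi] at hz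
      have := h2 z hz
      push_cast
      omega

theorem Cfg.FitsIn.run {Q ι : Type} {δ : CoinRule Q ι} {c : Cfg Q ι} {S : ℕ} (h : c.FitsIn S)
    (ω : List Bool) : (δ.run c ω).FitsIn (S + ω.length) := by
  induction ω generalizing c S with
  | nil => exact h
  | cons b ω ih =>
    rw [CoinRule.run_cons, List.length_cons, Nat.add_comm ω.length 1, ← Nat.add_assoc]
    refine ih ?_
    rw [CoinRule.step]
    split
    · exact h.mono (Nat.le_succ S)
    · exact h.apply _

/-- Strings of length at most `S`, with all heads on cell `0`, fit in space `S`. -/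
theorem Cfg.fitsIn_ofTapes {Q ι : Type} {q : Q} {τ : ι → Tape} {S : ℕ}
    (h : ∀ i, ∃ s : List Bool, τ i = Tape.ofList s ∧ s.length ≤ S) :
    (Cfg.ofTapes q τ).FitsIn S := by
  intro i
  obtain ⟨s, hs, hS⟩ := h i
  simp only [Cfg.ofTapes, hs, Tape.zip, List.length_nil, Nat.cast_zero, abs_zero,
    List.reverse_nil, List.nil_append]
  refine ⟨Nat.cast_nonneg S, fun z hz => ?_⟩
  rcases lt_or_ge z 0 with h0 | h0
  · exact absurd (Tape.tapeOf_neg s h0) hz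
  · obtain ⟨j, rfl⟩ := Int.eq_ofNat_of_zero_le h0
    rw [Tape.tapeOf_natCast] at hz
    have : j < s.length := by
      by_contra hj
      exact hz (List.getElem?_eq_none (not_lt.1 hj))
    rw [abs_of_nonneg h0]
    exact_mod_cast (this.le.trans hS)

/-! ### The streaming algorithm -/

namespace HashStream

/-- The control of the streaming algorithm. Before the stream: `start`, `draw` (a random key is
drawn, and the length is padded with zeros), `rewind`. After each bit: `write`, `conv`, `mul`,
`add`. In the state `sim q j`, a probabilistic machine is simulated whose input tape is the
interleaving of three tracks; it is in state `q`, and its head is on track `j`. -/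
inductive Ctl (Q : Type) where
  | start
  | draw
  | rewind
  | write (b : Bool)
  | conv
  | mul
  | add
  | sim (q : Q) (j : Fin 3)

theorem finite_ctl (Q : Type) [Finite Q] : Finite (Ctl Q) :=
  Finite.of_surjective (fun i : Fin 6 ⊕ Bool ⊕ Q × Fin 3 =>
    Sum.elim ![Ctl.start, .draw, .rewind, .conv, .mul, .add]
      (Sum.elim .write fun q => .sim q.1 q.2) i) fun c => by
    cases c with
    | start => exact ⟨Sum.inl 0, rfl⟩
    | draw => exact ⟨Sum.inl 1, rfl⟩
    | rewind => exact ⟨Sum.inl 2, rfl⟩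
    | conv => exact ⟨Sum.inl 3, rfl⟩
    | mul => exact ⟨Sum.inl 4, rfl⟩
    | add => exact ⟨Sum.inl 5, rfl⟩
    | write b => exact ⟨Sum.inr (Sum.inl b), rfl⟩
    | sim q j => exact ⟨Sum.inr (Sum.inr (q, j)), rfl⟩

/-- A family indexed by the tapes: length, field, key, current hash value, received bit, the field
element of this bit, and the work tapes of the simulated machine. -/
def fam {W α : Type} (n f z g s e : α) (w : W → α) : Fin 2 ⊕ (Fin 4 ⊕ W) → α :=
  Sum.elim ![n, f] (Sum.elim ![z, g, s, e] w)

section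

variable {W : Type}

theorem forall_index {P : Fin 2 ⊕ (Fin 4 ⊕ W) → Prop} (h₁ : P (Sum.inl 0)) (h₂ : P (Sum.inl 1))
    (h₃ : P (Sum.inr (Sum.inl 0))) (h₄ : P (Sum.inr (Sum.inl 1))) (h₅ : P (Sum.inr (Sum.inl 2)))
    (h₆ : P (Sum.inr (Sum.inl 3))) (h₇ : ∀ w, P (Sum.inr (Sum.inr w))) (i) : P i := by
  rcases i with i | i | i
  · fin_cases i <;> assumption
  · fin_cases i <;> assumption
  · exact h₇ i

/-- The tapes of the streaming algorithm while no machine is simulated. -/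
def tapes (n f z g s e : Tape) : Fin 2 ⊕ (Fin 4 ⊕ W) → Tape :=
  fam n f z g s e fun _ => Tape.ofList []

end

section

variable (M : PTM) (N : ℕ)

/-- The states: at most `N` letters of the input (the first ones), and the control. -/
abbrev State : Type := {l : List Bool // l.length ≤ N} × Ctl M.State

theorem finite_state : Finite (State M N) := by
  have := M.finState
  have := finite_ctl M.State
  have : Finite {l : List Bool // l.length ≤ N} := (List.finite_length_le Bool N).to_subtype
  infer_instance

/-- Append a letter to the stored letters, if there is room for it. -/
def store (l : {l : List Bool // l.length ≤ N}) (b : Bool) : {l : List Bool // l.length ≤ N} :=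
  if h : l.1.length < N then ⟨l.1 ++ [b], by simpa using h⟩ else l

/-- The phase before the stream. The head of the tape with the `k + 1` letters of the field
representation starts on its second letter, so that a key of length `k` is drawn. -/
def preRule : CoinRule (State M N) (Fin 2 ⊕ (Fin 4 ⊕ M.Work)) := fun q s =>
  let keep : Fin 2 ⊕ (Fin 4 ⊕ M.Work) → Option Bool × Move := fun i => (s i, .stay)
  match q with
  | (l, .start) => some fun _ => ((l, .draw), fam (keep (Sum.inl 0)) (s (Sum.inl 1), .right)
      (keep (Sum.inr (Sum.inl 0))) (keep (Sum.inr (Sum.inl 1))) (keep (Sum.inr (Sum.inl 2)))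
      (keep (Sum.inr (Sum.inl 3))) fun w => keep (Sum.inr (Sum.inr w)))
  | (l, .draw) => match s (Sum.inl 1) with
    | some f => some fun b => ((l, .draw), fam (some ((s (Sum.inl 0)).getD false), .right)
        (some f, .right) (some b, .right) (keep (Sum.inr (Sum.inl 1)))
        (keep (Sum.inr (Sum.inl 2))) (keep (Sum.inr (Sum.inl 3)))
        fun w => keep (Sum.inr (Sum.inr w)))
    | none => some fun _ => ((l, .rewind), fam (s (Sum.inl 0), .left) (none, .left)
        (s (Sum.inr (Sum.inl 0)), .left) (keep (Sum.inr (Sum.inl 1)))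
        (keep (Sum.inr (Sum.inl 2))) (keep (Sum.inr (Sum.inl 3)))
        fun w => keep (Sum.inr (Sum.inr w)))
  | (l, .rewind) => match s (Sum.inr (Sum.inl 0)) with
    | some z => some fun _ => ((l, .rewind), fam (s (Sum.inl 0), .left) (s (Sum.inl 1), .left)
        (some z, .left) (keep (Sum.inr (Sum.inl 1)))
        (keep (Sum.inr (Sum.inl 2))) (keep (Sum.inr (Sum.inl 3)))
        fun w => keep (Sum.inr (Sum.inr w)))
    | none => some fun _ => ((l, .sim M.start 0), fam (s (Sum.inl 0), .right) (keep (Sum.inl 1))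
        (none, .right) (keep (Sum.inr (Sum.inl 1)))
        (keep (Sum.inr (Sum.inl 2))) (keep (Sum.inr (Sum.inl 3)))
        fun w => keep (Sum.inr (Sum.inr w)))
  | _ => none

/-- The processing of a bit `b`: the current hash value `g` is replaced by `g * z + b`. -/
def updateRule : State M N → (Fin 2 ⊕ (Fin 4 ⊕ M.Work) → Option Bool) →
    Option (Instr (State M N) (Fin 2 ⊕ (Fin 4 ⊕ M.Work)))
  | (l, .write b), s =>
    let keep : Fin 2 ⊕ (Fin 4 ⊕ M.Work) → Option Bool × Move := fun i => (s i, .stay)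
    some (.act ((l, .conv), fam (keep (Sum.inl 0)) (keep (Sum.inl 1)) (keep (Sum.inr (Sum.inl 0)))
      (keep (Sum.inr (Sum.inl 1))) (some b, .stay) (keep (Sum.inr (Sum.inl 3)))
      fun w => keep (Sum.inr (Sum.inr w))))
  | (l, .conv), _ => some (.conv (Sum.inr (Sum.inl 2)) (Sum.inr (Sum.inl 3)) (l, .mul))
  | (l, .mul), _ => some (.mul (Sum.inr (Sum.inl 1)) (Sum.inr (Sum.inl 0)) (Sum.inr (Sum.inl 1))
      (l, .add))
  | (l, .add), _ => some (.add (Sum.inr (Sum.inl 1)) (Sum.inr (Sum.inl 3)) (Sum.inr (Sum.inl 1))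
      (l, .sim M.start 0))
  | _, _ => none

/-- The tapes that carry the three tracks of the input of the simulated machine: the length, the
key, and the hash value. -/
def track {W : Type} : Fin 3 → Fin 2 ⊕ (Fin 4 ⊕ W) :=
  ![Sum.inl 0, Sum.inr (Sum.inl 0), Sum.inr (Sum.inl 1)]

/-- The track on which the simulated input head is after a move. -/
def nextTrack (m : Move) (j : Fin 3) : Fin 3 :=
  match m with
  | .left => j - 1
  | .stay => j
  | .right => j + 1

/-- The move of the heads of the tracks that simulates a move of the input head. -/
def trackMove (m : Move) (j : Fin 3) : Move :=
  match m with
  | .left => if j = 0 then .left else .stay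
  | .stay => .stay
  | .right => if j = 2 then .right else .stay

/-- The simulation of the probabilistic machine: cell `3 i + j` of its input tape is cell `i` of
track `j`, so that each of its steps takes one step. -/
def postRule : CoinRule (State M N) (Fin 2 ⊕ (Fin 4 ⊕ M.Work)) := fun q s =>
  match q with
  | (l, .sim q j) =>
    (M.next q fun i => i.elim (s (track j)) fun w => s (Sum.inr (Sum.inr w))).map fun a b =>
      let w : Fin 3 → Option Bool × Move := fun t =>
        (if t = j then ((a b).2 none).1 else s (track t), trackMove ((a b).2 none).2 j)
      ((l, .sim (a b).1 (nextTrack ((a b).2 none).2 j)),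
        fam (w 0) (s (Sum.inl 1), .stay) (w 1) (w 2) (s (Sum.inr (Sum.inl 2)), .stay)
          (s (Sum.inr (Sum.inl 3)), .stay) fun i => (a b).2 (some i))
  | _ => none

/-- The streaming algorithm that computes the hash value of its input for a random key and runs the
probabilistic machine `M` on the encoding of length, key and hash value. Inputs of length less than
`N` are compared with `L` by the finite control. -/
abbrev machine (L : Language Bool) : StreamMachine where
  Work := Fin 4 ⊕ M.Work
  State := State M N
  finWork := have := M.finWork; inferInstance
  finState := finite_state M N
  start := (⟨[], Nat.zero_le N⟩, .start)
  accept := {q | (q.1.1.length < N ∧ q.1.1 ∈ L) ∨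
    (¬ q.1.1.length < N ∧ ∃ q' ∈ M.accept, ∃ j, q.2 = .sim q' j)}
  pre := preRule M N
  receive := fun b q => (store N q.1 b, .write b)
  update := updateRule M N
  post := postRule M N

end

/-! ### The phase before the stream -/

section

variable {M : PTM} {N : ℕ} {l : {l : List Bool // l.length ≤ N}}

/-- The string `r`, cut or padded with zeros to the length `m`. -/
def padTo : ℕ → List Bool → List Bool
  | 0, _ => []
  | m + 1, r => r.head?.getD false :: padTo m r.tail

@[simp] theorem length_padTo (m : ℕ) (r : List Bool) : (padTo m r).length = m := by
  induction m generalizing r with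
  | zero => rfl
  | succ m ih => simp [padTo, ih]

theorem padTo_eq {m : ℕ} {r : List Bool} (h : r.length ≤ m) :
    padTo m r = r ++ List.replicate (m - r.length) false := by
  induction m generalizing r with
  | zero =>
    obtain rfl := List.eq_nil_of_length_eq_zero (Nat.le_zero.1 h)
    rfl
  | succ m ih =>
    cases r with
    | nil => simpa [padTo, List.replicate_succ] using ih (r := []) (by simp)
    | cons b r => simpa [padTo] using ih (r := r) (by simpa using h)

/-- A key is drawn while the head of the field tape moves to the right end. -/
theorem run_draw (cs rest lF rF lN rN lZ : List Bool) (h : cs.length = rF.length) :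
    (preRule M N).run (Cfg.ofTapes (l, .draw) (tapes (.zip lN rN) (.zip lF rF) (.zip lZ [])
      (.ofList []) (.ofList []) (.ofList []))) (cs ++ rest) =
    (preRule M N).run (Cfg.ofTapes (l, .draw) (tapes
      (.zip ((padTo rF.length rN).reverse ++ lN) (rN.drop rF.length))
      (.zip (rF.reverse ++ lF) []) (.zip (cs.reverse ++ lZ) [])
      (.ofList []) (.ofList []) (.ofList []))) rest := by
  induction rF generalizing cs lF lN rN lZ with
  | nil =>
    obtain rfl := List.eq_nil_of_length_eq_zero h
    rfl
  | cons f rF ih =>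
    obtain ⟨c, cs, rfl⟩ := List.exists_cons_of_length_eq_add_one h
    have hn : (Tape.zip lN rN).step (some (rN.head?.getD false), .right)
        = .zip (rN.head?.getD false :: lN) rN.tail := by
      cases rN <;> simp
    have hs : (preRule M N).step (Cfg.ofTapes (l, .draw) (tapes (.zip lN rN) (.zip lF (f :: rF))
        (.zip lZ []) (.ofList []) (.ofList []) (.ofList []))) c =
        Cfg.ofTapes (l, .draw) (tapes (.zip (rN.head?.getD false :: lN) rN.tail)
          (.zip (f :: lF) rF) (.zip (c :: lZ) []) (.ofList []) (.ofList []) (.ofList [])) :=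
      CoinRule.step_of (s := fam rN.head? (some f) none none none none fun _ => none)
        (forall_index (Tape.read_zip _ _) (Tape.read_zip _ _) (Tape.read_zip _ _)
          (Tape.read_zip _ _) (Tape.read_zip _ _) (Tape.read_zip _ _) fun _ => Tape.read_zip _ _)
        rfl rfl
        (forall_index hn (Tape.step_right_cons ..) (Tape.step_right_nil ..)
          (Tape.step_stay_of_read rfl) (Tape.step_stay_of_read rfl)
          (Tape.step_stay_of_read rfl) fun _ => Tape.step_stay_of_read rfl)
    rw [List.cons_append, CoinRule.run_cons, hs, ih _ _ _ _ _ (by simpa using h)]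
    simp [padTo]

/-- The three heads return to cell `0`. The field tape is one letter longer than the other two tapes,
so that its head arrives when the other heads are on the blank to the left of their strings. -/
theorem run_rewind (cs rest lN lF lZ rN rF rZ : List Bool) (d f : Bool)
    (h : cs.length = lZ.length) (hN : lN.length = lZ.length) (hF : lF.length = lZ.length) :
    (preRule M N).run (Cfg.ofTapes (l, .rewind) (tapes (.back lN rN) (.back (lF ++ [f]) rF)
      (.back lZ rZ) (.ofList []) (.ofList []) (.ofList []))) (cs ++ d :: rest) =
    (preRule M N).run (Cfg.ofTapes (l, .sim M.start 0) (tapes (.ofList (lN.reverse ++ rN))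
      (.ofList (f :: (lF.reverse ++ rF))) (.ofList (lZ.reverse ++ rZ))
      (.ofList []) (.ofList []) (.ofList []))) rest := by
  induction lZ generalizing cs lN lF rN rF rZ with
  | nil =>
    obtain rfl := List.eq_nil_of_length_eq_zero h
    obtain rfl := List.eq_nil_of_length_eq_zero hN
    obtain rfl := List.eq_nil_of_length_eq_zero hF
    rw [List.nil_append (d :: rest), CoinRule.run_cons]
    refine congrArg (fun c => (preRule M N).run c rest) ?_
    exact CoinRule.step_of (s := fam none (some f) none none none none fun _ => none)
      (forall_index (Tape.read_back [] _) (Tape.read_back [f] _) (Tape.read_back [] _)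
        (Tape.read_zip _ _) (Tape.read_zip _ _) (Tape.read_zip _ _) fun _ => Tape.read_zip _ _)
      rfl rfl
      (forall_index (Tape.back_step_right _) (Tape.step_stay_of_read (Tape.read_back [f] _))
        (Tape.back_step_right _) (Tape.step_stay_of_read rfl) (Tape.step_stay_of_read rfl)
        (Tape.step_stay_of_read rfl) fun _ => Tape.step_stay_of_read rfl)
  | cons z lZ ih =>
    obtain ⟨c, cs, rfl⟩ := List.exists_cons_of_length_eq_add_one h
    obtain ⟨x, lN, rfl⟩ := List.exists_cons_of_length_eq_add_one hN
    obtain ⟨y, lF, rfl⟩ := List.exists_cons_of_length_eq_add_one hF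
    have hs : (preRule M N).step (Cfg.ofTapes (l, .rewind) (tapes (.back (x :: lN) rN)
        (.back (y :: (lF ++ [f])) rF) (.back (z :: lZ) rZ)
        (.ofList []) (.ofList []) (.ofList []))) c =
        Cfg.ofTapes (l, .rewind) (tapes (.back lN (x :: rN)) (.back (lF ++ [f]) (y :: rF))
          (.back lZ (z :: rZ)) (.ofList []) (.ofList []) (.ofList [])) :=
      CoinRule.step_of (s := fam (some x) (some y) (some z) none none none fun _ => none)
        (forall_index (Tape.read_back (x :: lN) _) (Tape.read_back (y :: (lF ++ [f])) _)
          (Tape.read_back (z :: lZ) _)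
          (Tape.read_zip _ _) (Tape.read_zip _ _) (Tape.read_zip _ _) fun _ => Tape.read_zip _ _)
        rfl rfl
        (forall_index (Tape.back_step_left ..) (Tape.back_step_left ..) (Tape.back_step_left ..)
          (Tape.step_stay_of_read rfl) (Tape.step_stay_of_read rfl)
          (Tape.step_stay_of_read rfl) fun _ => Tape.step_stay_of_read rfl)
    rw [List.cons_append, List.cons_append, CoinRule.run_cons, hs,
      ih _ _ _ _ _ _ (by simpa using h) (by simpa using hN) (by simpa using hF)]
    simp

theorem ofStrings_eq_tapes {Q W : Type} (q : Q) (s s' : List Bool) :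
    Cfg.ofStrings q (Sum.elim ![s, s'] fun _ : Fin 4 ⊕ W => []) =
      Cfg.ofTapes q (tapes (.ofList s) (.ofList s')
        (.ofList []) (.ofList []) (.ofList []) (.ofList [])) := by
  rw [Cfg.ofStrings_eq_ofTapes]
  exact congrArg _ (funext (forall_index rfl rfl rfl rfl rfl rfl fun _ => rfl))

/-- In its first `2 k + 3` steps the algorithm pads the length to `k` letters and draws a key of
length `k`, where `k + 1` is the length of the field representation. -/
theorem run_pre (r F cs ds : List Bool) (b b' b'' : Bool) (hF : F.length = cs.length + 1)
    (hr : r.length ≤ cs.length) (hd : ds.length = cs.length) :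
    (preRule M N).run (Cfg.ofTapes (l, .start) (tapes (.ofList r) (.ofList F)
      (.ofList []) (.ofList []) (.ofList []) (.ofList [])))
      (b :: (cs ++ b' :: (ds ++ [b'']))) =
    Cfg.ofTapes (l, .sim M.start 0) (tapes (.ofList (padTo cs.length r)) (.ofList F)
      (.ofList cs) (.ofList []) (.ofList []) (.ofList [])) := by
  obtain ⟨f, F, rfl⟩ := List.exists_cons_of_length_eq_add_one hF
  have hF' : F.length = cs.length := by simpa using hF
  have hs : (preRule M N).step (Cfg.ofTapes (l, .start) (tapes (.ofList r) (.ofList (f :: F))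
      (.ofList []) (.ofList []) (.ofList []) (.ofList []))) b =
      Cfg.ofTapes (l, .draw) (tapes (.zip [] r) (.zip [f] F) (.zip [] [])
        (.ofList []) (.ofList []) (.ofList [])) :=
    CoinRule.step_of (s := fam r.head? (some f) none none none none fun _ => none)
      (forall_index (Tape.read_zip _ _) (Tape.read_zip _ _) (Tape.read_zip _ _)
        (Tape.read_zip _ _) (Tape.read_zip _ _) (Tape.read_zip _ _) fun _ => Tape.read_zip _ _)
      rfl rfl
      (forall_index (Tape.step_stay_of_read (Tape.read_zip _ _)) (Tape.step_right_cons ..)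
        (Tape.step_stay_of_read rfl) (Tape.step_stay_of_read rfl) (Tape.step_stay_of_read rfl)
        (Tape.step_stay_of_read rfl) fun _ => Tape.step_stay_of_read rfl)
  have hs' : ∀ lN lF lZ : List Bool, (preRule M N).step (Cfg.ofTapes (l, .draw)
      (tapes (.zip lN []) (.zip lF []) (.zip lZ []) (.ofList []) (.ofList []) (.ofList []))) b' =
      Cfg.ofTapes (l, .rewind) (tapes (.back lN []) (.back lF []) (.back lZ [])
        (.ofList []) (.ofList []) (.ofList [])) := fun lN lF lZ =>
    CoinRule.step_of (s := fam none none none none none none fun _ => none)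
      (forall_index (Tape.read_zip _ _) (Tape.read_zip _ _) (Tape.read_zip _ _)
        (Tape.read_zip _ _) (Tape.read_zip _ _) (Tape.read_zip _ _) fun _ => Tape.read_zip _ _)
      rfl rfl
      (forall_index (Tape.step_left_nil _) (Tape.step_left_nil _) (Tape.step_left_nil _)
        (Tape.step_stay_of_read rfl) (Tape.step_stay_of_read rfl)
        (Tape.step_stay_of_read rfl) fun _ => Tape.step_stay_of_read rfl)
  rw [CoinRule.run_cons, hs, run_draw _ _ _ _ _ _ _ hF'.symm, CoinRule.run_cons,
    List.drop_eq_nil_of_le (by omega), hs', run_rewind _ _ _ _ _ _ _ _ _ _ (by simp [hd])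
      (by simp [hF']) (by simp [hF'])]
  simp [CoinRule.run, hF']

end

end HashStream

/-! ### The processing of the stream -/

theorem Cfg.put_ofTapes {Q ι : Type} {q : Q} {τ τ' : ι → Tape} {i : ι} {s : List Bool}
    (h : τ' i = .ofList s) (h' : ∀ j, j ≠ i → τ' j = τ j) :
    (Cfg.ofTapes q τ).put i s = Cfg.ofTapes q τ' := by
  classical
  have : τ' = Function.update τ i (.ofList s) := by
    funext j
    by_cases hj : j = i
    · subst hj
      simp [h]
    · simp [hj, h']
  subst this
  simp only [Cfg.put, Cfg.ofTapes, Cfg.mk.injEq, true_and]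
  constructor
  · funext j
    by_cases hj : j = i
    · subst hj
      simp [Tape.zip]
    · simp [hj]
  · funext j
    by_cases hj : j = i
    · subst hj
      simp [Tape.zip]
    · simp [hj]

theorem Instr.exec_act_ofTapes {Q ι : Type} {p : (ZMod 2)[X]} {q q' : Q} {τ τ' : ι → Tape}
    {a : Act Q ι} (hq : a.1 = q') (hτ : ∀ i, (τ i).step (a.2 i) = τ' i) :
    (Instr.act a).exec p (Cfg.ofTapes q τ) = Cfg.ofTapes q' τ' := by
  rw [← hq, ← funext hτ]
  rfl

namespace HashStream

theorem getElem_padTo (m : ℕ) (r : List Bool) (j : ℕ) (hj : j < (padTo m r).length) :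
    (padTo m r)[j] = r[j]?.getD false := by
  induction m generalizing r j with
  | zero => simp at hj
  | succ m ih =>
    cases j with
    | zero => cases r <;> rfl
    | succ j =>
      cases r with
      | nil => simpa [padTo] using ih [] j (by simpa using hj)
      | cons b r => simpa [padTo] using ih r j (by simpa using hj)

theorem take_ofTapes {Q ι : Type} {q : Q} {τ : ι → Tape} {i : ι} {s : List Bool}
    (h : τ i = .ofList s) (k : ℕ) : (Cfg.ofTapes q τ).take i k = padTo k s := by
  apply List.ext_getElem
  · simp [Cfg.take]
  · intro j h₁ h₂
    rw [getElem_padTo]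
    simp [Cfg.take, Cfg.ofTapes, h, Tape.zip, Tape.tapeOf_natCast]

theorem exec_conv_ofTapes {Q ι : Type} {p : (ZMod 2)[X]} {q q' : Q} {τ τ₁ τ' : ι → Tape}
    {i j : ι} {s : List Bool} (hs : τ i = .ofList s) (h₁ : τ₁ i = .ofList [])
    (h₁' : ∀ t, t ≠ i → τ₁ t = τ t)
    (h₂ : τ' j = .ofList (elemBits p.natDegree (segPoly (padTo p.natDegree s))))
    (h₂' : ∀ t, t ≠ j → τ' t = τ₁ t) :
    (Instr.conv i j q').exec p (Cfg.ofTapes q τ) = Cfg.ofTapes q' τ' := by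
  rw [Instr.exec, take_ofTapes hs, Cfg.put_ofTapes h₁ h₁', Cfg.put_ofTapes h₂ h₂']
  rfl

theorem exec_mul_ofTapes {Q ι : Type} {p : (ZMod 2)[X]} {q q' : Q} {τ τ' : ι → Tape}
    {i i' j : ι} {s s' : List Bool} (hs : τ i = .ofList s) (hs' : τ i' = .ofList s')
    (h : τ' j = .ofList (elemBits p.natDegree
      ((elemPoly (padTo p.natDegree s) * elemPoly (padTo p.natDegree s')) %ₘ p)))
    (h' : ∀ t, t ≠ j → τ' t = τ t) :
    (Instr.mul i i' j q').exec p (Cfg.ofTapes q τ) = Cfg.ofTapes q' τ' := by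
  rw [Instr.exec, take_ofTapes hs, take_ofTapes hs', Cfg.put_ofTapes h h']
  rfl

theorem exec_add_ofTapes {Q ι : Type} {p : (ZMod 2)[X]} {q q' : Q} {τ τ' : ι → Tape}
    {i i' j : ι} {s s' : List Bool} (hs : τ i = .ofList s) (hs' : τ i' = .ofList s')
    (h : τ' j = .ofList (elemBits p.natDegree
      ((elemPoly (padTo p.natDegree s) + elemPoly (padTo p.natDegree s')) %ₘ p)))
    (h' : ∀ t, t ≠ j → τ' t = τ t) :
    (Instr.add i i' j q').exec p (Cfg.ofTapes q τ) = Cfg.ofTapes q' τ' := by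
  rw [Instr.exec, take_ofTapes hs, take_ofTapes hs', Cfg.put_ofTapes h h']
  rfl

theorem padTo_of_length {k : ℕ} {s : List Bool} (h : s.length = k) : padTo k s = s := by
  simp [padTo_eq h.le, h]

theorem elemPoly_padTo_nil (k : ℕ) : elemPoly (padTo k []) = 0 := by
  ext i
  simp [elemPoly_coeff, padTo_eq]

theorem segPoly_padTo_singleton {k : ℕ} (hk : 1 ≤ k) (b : Bool) :
    segPoly (padTo k [b]) = if b then 1 else 0 := by
  ext i
  rw [segPoly_coeff, padTo_eq (by simpa using hk)]
  cases i with
  | zero => cases b <;> simp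
  | succ i => cases b <;> simp [Polynomial.coeff_one]


section

variable {M : PTM} {N : ℕ} {L : Language Bool}

theorem updStep_of {p : (ZMod 2)[X]} {q : State M N} {τ : Fin 2 ⊕ (Fin 4 ⊕ M.Work) → Tape}
    {i : Instr (State M N) (Fin 2 ⊕ (Fin 4 ⊕ M.Work))}
    (h : updateRule M N q (fun i => (τ i).read) = some i) :
    (machine M N L).updStep p (Cfg.ofTapes q τ) = i.exec p (Cfg.ofTapes q τ) := by
  have h' : (machine M N L).update (Cfg.ofTapes q τ).state (Cfg.ofTapes q τ).scan = some i := h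
  rw [StreamMachine.updStep, h']

theorem updStep_iterate_of_halted {p : (ZMod 2)[X]} {c : (machine M N L).Conf}
    (h : (machine M N L).update c.state c.scan = none) (T : ℕ) :
    ((machine M N L).updStep p)^[T] c = c := by
  refine Function.iterate_fixed ?_ T
  rw [StreamMachine.updStep, h]

/-- The processing of one bit `b` takes four steps, in which the hash value `g` is replaced by
`hashStep p Z g b`. -/
theorem updStep_iterate {p : (ZMod 2)[X]} (hp : Irreducible p) {z g s : List Bool}
    (hz : z.length = p.natDegree) {h : (ZMod 2)[X]} (hg : elemPoly (padTo p.natDegree g) = h)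
    (a F : List Bool) (l : {l : List Bool // l.length ≤ N}) (q : Ctl M.State) (b : Bool) {T : ℕ}
    (hT : 4 ≤ T) :
    ((machine M N L).updStep p)^[T] ((machine M N L).recv (Cfg.ofTapes (l, q)
      (tapes (.ofList a) (.ofList F) (.ofList z) (.ofList g) (.ofList []) (.ofList s))) b) =
    Cfg.ofTapes (store N l b, .sim M.start 0) (tapes (.ofList a) (.ofList F) (.ofList z)
      (.ofList (elemBits p.natDegree (hashStep p (elemPoly z) h b))) (.ofList [])
      (.ofList (elemBits p.natDegree (if b then 1 else 0)))) := by
  have hk : 1 ≤ p.natDegree := hp.natDegree_pos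
  set k := p.natDegree with hkd
  have h1 : (machine M N L).updStep p ((machine M N L).recv (Cfg.ofTapes (l, q)
      (tapes (.ofList a) (.ofList F) (.ofList z) (.ofList g) (.ofList []) (.ofList s))) b) =
      Cfg.ofTapes (store N l b, .conv) (tapes (.ofList a) (.ofList F) (.ofList z) (.ofList g)
        (.ofList [b]) (.ofList s)) := by
    exact (updStep_of (q := (store N l b, .write b)) rfl).trans
      (Instr.exec_act_ofTapes rfl (forall_index
        (Tape.step_read_stay _) (Tape.step_read_stay _) (Tape.step_read_stay _)
        (Tape.step_read_stay _) (Tape.step_stay_nil [] b) (Tape.step_read_stay _)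
        fun _ => Tape.step_read_stay _))
  have h2 : (machine M N L).updStep p (Cfg.ofTapes (store N l b, .conv)
        (tapes (.ofList a) (.ofList F) (.ofList z) (.ofList g) (.ofList [b]) (.ofList s))) =
      Cfg.ofTapes (store N l b, .mul) (tapes (.ofList a) (.ofList F) (.ofList z) (.ofList g)
        (.ofList []) (.ofList (elemBits k (if b then 1 else 0)))) := by
    refine (updStep_of rfl).trans (exec_conv_ofTapes (s := [b]) (τ₁ := tapes (.ofList a)
      (.ofList F) (.ofList z) (.ofList g) (.ofList []) (.ofList s)) rfl rfl ?_ ?_ ?_)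
    · exact forall_index (fun _ => rfl) (fun _ => rfl) (fun _ => rfl) (fun _ => rfl)
        (fun h => (h rfl).elim) (fun _ => rfl) fun _ _ => rfl
    · rw [segPoly_padTo_singleton hk]
      rfl
    · exact forall_index (fun _ => rfl) (fun _ => rfl) (fun _ => rfl) (fun _ => rfl)
        (fun _ => rfl) (fun h => (h rfl).elim) fun _ _ => rfl
  have h3 : (machine M N L).updStep p (Cfg.ofTapes (store N l b, .mul)
        (tapes (.ofList a) (.ofList F) (.ofList z) (.ofList g) (.ofList [])
          (.ofList (elemBits k (if b then 1 else 0))))) =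
      Cfg.ofTapes (store N l b, .add) (tapes (.ofList a) (.ofList F) (.ofList z)
        (.ofList (elemBits k ((h * elemPoly z) %ₘ p)))
        (.ofList []) (.ofList (elemBits k (if b then 1 else 0)))) := by
    refine (updStep_of rfl).trans (exec_mul_ofTapes (s := g) (s' := z) rfl rfl ?_ ?_)
    · rw [padTo_of_length hz, hg]
      rfl
    · exact forall_index (fun _ => rfl) (fun _ => rfl) (fun _ => rfl) (fun h => (h rfl).elim)
        (fun _ => rfl) (fun _ => rfl) fun _ _ => rfl
  have h4 : (machine M N L).updStep p (Cfg.ofTapes (store N l b, .add) (tapes (.ofList a)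
        (.ofList F) (.ofList z) (.ofList (elemBits k ((h * elemPoly z) %ₘ p)))
        (.ofList []) (.ofList (elemBits k (if b then 1 else 0))))) =
      Cfg.ofTapes (store N l b, .sim M.start 0) (tapes (.ofList a) (.ofList F) (.ofList z)
        (.ofList (elemBits k (hashStep p (elemPoly z) h b)))
        (.ofList []) (.ofList (elemBits k (if b then 1 else 0)))) := by
    refine (updStep_of rfl).trans (exec_add_ofTapes (s := elemBits k ((h * elemPoly z) %ₘ p))
      (s' := elemBits k (if b then 1 else 0)) rfl rfl ?_ ?_)
    · have hd := degree_hashStep_lt hp (elemPoly z) h b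
      rw [← degree_eq_natDegree hp.ne_zero] at hd
      rw [padTo_of_length (length_elemBits _ _), padTo_of_length (length_elemBits _ _),
        elemPoly_elemBits (degree_modByMonic_lt_natDegree hp _),
        elemPoly_elemBits (degree_bit_lt hp b), ← hashStep,
        (modByMonic_eq_self_iff (monic_of_irreducible hp)).2 hd]
      rfl
    · exact forall_index (fun _ => rfl) (fun _ => rfl) (fun _ => rfl) (fun h => (h rfl).elim)
        (fun _ => rfl) (fun _ => rfl) fun _ _ => rfl
  obtain ⟨T, rfl⟩ := Nat.exists_eq_add_of_le hT
  rw [Nat.add_comm, Function.iterate_add_apply, Function.iterate_succ_apply,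
    Function.iterate_succ_apply, Function.iterate_succ_apply, Function.iterate_one, h1, h2, h3, h4]
  exact updStep_iterate_of_halted rfl T

theorem stream_append {p : (ZMod 2)[X]} {T : ℕ} (c : (machine M N L).Conf) (y : List Bool)
    (b : Bool) : (machine M N L).stream p T c (y ++ [b]) =
      ((machine M N L).updStep p)^[T] ((machine M N L).recv ((machine M N L).stream p T c y) b) := by
  simp [StreamMachine.stream]

theorem foldl_store (y : List Bool) :
    (y.foldl (store N) ⟨[], Nat.zero_le N⟩).1 = y.take N := by
  induction y using List.reverseRecOn with
  | nil => simp
  | append_singleton y b ih =>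
    rw [List.foldl_append, List.foldl_cons, List.foldl_nil, store]
    split_ifs with h
    · rw [ih, List.length_take] at h
      simp only [ih]
      rw [List.take_of_length_le (by omega), List.take_of_length_le (by simp; omega)]
    · rw [ih, List.length_take] at h
      rw [ih, List.take_append_of_le_length (by omega)]

/-- After the prefix `y` of the stream, the hash value of `y` is on its tape. -/
theorem exists_stream_eq {p : (ZMod 2)[X]} (hp : Irreducible p) {z : List Bool}
    (hz : z.length = p.natDegree) (a F : List Bool) {T : ℕ} (hT : 4 ≤ T) (y : List Bool) :
    ∃ g s, (machine M N L).stream p T (Cfg.ofTapes (⟨[], Nat.zero_le N⟩, .sim M.start 0)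
        (tapes (.ofList a) (.ofList F) (.ofList z) (.ofList []) (.ofList []) (.ofList []))) y =
      Cfg.ofTapes (y.foldl (store N) ⟨[], Nat.zero_le N⟩, .sim M.start 0)
        (tapes (.ofList a) (.ofList F) (.ofList z) (.ofList g) (.ofList []) (.ofList s)) ∧
      elemPoly (padTo p.natDegree g) = hashPoly p (elemPoly z) y ∧
      (1 ≤ y.length → g = elemBits p.natDegree (hashPoly p (elemPoly z) y)) := by
  induction y using List.reverseRecOn with
  | nil => exact ⟨[], [], rfl, elemPoly_padTo_nil _, fun h => by simp at h⟩
  | append_singleton y b ih =>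
    obtain ⟨g, s, h, hg, -⟩ := ih
    refine ⟨elemBits p.natDegree (hashPoly p (elemPoly z) (y ++ [b])),
      elemBits p.natDegree (if b then 1 else 0), ?_, ?_, fun _ => rfl⟩
    · rw [stream_append, h, updStep_iterate hp hz hg _ _ _ _ _ hT, hashPoly_append,
        List.foldl_append]
      rfl
    · rw [padTo_of_length (length_elemBits _ _), elemPoly_elemBits]
      rw [hashPoly_append]
      exact degree_hashStep_lt hp _ _ _

/-! ### The memory -/

/-- All heads are on cell `0`, and all strings have length at most `S`. The processing of the stream
preserves this property, since it does not move any head. -/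
def IsTidy {Q ι : Type} (S : ℕ) (c : Cfg Q ι) : Prop :=
  ∃ q σ, c = Cfg.ofStrings q σ ∧ ∀ i, (σ i).length ≤ S

theorem IsTidy.fitsIn {Q ι : Type} {S : ℕ} {c : Cfg Q ι} (h : IsTidy S c) : c.FitsIn S := by
  obtain ⟨q, σ, rfl, hσ⟩ := h
  rw [Cfg.ofStrings_eq_ofTapes]
  exact Cfg.fitsIn_ofTapes fun i => ⟨σ i, rfl, hσ i⟩

theorem IsTidy.with_state {Q ι : Type} {S : ℕ} {c : Cfg Q ι} (h : IsTidy S c) (q : Q) :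
    IsTidy S { c with state := q } := by
  obtain ⟨q', σ, rfl, hσ⟩ := h
  exact ⟨q, σ, rfl, hσ⟩

theorem IsTidy.put {Q ι : Type} {S : ℕ} {c : Cfg Q ι} (h : IsTidy S c) (i : ι) {s : List Bool}
    (hs : s.length ≤ S) : IsTidy S (c.put i s) := by
  classical
  obtain ⟨q, σ, rfl, hσ⟩ := h
  refine ⟨q, Function.update σ i s, ?_, fun j => ?_⟩
  · rw [Cfg.ofStrings_eq_ofTapes, Cfg.ofStrings_eq_ofTapes]
    exact Cfg.put_ofTapes (by simp) fun j hj => by simp [hj]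
  · by_cases hj : j = i
    · subst hj
      simpa using hs
    · simpa [hj] using hσ j

theorem isTidy_ofTapes {Q W : Type} {S : ℕ} {q : Q} {a F z g s e : List Bool} (ha : a.length ≤ S)
    (hF : F.length ≤ S) (hz : z.length ≤ S) (hg : g.length ≤ S) (hs : s.length ≤ S)
    (he : e.length ≤ S) : IsTidy S (Cfg.ofTapes q (tapes (W := W) (.ofList a) (.ofList F)
      (.ofList z) (.ofList g) (.ofList s) (.ofList e))) := by
  refine ⟨q, fam a F z g s e fun _ => [], ?_, forall_index ha hF hz hg hs he
    fun _ => Nat.zero_le _⟩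
  rw [Cfg.ofStrings_eq_ofTapes]
  exact congrArg _ (funext (forall_index rfl rfl rfl rfl rfl rfl fun _ => rfl))

theorem IsTidy.updStep {p : (ZMod 2)[X]} {S : ℕ} (hS : p.natDegree ≤ S) (hS' : 1 ≤ S)
    {c : (machine M N L).Conf} (h : IsTidy S c) : IsTidy S ((machine M N L).updStep p c) := by
  rw [StreamMachine.updStep]
  split
  · exact h
  · next i hi =>
    have hb : ∀ g, (elemBits p.natDegree g).length ≤ S := fun g => by simpa using hS
    obtain ⟨q, σ, rfl, hσ⟩ := h
    obtain ⟨l, q⟩ := q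
    cases q with
    | start => cases hi
    | draw => cases hi
    | rewind => cases hi
    | sim => cases hi
    | conv =>
      cases hi
      exact ((IsTidy.put ⟨_, _, rfl, hσ⟩ _ (s := []) (Nat.zero_le S)).put _ (hb _)).with_state _
    | mul =>
      cases hi
      exact (IsTidy.put ⟨_, _, rfl, hσ⟩ _ (hb _)).with_state _
    | add =>
      cases hi
      exact (IsTidy.put ⟨_, _, rfl, hσ⟩ _ (hb _)).with_state _
    | write b =>
      cases hi
      have ht : (Tape.ofList (σ (Sum.inr (Sum.inl 2)))).step (some b, .stay) =
          .ofList (b :: (σ (Sum.inr (Sum.inl 2))).tail) := by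
        cases σ (Sum.inr (Sum.inl 2)) <;> simp
      refine ⟨(l, .conv), fam (σ (Sum.inl 0)) (σ (Sum.inl 1)) (σ (Sum.inr (Sum.inl 0)))
        (σ (Sum.inr (Sum.inl 1))) (b :: (σ (Sum.inr (Sum.inl 2))).tail)
        (σ (Sum.inr (Sum.inl 3))) fun w => σ (Sum.inr (Sum.inr w)), ?_,
        forall_index (hσ _) (hσ _) (hσ _) (hσ _) ?_ (hσ _) fun _ => hσ _⟩
      · rw [Cfg.ofStrings_eq_ofTapes, Cfg.ofStrings_eq_ofTapes]
        exact Instr.exec_act_ofTapes rfl (forall_index (Tape.step_read_stay _)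
          (Tape.step_read_stay _) (Tape.step_read_stay _) (Tape.step_read_stay _) ht
          (Tape.step_read_stay _) fun _ => Tape.step_read_stay _)
      · have := hσ (Sum.inr (Sum.inl 2))
        simp only [fam, Sum.elim_inr, Sum.elim_inl, Matrix.cons_val, List.length_cons,
          List.length_tail]
        omega

theorem IsTidy.updStep_iterate {p : (ZMod 2)[X]} {S : ℕ} (hS : p.natDegree ≤ S) (hS' : 1 ≤ S)
    {c : (machine M N L).Conf} (h : IsTidy S c) (T : ℕ) :
    IsTidy S (((machine M N L).updStep p)^[T] c) := by
  induction T with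
  | zero => exact h
  | succ T ih =>
    rw [Function.iterate_succ_apply']
    exact ih.updStep hS hS'

theorem IsTidy.stream {p : (ZMod 2)[X]} {S : ℕ} (hS : p.natDegree ≤ S) (hS' : 1 ≤ S)
    {c : (machine M N L).Conf} (h : IsTidy S c) (T : ℕ) (y : List Bool) :
    IsTidy S ((machine M N L).stream p T c y) := by
  induction y using List.reverseRecOn with
  | nil => exact h
  | append_singleton y b ih =>
    rw [stream_append]
    exact (ih.with_state _).updStep_iterate hS hS' T

end

end HashStream

/-! ### The simulation of the probabilistic machine -/

namespace HashStream

theorem tapeOf_interleave {a b c : List Bool} (hb : b.length = a.length)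
    (hc : c.length = a.length) (t : Fin 3) (i : ℤ) :
    Cfg.tapeOf (interleave a b c) (3 * i + (t : ℕ)) = Cfg.tapeOf (![a, b, c] t) i := by
  rcases lt_or_ge i 0 with hi | hi
  · rw [Tape.tapeOf_neg _ hi, Tape.tapeOf_neg _ (by omega)]
  · obtain ⟨i, rfl⟩ := Int.eq_ofNat_of_zero_le hi
    rw [show (3 * (i : ℤ) + (t : ℕ)) = ((3 * i + (t : ℕ) : ℕ) : ℤ) by push_cast; rfl,
      Tape.tapeOf_natCast, Tape.tapeOf_natCast]
    clear hi
    induction a generalizing b c i with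
    | nil =>
      obtain rfl := List.eq_nil_of_length_eq_zero hb
      obtain rfl := List.eq_nil_of_length_eq_zero hc
      fin_cases t <;> simp [interleave]
    | cons x a ih =>
      obtain ⟨y, b, rfl⟩ := List.exists_cons_of_length_eq_add_one hb
      obtain ⟨z, c, rfl⟩ := List.exists_cons_of_length_eq_add_one hc
      cases i with
      | zero => fin_cases t <;> simp [interleave]
      | succ i =>
        have := ih (b := b) (c := c) (by simpa using hb) (by simpa using hc) i
        rw [show 3 * (i + 1) + (t : ℕ) = 3 * i + t + 3 by ring]
        fin_cases t <;> simpa [interleave] using this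

section

variable {M : PTM} {N : ℕ}

/-- The configuration `c` of the probabilistic machine is represented by the configuration `c'` of
the streaming algorithm. -/
structure Simulates (l : {l : List Bool // l.length ≤ N}) (c : Cfg M.State (Option M.Work))
    (c' : Cfg (State M N) (Fin 2 ⊕ (Fin 4 ⊕ M.Work))) (j : Fin 3) : Prop where
  state : c'.state = (l, .sim c.state j)
  head (t : Fin 3) : c.head none = 3 * c'.head (track t) + (j : ℕ)
  cell (t : Fin 3) (i : ℤ) : c.cell none (3 * i + (t : ℕ)) = c'.cell (track t) i
  work_head (w : M.Work) : c'.head (Sum.inr (Sum.inr w)) = c.head (some w)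
  work_cell (w : M.Work) : c'.cell (Sum.inr (Sum.inr w)) = c.cell (some w)

theorem fam_track {W α : Type} (w : Fin 3 → α) (f s e : α) (w' : W → α) (t : Fin 3) :
    fam (w 0) f (w 1) (w 2) s e w' (track t) = w t := by
  fin_cases t <;> rfl

variable {l : {l : List Bool // l.length ≤ N}} {c : Cfg M.State (Option M.Work)}
  {c' : Cfg (State M N) (Fin 2 ⊕ (Fin 4 ⊕ M.Work))} {j : Fin 3}

theorem Simulates.scan (h : Simulates l c c' j) :
    (fun i : Option M.Work => i.elim (c'.scan (track j)) fun w => c'.scan (Sum.inr (Sum.inr w))) =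
      c.scan := by
  funext i
  cases i with
  | none => simp only [Option.elim, Cfg.scan, h.head j, h.cell]
  | some w => simp only [Option.elim, Cfg.scan, h.work_head, h.work_cell]

theorem Simulates.halted (h : Simulates l c c' j) (hc : M.next.Halted c) :
    (postRule M N).Halted c' := by
  rw [CoinRule.Halted, h.state, postRule, h.scan, hc]
  rfl

theorem Simulates.step (h : Simulates l c c' j) (b : Bool) :
    ∃ j', Simulates l (M.next.step c b) ((postRule M N).step c' b) j' := by
  cases hn : M.next c.state c.scan with
  | none =>
    have h₁ : M.next.step c b = c := by rw [CoinRule.step, hn]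
    have h₂ : (postRule M N).step c' b = c' := by
      have : (postRule M N) c'.state c'.scan = none := h.halted hn
      rw [CoinRule.step, this]
    exact ⟨j, h₁.symm ▸ h₂.symm ▸ h⟩
  | some a =>
    have h₁ : M.next.step c b = c.apply (a b) := by rw [CoinRule.step, hn]
    obtain ⟨A, hA, hA₁, hAt, hAw⟩ : ∃ A : Act (State M N) (Fin 2 ⊕ (Fin 4 ⊕ M.Work)),
        (postRule M N).step c' b = c'.apply A ∧
        A.1 = (l, .sim (a b).1 (nextTrack ((a b).2 none).2 j)) ∧
        (∀ t, A.2 (track t) = (if t = j then ((a b).2 none).1 else c'.scan (track t),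
          trackMove ((a b).2 none).2 j)) ∧
        ∀ w, A.2 (Sum.inr (Sum.inr w)) = (a b).2 (some w) := by
      have h₂ := h.state
      rw [CoinRule.step, h₂, postRule, h.scan, hn]
      exact ⟨_, rfl, rfl, fun t => fam_track (fun t : Fin 3 =>
        (if t = j then ((a b).2 none).1 else c'.scan (track t), trackMove ((a b).2 none).2 j))
        _ _ _ _ t, fun _ => rfl⟩
    refine ⟨nextTrack ((a b).2 none).2 j, ?_⟩
    rw [h₁, hA]
    refine ⟨hA₁, fun t => ?_, fun t i => ?_, fun w => ?_, fun w => ?_⟩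
    · simp only [Cfg.apply, hAt, h.head t]
      cases ((a b).2 none).2 <;> fin_cases j <;>
        simp [nextTrack, trackMove, Move.toInt] <;> ring
    · simp only [Cfg.apply, hAt]
      have hj := h.head j
      by_cases htj : t = j
      · subst htj
        rw [if_pos rfl]
        by_cases hi : i = c'.head (track t)
        · subst hi
          rw [← hj, Function.update_self, Function.update_self]
        · rw [Function.update_of_ne hi, Function.update_of_ne (by omega), h.cell]
      · have htj' : (t : ℕ) ≠ j := fun he => htj (Fin.ext he)
        have := t.isLt
        have := j.isLt
        rw [if_neg htj, Cfg.scan, Function.update_eq_self, Function.update_of_ne, h.cell]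
        have := h.head t
        omega
    · simp only [Cfg.apply, hAw, h.work_head]
    · simp only [Cfg.apply, hAw, h.work_head, h.work_cell]

theorem Simulates.run (h : Simulates l c c' j) (ω : List Bool) :
    ∃ j', Simulates l (M.next.run c ω) ((postRule M N).run c' ω) j' := by
  induction ω generalizing c c' j with
  | nil => exact ⟨j, h⟩
  | cons b ω ih =>
    obtain ⟨j', h'⟩ := h.step b
    exact ih h'

theorem simulates_initial {a z g : List Bool} (hz : z.length = a.length)
    (hg : g.length = a.length) (F s e : List Bool) :
    Simulates l (Cfg.ofStrings M.start fun i : Option M.Work => i.elim (interleave a z g) fun _ => [])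
      (Cfg.ofTapes (l, .sim M.start 0) (tapes (.ofList a) (.ofList F) (.ofList z) (.ofList g)
        (.ofList s) (.ofList e))) 0 := by
  refine ⟨rfl, fun t => ?_, fun t i => ?_, fun w => rfl, fun w => rfl⟩
  · fin_cases t <;> rfl
  · refine (tapeOf_interleave hz hg t i).trans ?_
    fin_cases t <;> rfl

end

end HashStream

/-! ### Correctness of the streaming algorithm -/

namespace HashStream

section

variable {M : PTM} {N : ℕ} {L : Language Bool} {p : (ZMod 2)[X]}

theorem halted_pre (l : {l : List Bool // l.length ≤ N}) (q : M.State) (j : Fin 3)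
    (τ : Fin 2 ⊕ (Fin 4 ⊕ M.Work) → Tape) :
    (preRule M N).Halted (Cfg.ofTapes (l, .sim q j) τ) := rfl

theorem preRun_eq {n : ℕ} (hn : n.bits.length ≤ p.natDegree) {ω : List Bool}
    (hω : 2 * p.natDegree + 3 ≤ ω.length) :
    (machine M N L).preRun p n ω = Cfg.ofTapes (⟨[], Nat.zero_le N⟩, .sim M.start 0)
      (tapes (.ofList (padTo p.natDegree n.bits)) (.ofList (fieldRep p))
        (.ofList ((ω.drop 1).take p.natDegree)) (.ofList []) (.ofList []) (.ofList [])) := by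
  obtain ⟨b, ω, rfl⟩ : ∃ b ω', ω = b :: ω' :=
    List.exists_cons_of_length_pos (by omega)
  set k := p.natDegree with hk
  obtain ⟨b', rest, hb'⟩ : ∃ b' rest, ω.drop k = b' :: rest :=
    List.exists_cons_of_length_pos (by simp at hω ⊢; omega)
  have hl : rest.length = ω.length - k - 1 := by
    have := congrArg List.length hb'
    simp at this
    omega
  simp only [List.length_cons] at hω
  obtain ⟨b'', rest', hb''⟩ : ∃ b'' rest', rest.drop k = b'' :: rest' :=
    List.exists_cons_of_length_pos (by simp; omega)
  have hd : b :: ω = (b :: (ω.take k ++ b' :: (rest.take k ++ [b'']))) ++ rest' := by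
    conv_lhs => rw [← List.take_append_drop k ω, hb', ← List.take_append_drop k rest, hb'']
    simp
  have hc : (ω.take k).length = k := by simp; omega
  have hrun := run_pre (M := M) (N := N) (l := ⟨[], Nat.zero_le N⟩) n.bits (fieldRep p) (ω.take k)
    (rest.take k) b b' b'' (by rw [hc]; simp [fieldRep, hk]) (by rw [hc]; exact hn)
    (by simp; omega)
  rw [hc] at hrun
  rw [StreamMachine.preRun, ofStrings_eq_tapes, hd, CoinRule.run_append]
  refine (congrArg (fun c => (preRule M N).run c rest') hrun).trans ?_
  rw [CoinRule.run_of_halted (halted_pre _ _ _ _), ← hd]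
  rfl

/-- The input of the simulated machine for the key consisting of the coins number `1, …, k`. -/
noncomputable def simInput (p : (ZMod 2)[X]) (x ω : List Bool) : List Bool :=
  hashCode p x.length ((ω.drop 1).take p.natDegree)
    (hashPoly p (elemPoly ((ω.drop 1).take p.natDegree)) x)

/-- After the stream, `M` is simulated on the code of the length, the key and the hash value of the
stream. -/
theorem exists_simulates_fullRun (hp : Irreducible p) {x : List Bool} (hx : 1 ≤ x.length)
    (hn : x.length.bits.length ≤ p.natDegree) {ω : List Bool}
    (hω : 2 * p.natDegree + 3 ≤ ω.length) {T : ℕ} (hT : 4 ≤ T) (ω' : List Bool) :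
    ∃ j, Simulates (x.foldl (store N) ⟨[], Nat.zero_le N⟩)
      (M.next.run (Cfg.ofStrings M.start fun i => i.elim (simInput p x ω) fun _ => []) ω')
      ((machine M N L).fullRun p x T ω ω') j := by
  have hz : ((ω.drop 1).take p.natDegree).length = p.natDegree := by simp; omega
  obtain ⟨g, s, h, -, hg⟩ := exists_stream_eq (M := M) (N := N) (L := L) hp hz
    (padTo p.natDegree x.length.bits) (fieldRep p) hT x
  rw [StreamMachine.fullRun, preRun_eq hn hω, h, hg hx, simInput, hashCode, ← padTo_eq hn]
  exact Simulates.run (simulates_initial (by simp; omega) (by simp) _ _ _) ω'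

theorem fullRun_accept_iff (hp : Irreducible p) {x : List Bool} (hx : 1 ≤ x.length)
    (hn : x.length.bits.length ≤ p.natDegree) {ω : List Bool}
    (hω : 2 * p.natDegree + 3 ≤ ω.length) {T : ℕ} (hT : 4 ≤ T) (ω' : List Bool) :
    ((machine M N L).fullRun p x T ω ω').state ∈ (machine M N L).accept ↔
      (x.length < N ∧ x ∈ L) ∨ (¬ x.length < N ∧
        (M.next.run (Cfg.ofStrings M.start fun i => i.elim (simInput p x ω) fun _ => [])
          ω').state ∈ M.accept) := by
  obtain ⟨j, h⟩ := exists_simulates_fullRun (M := M) (N := N) (L := L) hp hx hn hω hT ω'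
  have hl : (x.take N).length < N ↔ x.length < N := by simp
  have hstate := h.state
  rw [hstate]
  simp only [Set.mem_ofPred_eq, foldl_store, hl]
  refine or_congr (and_congr_right fun hN => ?_) (and_congr_right fun _ => ?_)
  · rw [List.take_of_length_le hN.le]
  · constructor
    · rintro ⟨q, hq, j', hj⟩
      cases hj
      exact hq
    · exact fun hq => ⟨_, hq, j, rfl⟩

theorem runsWithin (hp : Irreducible p) {x : List Bool} (hx : 1 ≤ x.length)
    (hn : x.length.bits.length ≤ p.natDegree) {T₁ S T T₂ : ℕ} (hT₁ : 2 * p.natDegree + 3 ≤ T₁)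
    (hS : 3 * p.natDegree + 4 ≤ S) (hT : 4 ≤ T)
    (hM : ∀ a : List Bool, a.length = 3 * p.natDegree → ∀ ω : Fin T₂ → Bool,
      M.next.Halted (M.run a ω)) :
    (machine M N L).RunsWithin p x T₁ S T T₂ := by
  have hinit : ∀ ω : List Bool, 2 * p.natDegree + 3 ≤ ω.length →
      IsTidy (p.natDegree + 1) ((machine M N L).preRun p x.length ω) := fun ω hω => by
    rw [preRun_eq hn hω]
    refine isTidy_ofTapes ?_ ?_ ?_ ?_ ?_ ?_ <;> simp [fieldRep]
  refine ⟨fun ω => ?_, fun ω j => ?_, fun ω y b hy => ?_, fun ω y b hy j hj => ?_, fun ω ω' => ?_⟩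
  · rw [preRun_eq hn (by simpa using hT₁)]
    rfl
  · rcases le_or_gt (2 * p.natDegree + 3) ((List.ofFn ω).take j).length with h | h
    · exact (hinit _ h).fitsIn.mono (by omega)
    · have h0 : IsTidy (p.natDegree + 1) (Cfg.ofStrings (machine M N L).start
          (Sum.elim ![x.length.bits, fieldRep p] fun _ : Fin 4 ⊕ M.Work => [])) := by
        rw [ofStrings_eq_tapes]
        exact isTidy_ofTapes (by omega) (by simp [fieldRep]) (Nat.zero_le _) (Nat.zero_le _)
          (Nat.zero_le _) (Nat.zero_le _)
      exact (h0.fitsIn.run _).mono (by omega)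
  · have hω : 2 * p.natDegree + 3 ≤ (List.ofFn ω).length := by simpa using hT₁
    obtain ⟨g, s, h, -⟩ := exists_stream_eq (M := M) (N := N) (L := L) hp
      (z := ((List.ofFn ω).drop 1).take p.natDegree)
      (by rw [List.length_take, List.length_drop]; omega)
      (padTo p.natDegree x.length.bits) (fieldRep p) hT (y ++ [b])
    rw [preRun_eq hn hω, h]
    rfl
  · have hω : 2 * p.natDegree + 3 ≤ (List.ofFn ω).length := by simpa using hT₁
    have h1 := ((hinit _ hω).stream (M := M) (N := N) (L := L) (Nat.le_succ _) (by omega) T y)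
    exact ((h1.with_state _).updStep_iterate (Nat.le_succ _) (by omega) j).fitsIn.mono (by omega)
  · have hω : 2 * p.natDegree + 3 ≤ (List.ofFn ω).length := by simpa using hT₁
    obtain ⟨j, h⟩ := exists_simulates_fullRun (M := M) (N := N) (L := L) hp hx hn hω hT
      (List.ofFn ω')
    refine h.halted (hM _ ?_ ω')
    exact length_hashCode hn (by rw [List.length_take, List.length_drop]; omega)

end

end HashStream

/-! ### Uniform probabilities -/

section

variable {Ω Ω' : Type} [Fintype Ω] [Fintype Ω']

theorem uniformProb_nonneg (E : Set Ω) : 0 ≤ uniformProb E := by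
  unfold uniformProb
  positivity

theorem uniformProb_empty : uniformProb (∅ : Set Ω) = 0 := by
  simp [uniformProb]

theorem uniformProb_univ [Nonempty Ω] : uniformProb (Set.univ : Set Ω) = 1 := by
  rw [uniformProb, Set.ncard_univ, Nat.card_eq_fintype_card]
  exact div_self (by exact_mod_cast Fintype.card_ne_zero)

theorem uniformProb_preimage_equiv (e : Ω ≃ Ω') (E : Set Ω') :
    uniformProb (e ⁻¹' E) = uniformProb E := by
  rw [uniformProb, uniformProb, Fintype.card_congr e,
    Set.ncard_preimage_of_injective_subset_range e.injective (by simp)]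

theorem uniformProb_preimage_fst [Nonempty Ω'] (E : Set Ω) :
    uniformProb (Prod.fst ⁻¹' E : Set (Ω × Ω')) = uniformProb E := by
  have h : (Prod.fst ⁻¹' E : Set (Ω × Ω')) = E ×ˢ Set.univ := by ext; simp
  have hne : (Fintype.card Ω' : ℝ) ≠ 0 := by exact_mod_cast Fintype.card_ne_zero
  rw [uniformProb, uniformProb, h, Set.ncard_prod, Set.ncard_univ, Nat.card_eq_fintype_card,
    Fintype.card_prod]
  push_cast
  exact mul_div_mul_right _ _ hne

/-- The coins of an event that depends only on some of the coins. -/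
theorem uniformProb_preimage_comp {a b : ℕ} {i : Fin a → Fin b} (hi : i.Injective)
    (E : Set (Fin a → Bool)) :
    uniformProb {ω : Fin b → Bool | ω ∘ i ∈ E} = uniformProb E := by
  classical
  let e : Fin a ⊕ ((Set.range i)ᶜ : Set (Fin b)) ≃ Fin b :=
    (Equiv.sumCongr (Equiv.ofInjective i hi) (Equiv.refl _)).trans (Equiv.Set.sumCompl _)
  let e' : (Fin b → Bool) ≃ (Fin a → Bool) × (((Set.range i)ᶜ : Set (Fin b)) → Bool) :=
    (Equiv.arrowCongr e.symm (Equiv.refl Bool)).trans (Equiv.sumArrowEquivProdArrow _ _ _)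
  have h : {ω : Fin b → Bool | ω ∘ i ∈ E} = e' ⁻¹' (Prod.fst ⁻¹' E) := by
    ext ω
    rfl
  rw [h, uniformProb_preimage_equiv, uniformProb_preimage_fst]

theorem ncard_eq_sum_slices (E : Set (Ω × Ω')) :
    E.ncard = ∑ ω, {ω' | (ω, ω') ∈ E}.ncard := by
  classical
  simp only [Set.ncard_eq_toFinset_card']
  rw [← Finset.card_sigma]
  refine Finset.card_bij' (fun x _ => ⟨x.1, x.2⟩) (fun x _ => (x.1, x.2)) ?_ ?_ ?_ ?_ <;> simp

/-- The probability of an event is the average of the probabilities of its slices. -/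
theorem uniformProb_mul_card [Nonempty Ω'] (E : Set (Ω × Ω')) :
    uniformProb E * Fintype.card Ω = ∑ ω, uniformProb {ω' | (ω, ω') ∈ E} := by
  have hne : (Fintype.card Ω' : ℝ) ≠ 0 := by exact_mod_cast Fintype.card_ne_zero
  simp only [uniformProb]
  rw [← Finset.sum_div, ncard_eq_sum_slices, Fintype.card_prod]
  push_cast
  rcases isEmpty_or_nonempty Ω with h | h
  · simp
  · have hne' : (Fintype.card Ω : ℝ) ≠ 0 := by exact_mod_cast Fintype.card_ne_zero
    field_simp

theorem le_uniformProb_of_slices [Nonempty Ω] [Nonempty Ω'] {E : Set (Ω × Ω')} {r : ℝ}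
    (h : ∀ ω, r ≤ uniformProb {ω' | (ω, ω') ∈ E}) : r ≤ uniformProb E := by
  have hpos : (0 : ℝ) < Fintype.card Ω := by exact_mod_cast Fintype.card_pos
  refine le_of_mul_le_mul_right ?_ hpos
  rw [uniformProb_mul_card, mul_comm, ← nsmul_eq_mul]
  exact Finset.card_nsmul_le_sum _ _ _ fun ω _ => h ω

theorem uniformProb_le_one [Nonempty Ω] (E : Set Ω) : uniformProb E ≤ 1 := by
  rw [uniformProb, div_le_one (by exact_mod_cast Fintype.card_pos), ← Nat.card_eq_fintype_card,
    ← Set.ncard_univ]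
  exact_mod_cast Set.ncard_le_ncard (Set.subset_univ E) (Set.toFinite _)

theorem uniformProb_le_of_slices [Nonempty Ω] [Nonempty Ω'] {E : Set (Ω × Ω')} {B : Set Ω} {r : ℝ}
    (hr : 0 ≤ r) (h : ∀ ω, ω ∉ B → uniformProb {ω' | (ω, ω') ∈ E} ≤ r) :
    uniformProb E ≤ r + uniformProb B := by
  classical
  have hpos : (0 : ℝ) < Fintype.card Ω := by exact_mod_cast Fintype.card_pos
  refine le_of_mul_le_mul_right ?_ hpos
  have hB : uniformProb B * Fintype.card Ω = ∑ ω, if ω ∈ B then (1 : ℝ) else 0 := by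
    rw [uniformProb, div_mul_cancel₀ _ hpos.ne', Finset.sum_boole, Set.ncard_eq_toFinset_card']
    congr 2
    ext
    simp
  have hr' : r * Fintype.card Ω = ∑ _ω : Ω, r := by
    rw [Finset.sum_const, nsmul_eq_mul, mul_comm]
    rfl
  rw [uniformProb_mul_card, add_mul, hB, hr', ← Finset.sum_add_distrib]
  refine Finset.sum_le_sum fun ω _ => ?_
  split_ifs with hω
  · exact (uniformProb_le_one _).trans (by linarith)
  · simpa using h ω hω

end

/-- Coins after the first `T` ones are irrelevant for events on these. -/
theorem uniformProb_take {T T' : ℕ} (h : T ≤ T') (P : List Bool → Prop) :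
    uniformProb {ω : Fin T' → Bool | P ((List.ofFn ω).take T)} =
      uniformProb {ω : Fin T → Bool | P (List.ofFn ω)} := by
  rw [← uniformProb_preimage_comp (Fin.castLE_injective h) {ω : Fin T → Bool | P (List.ofFn ω)}]
  congr 1
  ext ω
  have : (List.ofFn ω).take T = List.ofFn (ω ∘ Fin.castLE h) := by
    refine List.ext_getElem (by simpa using h) fun i h₁ h₂ => ?_
    simp
  simp only [Set.mem_ofPred_eq, this]

theorem uniformProb_drop_take {k T : ℕ} (h : k + 1 ≤ T) (P : List Bool → Prop) :
    uniformProb {ω : Fin T → Bool | P (((List.ofFn ω).drop 1).take k)} =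
      uniformProb {z : Fin k → Bool | P (List.ofFn z)} := by
  have hi : Function.Injective fun j : Fin k => (⟨j + 1, by omega⟩ : Fin T) := fun a b hab => by
    simpa [Fin.ext_iff] using hab
  rw [← uniformProb_preimage_comp hi {z : Fin k → Bool | P (List.ofFn z)}]
  congr 1
  ext ω
  have : ((List.ofFn ω).drop 1).take k =
      List.ofFn (ω ∘ fun j : Fin k => (⟨j + 1, by omega⟩ : Fin T)) := by
    refine List.ext_getElem (by simp; omega) fun i h₁ h₂ => ?_
    simp
  simp only [Set.mem_ofPred_eq, this]

/-! ### Hash collisions -/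

theorem interleave_injective {a b c a' b' c' : List Bool} (hb : b.length = a.length)
    (hc : c.length = a.length) (ha' : a'.length = a.length) (hb' : b'.length = a.length)
    (hc' : c'.length = a.length) (h : interleave a b c = interleave a' b' c') :
    a = a' ∧ b = b' ∧ c = c' := by
  induction a generalizing b c a' b' c' with
  | nil =>
    obtain rfl := List.eq_nil_of_length_eq_zero hb
    obtain rfl := List.eq_nil_of_length_eq_zero hc
    obtain rfl := List.eq_nil_of_length_eq_zero ha'
    obtain rfl := List.eq_nil_of_length_eq_zero hb'
    obtain rfl := List.eq_nil_of_length_eq_zero hc'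
    exact ⟨rfl, rfl, rfl⟩
  | cons x a ih =>
    obtain ⟨y, b, rfl⟩ := List.exists_cons_of_length_eq_add_one hb
    obtain ⟨z, c, rfl⟩ := List.exists_cons_of_length_eq_add_one hc
    obtain ⟨x', a', rfl⟩ := List.exists_cons_of_length_eq_add_one ha'
    obtain ⟨y', b', rfl⟩ := List.exists_cons_of_length_eq_add_one hb'
    obtain ⟨z', c', rfl⟩ := List.exists_cons_of_length_eq_add_one hc'
    simp only [interleave, List.cons.injEq] at h
    obtain ⟨rfl, rfl, rfl, h⟩ := h
    obtain ⟨rfl, rfl, rfl⟩ := ih (by simpa using hb) (by simpa using hc) (by simpa using ha')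
      (by simpa using hb') (by simpa using hc') h
    exact ⟨rfl, rfl, rfl⟩

theorem degree_hashPoly_lt {p : (ZMod 2)[X]} (hp : Irreducible p) (Z : (ZMod 2)[X])
    (y : List Bool) : (hashPoly p Z y).degree < p.natDegree := by
  induction y using List.reverseRecOn with
  | nil => exact WithBot.bot_lt_coe _ |>.trans_eq' (by simp [hashPoly])
  | append_singleton y b _ =>
    rw [hashPoly_append]
    exact degree_hashStep_lt hp _ _ _

/-- If the code of a word outside `L` is the code of a word of `L`, then the key is bad. -/
theorem mem_badKeys {q : ℕ → (ZMod 2)[X]} (hq : ∀ n, Irreducible (q n)) {L : Language Bool}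
    {x : List Bool} (hx : x ∉ L) (hn : x.length.bits.length ≤ (q x.length).natDegree)
    (z : Fin (q x.length).natDegree → Bool)
    (h : hashCode (q x.length) x.length (List.ofFn z)
      (hashPoly (q x.length) (elemPoly (List.ofFn z)) x) ∈ hashLanguage q L) :
    z ∈ badKeys L (q x.length) (q x.length).natDegree x := by
  obtain ⟨y, hy, -, hny, z', hz', h⟩ := h
  have hlen := congrArg List.length h
  rw [length_hashCode hn (by simp), length_hashCode hny hz'] at hlen
  have hk : (q y.length).natDegree = (q x.length).natDegree := by omega
  obtain ⟨h₁, h₂, h₃⟩ := interleave_injective (by simp; omega) (by simp; omega)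
    (by simp; omega) (by simp; omega) (by simp; omega) h
  have hxy : x.length = y.length := by
    have := congrArg bitVal h₁
    rwa [bitVal_append_replicate, bitVal_append_replicate, bitVal_bits, bitVal_bits] at this
  refine ⟨y, hy, hxy.symm, fun hyx => hx (hyx ▸ hy), ?_⟩
  rw [← hxy, ← h₂] at h₃
  rw [← elemPoly_elemBits (degree_hashPoly_lt (hq x.length) _ x), h₃,
    elemPoly_elemBits (degree_hashPoly_lt (hq x.length) _ y)]

/-- For a word `x` of length `n`, at most a fraction `2 ^ (-v(n))` of the keys is bad. -/
theorem uniformProb_badKeys_le {f : ℕ → ℕ} {L : Language Bool} {p : (ZMod 2)[X]}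
    (hp : Irreducible p) {x : List Bool} (hk : p.natDegree = 2 * logSize f x.length + 2)
    (hL : {y : List Bool | y ∈ L ∧ y.length = x.length}.ncard ≤ f x.length) :
    uniformProb (badKeys L p p.natDegree x) ≤ (1 / 2) ^ logSize f x.length := by
  set v := logSize f x.length with hv
  have h₁ : f x.length * x.length ≤ 2 ^ (v + 2) := by
    have := Nat.mul_le_mul (Nat.lt_pow_succ_log_self one_lt_two (f x.length)).le
      (Nat.lt_pow_succ_log_self one_lt_two x.length).le
    refine this.trans_eq ?_
    rw [← pow_add, hv, logSize]
    congr 1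
    simp only [Nat.succ_eq_add_one]
    ring
  have h₂ : (badKeys L p p.natDegree x).ncard ≤ 2 ^ (v + 2) :=
    (ncard_badKeys_le L hp rfl x).trans ((Nat.mul_le_mul_right _ hL).trans h₁)
  have h₃ : ((badKeys L p p.natDegree x).ncard : ℝ) ≤ 2 ^ (v + 2) := by exact_mod_cast h₂
  have h₄ : (Fintype.card (Fin p.natDegree → Bool) : ℝ) = 2 ^ v * 2 ^ (v + 2) := by
    rw [Fintype.card_fun, Fintype.card_bool, Fintype.card_fin, hk, ← pow_add]
    push_cast
    ring
  rw [uniformProb, h₄, one_div, inv_pow, div_le_iff₀ (by positivity), ← mul_assoc,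
    inv_mul_cancel₀ (by positivity), one_mul]
  exact h₃

/-! ### The streaming algorithm for a sparse language -/

namespace HashStream

variable {M : PTM} {N : ℕ} {L : Language Bool} {p : (ZMod 2)[X]}

/-- Coins after the last step do not change the acceptance probability. -/
theorem uniformProb_run_of_halted {a : List Bool} {T T' : ℕ} (h : T ≤ T')
    (hM : ∀ ω : Fin T → Bool, M.next.Halted (M.run a ω)) :
    (∀ ω : Fin T' → Bool, M.next.Halted (M.run a ω)) ∧
    uniformProb {ω : Fin T' → Bool | (M.run a ω).state ∈ M.accept} =
      uniformProb {ω : Fin T → Bool | (M.run a ω).state ∈ M.accept} := by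
  have key : ∀ ω : Fin T' → Bool, ∃ ω' : Fin T → Bool,
      (List.ofFn ω).take T = List.ofFn ω' ∧ M.run a ω = M.run a ω' := fun ω => by
    have hl : ((List.ofFn ω).take T).length = T := by simpa using h
    obtain ⟨ω', hω'⟩ : ∃ ω' : Fin T → Bool, (List.ofFn ω).take T = List.ofFn ω' :=
      ⟨fun i => ((List.ofFn ω).take T)[i]'(by omega), by
        refine List.ext_getElem (by simpa using h) fun i h₁ h₂ => ?_
        simp⟩
    refine ⟨ω', hω', ?_⟩
    rw [PTM.run, ← List.take_append_drop T (List.ofFn ω), CoinRule.run_append, hω']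
    exact CoinRule.run_of_halted (hM ω') _
  refine ⟨fun ω => ?_, ?_⟩
  · obtain ⟨ω', -, h'⟩ := key ω
    rw [h']
    exact hM ω'
  · refine Eq.trans ?_ (uniformProb_take h fun ω => (M.next.run (Cfg.ofStrings M.start
      fun i => i.elim a fun _ => []) ω).state ∈ M.accept)
    congr 1
    ext ω
    obtain ⟨ω', h₁, h₂⟩ := key ω
    simp only [Set.mem_ofPred_eq, h₁, h₂]
    rfl

theorem acceptProb_of_short (hp : Irreducible p) {x : List Bool} (hx : 1 ≤ x.length)
    (hn : x.length.bits.length ≤ p.natDegree) {T₁ T T₂ : ℕ} (hT₁ : 2 * p.natDegree + 3 ≤ T₁)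
    (hT : 4 ≤ T) (hN : x.length < N) :
    (x ∈ L → (machine M N L).acceptProb p x T₁ T T₂ = 1) ∧
      (x ∉ L → (machine M N L).acceptProb p x T₁ T T₂ = 0) := by
  have h : ∀ ω : (Fin T₁ → Bool) × (Fin T₂ → Bool),
      ((machine M N L).fullRun p x T (List.ofFn ω.1) (List.ofFn ω.2)).state ∈
        (machine M N L).accept ↔ x ∈ L := fun ω => by
    rw [fullRun_accept_iff hp hx hn (by simpa using hT₁) hT]
    simp [hN]
  constructor
  · intro hxL
    refine Eq.trans ?_ (uniformProb_univ (Ω := (Fin T₁ → Bool) × (Fin T₂ → Bool)))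
    rw [StreamMachine.acceptProb]
    congr 1
    ext ω
    simpa using (h ω).2 hxL
  · intro hxL
    refine Eq.trans ?_ (uniformProb_empty (Ω := (Fin T₁ → Bool) × (Fin T₂ → Bool)))
    rw [StreamMachine.acceptProb]
    congr 1
    ext ω
    simpa using (h ω).not.2 hxL

/-- When the coins before the stream are fixed, the algorithm accepts with the probability with which
`M` accepts the code of length, key and hash value. -/
theorem uniformProb_slice (hp : Irreducible p) {x : List Bool} (hx : 1 ≤ x.length)
    (hn : x.length.bits.length ≤ p.natDegree) {T₁ T T₂ : ℕ} (hT₁ : 2 * p.natDegree + 3 ≤ T₁)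
    (hT : 4 ≤ T) (hN : ¬ x.length < N) (ω : Fin T₁ → Bool) :
    uniformProb {ω' : Fin T₂ → Bool | (ω, ω') ∈ {ω : (Fin T₁ → Bool) × (Fin T₂ → Bool) |
      ((machine M N L).fullRun p x T (List.ofFn ω.1) (List.ofFn ω.2)).state ∈
        (machine M N L).accept}} =
    uniformProb {ω' : Fin T₂ → Bool |
      (M.run (simInput p x (List.ofFn ω)) ω').state ∈ M.accept} := by
  congr 1
  ext ω'
  refine (fullRun_accept_iff hp hx hn (by simpa using hT₁) hT _).trans ?_
  simp only [hN, not_false_eq_true, false_and, true_and, false_or]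
  rfl

/-- For `x ∉ L`, the code is in the language of hash values only if the key is bad; otherwise the
error is at most that of the machine `M`. -/
theorem acceptProb_le {M : PTM} {N : ℕ} {L : Language Bool} {q : ℕ → (ZMod 2)[X]}
    (hq : ∀ n, Irreducible (q n)) {x : List Bool} (hx : 1 ≤ x.length)
    (hn : x.length.bits.length ≤ (q x.length).natDegree) {T₁ T T₂ : ℕ}
    (hT₁ : 2 * (q x.length).natDegree + 3 ≤ T₁) (hT : 4 ≤ T) (hN : ¬ x.length < N) (hxL : x ∉ L)
    {ε : ℝ} (hε : 0 ≤ ε)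
    (hM : ∀ a : List Bool, a.length = 3 * (q x.length).natDegree → a ∉ hashLanguage q L →
      uniformProb {ω : Fin T₂ → Bool | (M.run a ω).state ∈ M.accept} ≤ ε) :
    (machine M N L).acceptProb (q x.length) x T₁ T T₂ ≤
      ε + uniformProb (badKeys L (q x.length) (q x.length).natDegree x) := by
  have hB := uniformProb_drop_take (T := T₁) (k := (q x.length).natDegree) (by omega) fun z =>
    hashCode (q x.length) x.length z (hashPoly (q x.length) (elemPoly z) x) ∈ hashLanguage q L
  have hle : uniformProb {z : Fin (q x.length).natDegree → Bool | hashCode (q x.length) x.length (List.ofFn z)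
      (hashPoly (q x.length) (elemPoly (List.ofFn z)) x) ∈ hashLanguage q L} ≤
      uniformProb (badKeys L (q x.length) (q x.length).natDegree x) := by
    refine div_le_div_of_nonneg_right ?_ (Nat.cast_nonneg _)
    exact_mod_cast Set.ncard_le_ncard (fun z hz => mem_badKeys hq hxL hn z hz) (Set.toFinite _)
  refine (uniformProb_le_of_slices (B := {ω : Fin T₁ → Bool |
    simInput (q x.length) x (List.ofFn ω) ∈ hashLanguage q L}) hε fun ω hω => ?_).trans ?_
  · rw [uniformProb_slice (hq _) hx hn hT₁ hT hN]
    exact hM _ (length_hashCode hn (by simp; omega)) hω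
  · exact add_le_add_right (hB.trans_le hle) ε

/-- For `x ∈ L`, the code is in the language of hash values for all keys. -/
theorem le_acceptProb {M : PTM} {N : ℕ} {L : Language Bool} {q : ℕ → (ZMod 2)[X]}
    (hq : ∀ n, Irreducible (q n)) {x : List Bool} (hx : 1 ≤ x.length)
    (hn : x.length.bits.length ≤ (q x.length).natDegree) {T₁ T T₂ : ℕ}
    (hT₁ : 2 * (q x.length).natDegree + 3 ≤ T₁) (hT : 4 ≤ T) (hN : ¬ x.length < N) (hxL : x ∈ L)
    {r : ℝ}
    (hM : ∀ a : List Bool, a.length = 3 * (q x.length).natDegree → a ∈ hashLanguage q L →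
      r ≤ uniformProb {ω : Fin T₂ → Bool | (M.run a ω).state ∈ M.accept}) :
    r ≤ (machine M N L).acceptProb (q x.length) x T₁ T T₂ := by
  refine le_uniformProb_of_slices fun ω => ?_
  rw [uniformProb_slice (hq _) hx hn hT₁ hT hN]
  have hl : (((List.ofFn ω).drop 1).take (q x.length).natDegree).length =
      (q x.length).natDegree := by
    simp; omega
  exact hM _ (length_hashCode hn hl) ⟨x, hxL, hx, hn, _, hl, rfl⟩

end HashStream

/-- A bounded-error algorithm for the hash values of the words of a sparse language yields a
streaming algorithm for this language. -/
theorem mem_Streaming_of_hashLanguage_mem_BTIME {f u t : ℕ → ℕ} (ht : Monotone t)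
    {L : Language Bool} (hL : IsSparse f L) {q : ℕ → (ZMod 2)[X]} (hq : ∀ n, Irreducible (q n))
    (hdeg : ∀ n, (q n).natDegree = 2 * logSize f n + 2) {G : Transducer 1} {c' : ℕ}
    (hG : ∀ n, 1 ≤ n →
      G.ComputesIn ![n.bits] (fieldRep (q n)) (c' * u (10 * logSize f n) + c'))
    (hA : hashLanguage q L ∈ BTIME t) :
    L ∈ Streaming (fun n => u (10 * logSize f n)) (logSize f) (logSize f) (fun _ => 1)
      (fun n => t (10 * logSize f n)) := by
  obtain ⟨M, cM, ε, hε, hM⟩ := hA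
  have hε0 : 0 ≤ ε := by
    obtain ⟨-, h₁, h₂⟩ := hM []
    by_cases h : [] ∈ hashLanguage q L
    · have := (h₁ h).trans (uniformProb_le_one _)
      linarith
    · exact (uniformProb_nonneg _).trans (h₂ h)
  obtain ⟨m, hm⟩ := exists_pow_lt_of_lt_one (show 0 < (1 / 2 - ε) / 2 by linarith)
    (show (1 / 2 : ℝ) < 1 by norm_num)
  -- From `N` on, `L` is sparse, and bad keys contribute less than half of the gap `1 / 2 - ε`.
  obtain ⟨N, hN⟩ := eventually_atTop.1 (hL.and (eventually_le_logSize f m))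
  have hbits : ∀ n, n.bits.length ≤ (q n).natDegree := fun n => by
    have := length_bits_le n
    rw [hdeg, logSize]
    omega
  -- For `v ≤ 1` the inputs of `M` have length up to `12`, which may exceed `10 v`.
  have hsim : ∀ n, cM * t (3 * (q n).natDegree) + cM ≤
      (c' + 10 + cM + cM * t 12) * t (10 * logSize f n) + (c' + 10 + cM + cM * t 12) := fun n => by
    rw [hdeg]
    rcases le_or_gt 2 (logSize f n) with h | h
    · have h₁ := ht (show 3 * (2 * logSize f n + 2) ≤ 10 * logSize f n by omega)
      have h₂ := Nat.mul_le_mul (show cM ≤ c' + 10 + cM + cM * t 12 by omega) h₁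
      omega
    · have h₁ := ht (show 3 * (2 * logSize f n + 2) ≤ 12 by omega)
      have h₂ := Nat.mul_le_mul_left cM h₁
      have := Nat.zero_le ((c' + 10 + cM + cM * t 12) * t (10 * logSize f n))
      omega
  set c := c' + 10 + cM + cM * t 12 with hc
  refine ⟨G, HashStream.machine M N L, c, (ε + 1 / 2) / 2, by linarith, fun n hn => ⟨q n, hq n,
    (hG n hn).mono (add_le_add (Nat.mul_le_mul_right _ (by omega)) (by omega)), ?_⟩⟩
  rintro x rfl
  have h10 : 10 * logSize f x.length ≤ c * logSize f x.length :=
    Nat.mul_le_mul_right _ (by omega)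
  have hd := hdeg x.length
  have hT₁ : 2 * (q x.length).natDegree + 3 ≤ c * logSize f x.length + c := by omega
  have hT : 4 ≤ c * 1 + c := by omega
  have hrun : ∀ a : List Bool, a.length = 3 * (q x.length).natDegree → _ := fun a ha =>
    HashStream.uniformProb_run_of_halted (M := M) (a := a) (T := cM * t a.length + cM)
      (T' := c * t (10 * logSize f x.length) + c) (ha ▸ hsim x.length) (hM a).1
  refine ⟨HashStream.runsWithin (hq _) hn (hbits _) hT₁ (by omega) hT fun a ha =>
    (hrun a ha).1, fun hxL => ?_, fun hxL => ?_⟩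
  · by_cases hxN : x.length < N
    · rw [(HashStream.acceptProb_of_short (hq _) hn (hbits _) hT₁ hT hxN).1 hxL]
      linarith
    · refine (show 1 - (ε + 1 / 2) / 2 ≤ 1 - ε by linarith).trans
        (HashStream.le_acceptProb hq hn (hbits _) hT₁ hT hxN hxL fun a ha haA => ?_)
      rw [(hrun a ha).2]
      exact (hM a).2.1 haA
  · by_cases hxN : x.length < N
    · rw [(HashStream.acceptProb_of_short (hq _) hn (hbits _) hT₁ hT hxN).2 hxL]
      linarith
    · obtain ⟨hs, hv⟩ := hN _ (not_lt.1 hxN)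
      have h₁ := HashStream.acceptProb_le (M := M) hq hn (hbits _) hT₁ hT hxN hxL hε0
        fun a ha haA => ((hrun a ha).2.trans_le ((hM a).2.2 haA))
      have h₂ := uniformProb_badKeys_le (L := L) (hq x.length) hd hs
      have h₃ : (1 / 2 : ℝ) ^ logSize f x.length ≤ (1 / 2) ^ m :=
        pow_le_pow_of_le_one (by norm_num) (by norm_num) hv
      linarith

theorem mainTheorem1 (f t₁ t₂ t₃ u₁ u₂ : ℕ → ℕ)
    (hf : Monotone f) (ht₁ : Monotone t₁) (ht₂ : Monotone t₂) (ht₃ : Monotone t₃)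
    (hu₁ : Monotone u₁) (hu₂ : Monotone u₂) (hf_pos : ∀ n, 0 < f n)
    (hgen : GeneratesIrreducibleIn u₁) (hops : FieldOperationsIn u₂)
    (hf_le : ∀ᶠ n : ℕ in atTop, (f n : ℝ) ≤ 2 ^ ((n : ℝ) / 2))
    (hv : ComputableInTime (logSize f) fun n => u₁ (10 * logSize f n))
    (htime : ∀ᶠ n : ℕ in atTop,
      10 * logSize f n + t₁ n + u₁ (10 * logSize f n) + n * u₂ (10 * logSize f n)
        ≤ t₂ (logSize f n))
    (hL : ∃ L : Language Bool, IsSparse f L ∧ L ∈ NTIME t₁ ∧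
      L ∉ Streaming (fun n => u₁ (10 * logSize f n)) (logSize f) (logSize f) (fun _ => 1)
        (fun n => t₃ (10 * logSize f n))) :
    ∃ A : Language Bool, A ∈ NTIME t₂ ∧ A ∉ BTIME t₃ := by
  obtain ⟨L, hsparse, hLN, hLS⟩ := hL
  obtain ⟨G, c, hG⟩ := hgen
  choose! p hp hdeg hGp using hG
  obtain ⟨T, c', hT⟩ := exists_field_generator hu₁ hGp hv
  have hq : ∀ n, Irreducible (p (2 * logSize f n + 2)) := fun n => hp _ (by omega)
  have hqdeg : ∀ n, (p (2 * logSize f n + 2)).natDegree = 2 * logSize f n + 2 := fun n =>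
    hdeg _ (by omega)
  exact ⟨hashLanguage (fun n => p (2 * logSize f n + 2)) L,
    hashLanguage_mem_NTIME ht₂ hu₂ htime hops hLN hq hqdeg hT,
    fun hA => hLS (mem_Streaming_of_hashLanguage_mem_BTIME ht₃ hsparse hq hqdeg hT hA)⟩
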